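/- Let $H$ be a discrete one-dimensional Schrödinger operator $[H\psi](n)=\psi(n+1)+\psi(n-1)+V(n)\psi(n)$ with real potential $V$, acting as a self-adjoint operator (on its natural domain) in $\ell^2(\mathbb Z)$ or in $\ell^2(\mathbb Z_+)$, $\mathbb Z_+=\{1,2,\dots\}$, in the latter case with the Dirichlet condition $\psi(0)=0$. For $T>0$ let $$a(n,T)=\frac2T\int_0^\infty e^{-2t/T}\,|\langle e^{-itH}\delta_1,\delta_n\rangle|^2\,dt,\qquad \langle |X|^p_{\delta_1}\rangle(T)=\sum_n |n|^p a(n,T),$$ and for $p>0$ let $$\beta^-_{\delta_1}(p)=\liminf_{T\to\infty}\frac{\log\langle |X|^p_{\delta_1}\rangle(T)}{\log T}.$$ Let $\mu$ be the spectral measure of $\delta_1$ with respect to $H$, that is, the finite measure with $\langle (H-z)^{-1}\delta_1,\delta_1\rangle=\int\frac{d\mu(x)}{x-z}$ for non-real $z$. For real solutions $u$ of $u(n+1)+u(n-1)+V(n)u(n)=Eu(n)$ (for all $n\in\mathbb Z$, respectively all $n\ge 1$), call $u$ normalized if $|u(0)|^2+|u(1)|^2=1$, and put $\|u\|_L^2=\sum_{n=1}^{[L]}|u(n)|^2+(L-[L])\,|u([L]+1)|^2$.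 Let $A\subseteq\mathbb R$ be a set with $\mu(A)>0$ such that: (a) $\alpha>0$, and there is $C>0$ such that $\|u\|_L^2\le CL^{2\alpha+1}$ for every $E\in A$, every normalized solution $u$ and every $L\ge1$; (b) there are $0<k,\gamma<1$ and $L_0\ge1$ such that $\|u\|_L^2\ge(1+\gamma)\|u\|_{kL}^2$ for every $E\in A$, every solution $u$ and every $L\ge L_0$. Then there is $\kappa>0$ for which the following holds: (c) there are $D>0$ and $L_1\ge1$ such that $\|u\|_L\ge DL^\kappa$ for every $E\in A$, every normalized solution $u$ and every $L\ge L_1$. Moreover, for every $\kappa>0$ for which (c) holds, $$\beta^-_{\delta_1}(p)\ \ge\ \frac{p(p+2\kappa)}{(p+1)(\alpha+\kappa+1/2)}\qquad\text{for } 0<p\le 2\alpha+1,$$ and $$\beta^-_{\delta_1}(p)\ \ge\ \frac{p}{\alpha+1}\qquad\text{for } p>2\alpha+1.$$ -/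

import Mathlib

open scoped ENNReal

/-- `U` is the strongly continuous one-parameter unitary group `t ↦ exp(-itT)` generated by the
(self-adjoint) operator `T`. -/
structure IsUnitaryGroup {E : Type*} [NormedAddCommGroup E] [InnerProductSpace ℂ E]
    (T : E →ₗ.[ℂ] E) (U : ℝ → E →L[ℂ] E) : Prop where
  zero : U 0 = 1
  add : ∀ s t, U (s + t) = U s * U t
  norm_map : ∀ t ψ, ‖U t ψ‖ = ‖ψ‖
  continuous : ∀ ψ, Continuous fun t => U t ψ
  hasDerivAt : ∀ ψ : T.domain, HasDerivAt (fun t => U t (ψ : E)) (-Complex.I • T ψ) 0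

/-- `μ` is the spectral measure of the vector `φ` with respect to the (self-adjoint) operator `T`:
the finite Borel measure on the line whose Borel transform is the function
`z ↦ ⟨(T - z)⁻¹ φ, φ⟩`, `z` non-real. -/
structure IsSpectralMeasure {E : Type*} [NormedAddCommGroup E] [InnerProductSpace ℂ E]
    (T : E →ₗ.[ℂ] E) (φ : E) (μ : MeasureTheory.Measure ℝ) : Prop where
  finite : MeasureTheory.IsFiniteMeasure μ
  borel : ∀ z : ℂ, z.im ≠ 0 → ∃ ψ : T.domain, T ψ - z • (ψ : E) = φ ∧
    inner ℂ φ (ψ : E) = ∫ x : ℝ, 1 / ((x : ℂ) - z) ∂μ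

/-- The bounded operator `R` is the resolvent `(T + ic)⁻¹`, with the properties which it has for
self-adjoint `T`. -/
structure IsResolventAt {E : Type*} [NormedAddCommGroup E] [InnerProductSpace ℂ E]
    [CompleteSpace E] (T : E →ₗ.[ℂ] E) (c : ℝ) (R : E →L[ℂ] E) : Prop where
  pos : 0 < c
  mem : ∀ φ, R φ ∈ T.domain
  right : ∀ φ, T ⟨R φ, mem φ⟩ + (Complex.I * c) • R φ = φ
  left : ∀ ψ : T.domain, R (T ψ + (Complex.I * c) • (ψ : E)) = ψ
  normal : IsStarNormal R
  dense : DenseRange R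
  rel : R - star R = (-2 * Complex.I * c) • (R * star R)

section resolvent

variable {E : Type*} [NormedAddCommGroup E] [InnerProductSpace ℂ E] [CompleteSpace E]
  {T : E →ₗ.[ℂ] E} {c : ℝ} {R : E →L[ℂ] E}

theorem IsResolventAt.spec (h : IsResolventAt T c R) (r : spectrum ℂ R) :
    (r : ℂ) - star (r : ℂ) = (-2 * Complex.I * c) * (r * star (r : ℂ)) := by
  have hn := h.normal
  set ρ : C(spectrum ℂ R, ℂ) := (ContinuousMap.id ℂ).restrict (spectrum ℂ R) with hρ
  have h1 : cfcHom hn ρ = R := cfcHom_id hn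
  have h2 : cfcHom hn (ρ - star ρ) = cfcHom hn ((-2 * Complex.I * c) • (ρ * star ρ)) := by
    rw [map_sub, map_smul, map_mul, map_star, h1, h.rel]
  have h3 := congrArg (fun f : C(spectrum ℂ R, ℂ) => f r) (cfcHom_injective hn h2)
  simpa [hρ] using h3

theorem IsResolventAt.spec_eq (h : IsResolventAt T c R) (r : spectrum ℂ R) (hr : (r : ℂ) ≠ 0) :
    1 / (r : ℂ) = ((1 / (r : ℂ)).re : ℂ) + Complex.I * c := by
  have h1 := h.spec r
  have hr' : star (r : ℂ) ≠ 0 := by simpa using hr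
  have h2 : star (1 / (r : ℂ)) - 1 / (r : ℂ) = -2 * Complex.I * c := by
    rw [star_div₀, star_one]
    field_simp
    linear_combination h1
  have h3 := congrArg Complex.im h2
  have h4 : -(1 / (r : ℂ)).im - (1 / (r : ℂ)).im = -2 * c := by
    rw [Complex.sub_im, Complex.star_def, Complex.conj_im] at h3
    rw [h3]
    simp
  apply Complex.ext
  · simp
  · simp only [Complex.add_im, Complex.ofReal_im, Complex.mul_im, Complex.I_re, Complex.I_im,
      Complex.ofReal_re, zero_mul, one_mul, zero_add]
    linarith

theorem inv_re_mul_le (r : ℂ) : ‖r‖ * |(1 / r).re| ≤ 1 := by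
  rcases eq_or_ne r 0 with rfl | hr
  · simp
  · calc ‖r‖ * |(1 / r).re| ≤ ‖r‖ * ‖1 / r‖ := by gcongr; exact Complex.abs_re_le_norm _
      _ = 1 := by rw [norm_div, norm_one]; field_simp [norm_ne_zero_iff.2 hr]

theorem norm_expI (θ : ℝ) : ‖Complex.exp (Complex.I * θ)‖ = 1 := by
  rw [mul_comm]; exact Complex.norm_exp_ofReal_mul_I θ

/-- The function `r ↦ r exp(-itx)`, `x = Re (1 / r)`. -/
noncomputable def resExp (R : E →L[ℂ] E) (t : ℝ) : C(spectrum ℂ R, ℂ) where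
  toFun r := r * Complex.exp (Complex.I * ((-t * (1 / (r : ℂ)).re : ℝ) : ℂ))
  continuous_toFun := by
    have : ∀ r : ℂ, ContinuousAt
        (fun r : ℂ => r * Complex.exp (Complex.I * ((-t * (1 / r).re : ℝ) : ℂ))) r := by
      intro r
      rcases eq_or_ne r 0 with rfl | hr
      · have h0 : Filter.Tendsto (fun r : ℂ => ‖r‖) (nhds 0) (nhds 0) := by
          simpa using (continuous_norm (E := ℂ)).tendsto 0
        rw [ContinuousAt, zero_mul]
        refine squeeze_zero_norm (fun r => ?_) h0
        rw [norm_mul, norm_expI, mul_one]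
      · have h1 : ContinuousAt (fun r : ℂ => 1 / r) r :=
          continuousAt_const.div continuousAt_id hr
        have h2 : ContinuousAt (fun r : ℂ => (1 / r).re) r :=
          Complex.continuous_re.continuousAt.comp h1
        have h3 : ContinuousAt (fun r : ℂ => (-t * (1 / r).re : ℝ)) r := h2.const_mul _
        have h4 := Complex.continuous_ofReal.continuousAt.comp h3
        exact continuousAt_id.mul (Complex.continuous_exp.continuousAt.comp
          (continuousAt_const.mul h4))
    exact (continuous_iff_continuousAt.2 this).comp continuous_subtype_val

theorem exists_isUnitaryGroup_of_resolvent (h : IsResolventAt T c R) :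
    ∃ U, IsUnitaryGroup T U := by
  have hn := h.normal
  set Φ := cfcHom hn (R := ℂ) with hΦ
  set ρ : C(spectrum ℂ R, ℂ) := (ContinuousMap.id ℂ).restrict (spectrum ℂ R) with hρ
  have hΦρ : Φ ρ = R := cfcHom_id hn
  have hΦn : ∀ f, ‖Φ f‖ ≤ ‖f‖ := fun f => NonUnitalStarAlgHom.norm_apply_le Φ f
  set m := resExp R with hm
  have m_apply : ∀ t r, m t r =
    r * Complex.exp (Complex.I * ((-t * (1 / (r : ℂ)).re : ℝ) : ℂ)) := fun t r => rfl
  have ρ_apply : ∀ r, ρ r = r := fun r => rfl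
  have m0 : m 0 = ρ := by ext r; simp [m_apply, ρ_apply]
  have mm : ∀ s t, m s * m t = ρ * m (s + t) := by
    intro s t
    ext r
    simp only [ContinuousMap.mul_apply, m_apply, ρ_apply]
    rw [mul_mul_mul_comm, ← Complex.exp_add, mul_assoc]
    congr 3
    push_cast
    ring_nf
  have ms : ∀ t, star (m t) * m t = star ρ * ρ := by
    intro t
    ext r
    simp only [ContinuousMap.mul_apply, ContinuousMap.star_apply, m_apply, ρ_apply, star_mul']
    rw [mul_mul_mul_comm]
    have := Complex.conj_mul' (Complex.exp (Complex.I * ((-t * (1 / (r : ℂ)).re : ℝ) : ℂ)))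
    rw [norm_expI] at this
    simp only [Complex.star_def]
    rw [this]
    simp
  have mnorm : ∀ t η, ‖Φ (m t) η‖ = ‖R η‖ := by
    intro t η
    have key : ∀ f, ‖Φ f η‖ ^ 2 = (inner ℂ η (Φ (star f * f) η)).re := by
      intro f
      rw [map_mul, map_star, mul_apply_eq_comp, ContinuousLinearMap.star_eq_adjoint,
        ContinuousLinearMap.adjoint_inner_right, inner_self_eq_norm_sq_to_K]
      norm_cast
    have h1 : ‖Φ (m t) η‖ ^ 2 = ‖R η‖ ^ 2 := by
      rw [key, ms, ← key, hΦρ]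
    exact (sq_eq_sq₀ (norm_nonneg _) (norm_nonneg _)).1 h1
  set U : ℝ → E →L[ℂ] E := fun t =>
    (Φ (m t) : E →ₗ[ℂ] E).extendOfNorm (R : E →ₗ[ℂ] E) with hU
  have hd : DenseRange (R : E →ₗ[ℂ] E) := h.dense
  have UR : ∀ t η, U t (R η) = Φ (m t) η := fun t η =>
    LinearMap.extendOfNorm_eq hd ⟨1, fun x => by simpa using (mnorm t x).le⟩ η
  have Unorm : ∀ t ψ, ‖U t ψ‖ = ‖ψ‖ := by
    intro t ψ
    refine h.dense.induction (P := fun ψ => ‖U t ψ‖ = ‖ψ‖) ?_ (isClosed_eq (by fun_prop) (by fun_prop)) ψ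
    rintro _ ⟨η, rfl⟩
    rw [UR, mnorm]
  have R_comm : ∀ f η, R (Φ f η) = Φ f (R η) := by
    intro f η
    have h1 : Φ ρ * Φ f = Φ f * Φ ρ := by rw [← map_mul, ← map_mul, mul_comm]
    rw [hΦρ] at h1
    exact congrArg (fun A : E →L[ℂ] E => A η) h1
  have U0 : U 0 = 1 := by
    apply ContinuousLinearMap.ext
    refine fun ψ => h.dense.induction (P := fun ψ => U 0 ψ = (1 : E →L[ℂ] E) ψ) ?_
      (isClosed_eq (by fun_prop) (by fun_prop)) ψ
    rintro _ ⟨η, rfl⟩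
    rw [UR, m0, hΦρ]
    rfl
  have hdd : DenseRange (fun η => R (R η)) := h.dense.comp h.dense R.continuous
  have Uadd : ∀ s t, U (s + t) = U s * U t := by
    intro s t
    apply ContinuousLinearMap.ext
    refine fun ψ => hdd.induction (P := fun ψ => U (s + t) ψ = (U s * U t) ψ) ?_
      (isClosed_eq (by fun_prop) (by fun_prop)) ψ
    rintro _ ⟨η, rfl⟩
    rw [mul_apply_eq_comp, UR t, ← R_comm, UR, UR]
    have h1 : Φ (m s) * Φ (m t) = R * Φ (m (s + t)) := by rw [← map_mul, mm, map_mul, hΦρ]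
    rw [← R_comm]
    exact (congrArg (fun A : E →L[ℂ] E => A η) h1).symm
  have lip0 : ∀ t η, ‖U t (R η) - R η‖ ≤ |t| * ‖η‖ := by
    intro t η
    have h1 : ‖m t - ρ‖ ≤ |t| := by
      rw [ContinuousMap.norm_le _ (abs_nonneg _)]
      intro r
      rw [ContinuousMap.sub_apply, m_apply, ρ_apply, ← mul_sub_one, norm_mul]
      calc _ ≤ ‖(r : ℂ)‖ * |-t * (1 / (r : ℂ)).re| := by
            gcongr
            exact Real.norm_exp_I_mul_ofReal_sub_one_le
        _ = |t| * (‖(r : ℂ)‖ * |(1 / (r : ℂ)).re|) := by rw [abs_mul, abs_neg]; ring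
        _ ≤ |t| * 1 := by gcongr; exact inv_re_mul_le _
        _ = |t| := mul_one _
    calc ‖U t (R η) - R η‖ = ‖Φ (m t - ρ) η‖ := by
          rw [UR, map_sub, hΦρ]; rfl
      _ ≤ ‖Φ (m t - ρ)‖ * ‖η‖ := ContinuousLinearMap.le_opNorm _ _
      _ ≤ |t| * ‖η‖ := by gcongr; exact (hΦn _).trans h1
  have tendsto0 : ∀ ψ, Filter.Tendsto (fun t => ‖U t ψ - ψ‖) (nhds 0) (nhds 0) := by
    intro ψ
    rw [Metric.tendsto_nhds]
    intro ε hε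
    obtain ⟨η, hη⟩ := h.dense.exists_dist_lt ψ (show 0 < ε / 3 by positivity)
    have hl : Filter.Tendsto (fun t : ℝ => |t| * ‖η‖) (nhds 0) (nhds 0) := by
      have : Continuous (fun t : ℝ => |t| * ‖η‖) := by fun_prop
      simpa using this.tendsto 0
    filter_upwards [hl.eventually (gt_mem_nhds (show 0 < ε / 3 by positivity))] with t ht
    rw [dist_zero_right, norm_norm]
    rw [dist_eq_norm] at hη
    have e : U t ψ - ψ = U t (ψ - R η) + (U t (R η) - R η) - (ψ - R η) := by
      rw [map_sub]; abel
    calc ‖U t ψ - ψ‖ ≤ ‖U t (ψ - R η)‖ + ‖U t (R η) - R η‖ + ‖ψ - R η‖ := by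
          rw [e]; exact (norm_sub_le _ _).trans (by gcongr; exact norm_add_le _ _)
      _ < ε := by rw [Unorm]; linarith [lip0 t η]
  have Ucont : ∀ ψ, Continuous fun t => U t ψ := by
    intro ψ
    rw [continuous_iff_continuousAt]
    intro s
    rw [ContinuousAt, tendsto_iff_norm_sub_tendsto_zero]
    have h1 : Filter.Tendsto (fun t : ℝ => t - s) (nhds s) (nhds 0) := by
      have : Continuous (fun t : ℝ => t - s) := by fun_prop
      simpa using this.tendsto s
    refine ((tendsto0 ψ).comp h1).congr fun t => ?_
    have : U t ψ - U s ψ = U s (U (t - s) ψ - ψ) := by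
      rw [map_sub, ← mul_apply_eq_comp, ← Uadd]; simp
    rw [this, Unorm]; rfl
  refine ⟨U, U0, Uadd, Unorm, Ucont, ?_⟩
  intro ψ
  set η := T ψ + (Complex.I * c) • (ψ : E) with hη
  have hψ : (ψ : E) = R η := (h.left ψ).symm
  have hTψ : T ψ = η - (Complex.I * c) • R η := by rw [← hψ, hη]; abel
  rw [hTψ, hψ]
  set B : ℝ → E → E := fun t η => U t (R η) - R η - t • (-Complex.I • (η - (Complex.I * c) • R η))
    with hB
  have B_sub : ∀ t η ξ, B t (η - ξ) = B t η - B t ξ := by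
    intro t η ξ
    simp only [hB, map_sub, smul_sub]
    abel
  set K := 1 + (1 + c * ‖R‖) with hK
  have hc := h.pos
  have B1 : ∀ t η, ‖B t η‖ ≤ |t| * (K * ‖η‖) := by
    intro t η
    calc ‖B t η‖ ≤ ‖U t (R η) - R η‖ + ‖t • (-Complex.I • (η - (Complex.I * c) • R η))‖ :=
          norm_sub_le _ _
      _ ≤ |t| * ‖η‖ + |t| * (‖η‖ + c * (‖R‖ * ‖η‖)) := by
          gcongr
          · exact lip0 t η
          · rw [norm_smul, norm_smul, Real.norm_eq_abs, norm_neg, Complex.norm_I, one_mul]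
            gcongr
            refine (norm_sub_le _ _).trans ?_
            gcongr
            rw [norm_smul, norm_mul, Complex.norm_I, one_mul, Complex.norm_real,
              Real.norm_of_nonneg hc.le]
            gcongr
            exact R.le_opNorm _
      _ = |t| * (K * ‖η‖) := by rw [hK]; ring
  have exp2 : ∀ θ : ℝ, ‖Complex.exp (Complex.I * θ) - 1 - Complex.I * θ‖ ≤ 2 * θ ^ 2 := by
    intro θ
    rcases le_total |θ| 1 with h1 | h1
    · have := Complex.norm_exp_sub_one_sub_id_le (x := Complex.I * θ) (by simpa using h1)
      refine this.trans ?_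
      simp
      nlinarith [sq_nonneg θ]
    · calc _ ≤ ‖Complex.exp (Complex.I * θ) - 1‖ + ‖Complex.I * θ‖ := norm_sub_le _ _
        _ ≤ |θ| + |θ| := by
            gcongr
            · exact Real.norm_exp_I_mul_ofReal_sub_one_le
            · simp
        _ ≤ 2 * θ ^ 2 := by nlinarith [sq_abs θ]
  have B2 : ∀ t ξ, ‖B t (R ξ)‖ ≤ 2 * t ^ 2 * ‖ξ‖ := by
    intro t ξ
    set f : C(spectrum ℂ R, ℂ) :=
      m t * ρ - ρ * ρ - (t : ℂ) • (-Complex.I • (ρ - (Complex.I * c) • (ρ * ρ))) with hf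
    have h1 : B t (R ξ) = Φ f ξ := by
      simp only [hf, hB, map_sub, map_smul, map_mul, hΦρ, UR]
      simp
    have h2 : ‖f‖ ≤ 2 * t ^ 2 := by
      rw [ContinuousMap.norm_le _ (by positivity)]
      intro r
      have hfr : f r = (r : ℂ) ^ 2 * (Complex.exp (Complex.I * ((-t * (1 / (r : ℂ)).re : ℝ) : ℂ)) -
          1 - Complex.I * ((-t * (1 / (r : ℂ)).re : ℝ) : ℂ)) := by
        simp only [hf, ContinuousMap.sub_apply, ContinuousMap.smul_apply, ContinuousMap.mul_apply,
          m_apply, ρ_apply, smul_eq_mul]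
        rcases eq_or_ne (r : ℂ) 0 with hr | hr
        · simp [hr]
        · have h3 := h.spec_eq r hr
          have h4 : (1 : ℂ) - Complex.I * c * r = r * ((1 / (r : ℂ)).re : ℂ) := by
            have : (1 : ℂ) = r * (1 / r) := by field_simp
            linear_combination this + r * h3
          push_cast
          linear_combination (t * Complex.I * r) * h4
      rw [hfr, norm_mul, norm_pow]
      calc _ ≤ ‖(r : ℂ)‖ ^ 2 * (2 * (-t * (1 / (r : ℂ)).re) ^ 2) := by
            gcongr
            exact exp2 _
        _ = 2 * t ^ 2 * (‖(r : ℂ)‖ * |(1 / (r : ℂ)).re|) ^ 2 := by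
            rw [mul_pow, mul_pow, sq_abs]; ring
        _ ≤ 2 * t ^ 2 * 1 ^ 2 := by
            gcongr
            exact inv_re_mul_le _
        _ = 2 * t ^ 2 := by ring
    rw [h1]
    exact (ContinuousLinearMap.le_opNorm _ _).trans (by gcongr; exact (hΦn f).trans h2)
  rw [hasDerivAt_iff_isLittleO_nhds_zero]
  have hgoal : (fun t : ℝ => U (0 + t) (R η) - U 0 (R η) -
      t • (-Complex.I • (η - (Complex.I * c) • R η))) = fun t => B t η := by
    funext t
    rw [zero_add, U0]; rfl
  rw [hgoal, Asymptotics.isLittleO_iff]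
  intro ε hε
  have hKpos : 0 < K := by positivity
  obtain ⟨ξ, hξ⟩ := h.dense.exists_dist_lt η (show 0 < ε / (2 * K) by positivity)
  rw [dist_eq_norm] at hξ
  have hl : Filter.Tendsto (fun t : ℝ => 2 * |t| * ‖ξ‖) (nhds 0) (nhds 0) := by
    have : Continuous (fun t : ℝ => 2 * |t| * ‖ξ‖) := by fun_prop
    simpa using this.tendsto 0
  filter_upwards [hl.eventually (gt_mem_nhds (show 0 < ε / 2 by positivity))] with t ht
  have e : B t η = B t (η - R ξ) + B t (R ξ) := by rw [B_sub]; abel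
  have h5 : K * ‖η - R ξ‖ ≤ ε / 2 := by
    have := mul_le_mul_of_nonneg_left hξ.le hKpos.le
    calc _ ≤ _ := this
      _ = ε / 2 := by field_simp
  calc ‖B t η‖ ≤ ‖B t (η - R ξ)‖ + ‖B t (R ξ)‖ := by rw [e]; exact norm_add_le _ _
    _ ≤ |t| * (K * ‖η - R ξ‖) + 2 * t ^ 2 * ‖ξ‖ := add_le_add (B1 _ _) (B2 _ _)
    _ = |t| * (K * ‖η - R ξ‖) + |t| * (2 * |t| * ‖ξ‖) := by rw [← sq_abs t]; ring
    _ ≤ |t| * (ε / 2) + |t| * (ε / 2) := by gcongr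
    _ = ε * ‖t‖ := by rw [Real.norm_eq_abs]; ring

theorem exists_isSpectralMeasure_of_resolvent (h : IsResolventAt T c R) (φ : E) :
    ∃ μ, IsSpectralMeasure T φ μ := by
  have hn := h.normal
  let X := spectrum ℂ R
  let Φ : C(X, ℂ) →⋆ₐ[ℂ] E →L[ℂ] E := cfcHom hn
  set ρ : C(X, ℂ) := (ContinuousMap.id ℂ).restrict X with hρ
  have hΦρ : Φ ρ = R := cfcHom_id (R := ℂ) hn
  have ρ_apply : ∀ r, ρ r = r := fun r => rfl
  have : CompactSpace X := isCompact_iff_compactSpace.1 (spectrum.isCompact R)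
  -- the positive functional of the vector
  let cplx : CompactlySupportedContinuousMap X ℝ → C(X, ℂ) := fun f =>
    ⟨fun r => (f r : ℂ), Complex.continuous_ofReal.comp f.continuous⟩
  have cplx_apply : ∀ f r, cplx f r = (f r : ℂ) := fun f r => rfl
  let L : CompactlySupportedContinuousMap X ℝ →ₗ[ℝ] ℝ :=
    { toFun := fun f => (inner ℂ φ (Φ (cplx f) φ)).re
      map_add' := fun f g => by
        have : cplx (f + g) = cplx f + cplx g := by ext r; simp [cplx_apply]
        rw [this, map_add, add_apply, inner_add_right, Complex.add_re]
      map_smul' := fun a f => by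
        have : cplx (a • f) = (a : ℂ) • cplx f := by ext r; simp [cplx_apply]
        rw [this, map_smul, smul_apply, inner_smul_right]
        simp }
  have hLpos : ∀ f, 0 ≤ f → 0 ≤ L f := by
    intro f hf
    let g : C(X, ℂ) := ⟨fun r => ((Real.sqrt (f r) : ℝ) : ℂ),
      Complex.continuous_ofReal.comp (Real.continuous_sqrt.comp f.continuous)⟩
    have hg : cplx f = star g * g := by
      ext r
      have h0 : (0 : ℝ) ≤ f r := hf r
      change ((f r : ℝ) : ℂ) = star ((Real.sqrt (f r) : ℝ) : ℂ) * ((Real.sqrt (f r) : ℝ) : ℂ)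
      rw [Complex.star_def, Complex.conj_ofReal, ← Complex.ofReal_mul, Real.mul_self_sqrt h0]
    change 0 ≤ (inner ℂ φ (Φ (cplx f) φ)).re
    rw [hg, map_mul, map_star, mul_apply_eq_comp, ContinuousLinearMap.star_eq_adjoint,
        ContinuousLinearMap.adjoint_inner_right]
    exact inner_self_nonneg (𝕜 := ℂ)
  set Λ := PositiveLinearMap.mk₀ L hLpos with hΛ
  set ν := RealRMK.rieszMeasure Λ with hν
  have hint : ∀ f : CompactlySupportedContinuousMap X ℝ,
      ∫ r, f r ∂ν = (inner ℂ φ (Φ (cplx f) φ)).re := fun f => RealRMK.integral_rieszMeasure Λ f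
  have : MeasureTheory.IsFiniteMeasure ν := by
    have : MeasureTheory.IsFiniteMeasureOnCompacts ν := by
      rw [hν]; infer_instance
    infer_instance
  -- the inner products are integrals
  have real_im : ∀ f, (inner ℂ φ (Φ (cplx f) φ)).im = 0 := by
    intro f
    have hs : star (cplx f) = cplx f := by
      ext r; simp [cplx_apply]
    have h1 : inner ℂ φ (Φ (cplx f) φ) = inner ℂ (Φ (cplx f) φ) φ := by
      conv_lhs => rw [← hs, map_star, ContinuousLinearMap.star_eq_adjoint]
      rw [ContinuousLinearMap.adjoint_inner_right]
    have h2 := congrArg Complex.im ((inner_conj_symm (𝕜 := ℂ) φ (Φ (cplx f) φ)).trans h1)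
    rw [← h1] at h2
    have h3 := congrArg Complex.im (inner_conj_symm (𝕜 := ℂ) φ (Φ (cplx f) φ))
    rw [← h1, Complex.conj_im] at h3
    linarith
  have hint' : ∀ q : C(X, ℂ), inner ℂ φ (Φ q φ) = ∫ r, q r ∂ν := by
    intro q
    let q1 : CompactlySupportedContinuousMap X ℝ :=
      ⟨⟨fun r => (q r).re, Complex.continuous_re.comp q.continuous⟩,
        HasCompactSupport.of_compactSpace _⟩
    let q2 : CompactlySupportedContinuousMap X ℝ :=
      ⟨⟨fun r => (q r).im, Complex.continuous_im.comp q.continuous⟩,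
        HasCompactSupport.of_compactSpace _⟩
    have hq : q = cplx q1 + Complex.I • cplx q2 := by
      ext r
      change q r = ((q r).re : ℂ) + Complex.I * ((q r).im : ℂ)
      rw [mul_comm, Complex.re_add_im]
    have hqi : MeasureTheory.Integrable (fun r => q r) ν := by
      exact q.continuous.integrable_of_hasCompactSupport (HasCompactSupport.of_compactSpace _)
    have h1 : inner ℂ φ (Φ (cplx q1) φ) = ((∫ r, q1 r ∂ν : ℝ) : ℂ) :=
      Complex.ext (by rw [hint]; simp) (by rw [real_im]; simp)
    have h2 : inner ℂ φ (Φ (cplx q2) φ) = ((∫ r, q2 r ∂ν : ℝ) : ℂ) :=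
      Complex.ext (by rw [hint]; simp) (by rw [real_im]; simp)
    calc inner ℂ φ (Φ q φ) = inner ℂ φ (Φ (cplx q1) φ) + Complex.I * inner ℂ φ (Φ (cplx q2) φ) := by
          conv_lhs => rw [hq]
          rw [map_add, map_smul, add_apply, smul_apply,
            inner_add_right, inner_smul_right]
      _ = ∫ r, q r ∂ν := by
          rw [h1, h2, mul_comm]
          exact integral_re_add_im (𝕜 := ℂ) hqi
  have hxm : Measurable (fun r : X => (1 / (r : ℂ)).re) :=
    Complex.measurable_re.comp ((measurable_const.div measurable_subtype_coe))
  have h0m : MeasurableSet {r : X | (r : ℂ) ≠ 0} :=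
    (measurable_subtype_coe (measurableSet_singleton (0 : ℂ))).compl
  refine ⟨(ν.restrict {r : X | (r : ℂ) ≠ 0}).map (fun r : X => (1 / (r : ℂ)).re),
    inferInstance, ?_⟩
  intro z hz
  have hden : ∀ r : X, (1 : ℂ) - (z + Complex.I * c) * r ≠ 0 := by
    intro r h0
    have hr : (r : ℂ) ≠ 0 := by rintro hr; simp [hr] at h0
    have h1 := h.spec_eq r hr
    have h2 : z = ((1 / (r : ℂ)).re : ℂ) := by
      have h3 : 1 / (r : ℂ) = z + Complex.I * c := by
        rw [div_eq_iff hr]; linear_combination h0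
      rw [h3] at h1
      rw [h3]
      linear_combination h1
    apply hz
    rw [h2, Complex.ofReal_im]
  let s : C(X, ℂ) := ⟨fun r => 1 / (1 - (z + Complex.I * c) * r),
    continuous_const.div (by fun_prop) hden⟩
  have hs : (1 - (z + Complex.I * c) • ρ) * s = 1 := by
    ext r
    change (1 - (z + Complex.I * c) * r) * (1 / (1 - (z + Complex.I * c) * r)) = (1 : ℂ)
    field_simp [hden r]
  have hs' := congrArg (fun A : E →L[ℂ] E => A φ) (congrArg Φ hs)
  simp only [map_mul, map_sub, map_one, map_smul, hΦρ, mul_apply_eq_comp,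
    sub_apply, one_apply_eq_self,
    smul_apply] at hs'
  refine ⟨⟨R (Φ s φ), h.mem _⟩, ?_, ?_⟩
  · have h1 := h.right (Φ s φ)
    rw [add_smul, ← sub_sub] at hs'
    rw [eq_sub_of_add_eq h1]
    refine Eq.trans ?_ hs'
    simp only
    abel
  · change inner ℂ φ (R (Φ s φ)) = _
    rw [MeasureTheory.integral_map hxm.aemeasurable]
    · have e1 : R (Φ s φ) = Φ (ρ * s) φ := by
        rw [map_mul, hΦρ]; rfl
      rw [e1, hint', ← MeasureTheory.integral_indicator h0m]
      congr 1
      funext r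
      by_cases hr : (r : ℂ) = 0
      · simp [Set.indicator, hr, ρ_apply]
      · rw [Set.indicator_of_mem (by exact hr)]
        have h1 := h.spec_eq r hr
        have h3 : ((1 / (r : ℂ)).re : ℂ) - z = 1 / r - (z + Complex.I * c) := by
          linear_combination -h1
        rw [h3]
        change (r : ℂ) * (1 / (1 - (z + Complex.I * c) * r)) = _
        have h4 : 1 / (r : ℂ) - (z + Complex.I * c) = (1 - (z + Complex.I * c) * r) / r := by
          field_simp
        rw [h4, one_div_div, mul_one_div]
    · have : Measurable (fun x : ℝ => 1 / ((x : ℂ) - z)) :=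
        measurable_const.div (Complex.measurable_ofReal.sub_const z)
      exact this.aestronglyMeasurable

end resolvent

/-- The Hilbert space `ℓ²(S)`, `S ⊆ ℤ`. -/
noncomputable abbrev Ell2 (S : Set ℤ) := lp (fun _ : S => ℂ) 2

/-- Extension by zero of a sequence on `S` to `ℤ`; for `S = {1, 2, …}` this puts the Dirichlet
condition `ψ 0 = 0`. -/
noncomputable def zeroExt {S : Set ℤ} (ψ : S → ℂ) (n : ℤ) : ℂ :=
  open Classical in if h : n ∈ S then ψ ⟨n, h⟩ else 0

/-- The difference expression `(H ψ)(n) = ψ(n + 1) + ψ(n - 1) + V(n) ψ(n)`, `n ∈ S`. -/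
noncomputable def schrodingerExpr {S : Set ℤ} (V : ℤ → ℝ) (ψ : S → ℂ) (n : S) : ℂ :=
  zeroExt ψ (n + 1) + zeroExt ψ (n - 1) + (V n : ℂ) * ψ n

theorem zeroExt_add {S : Set ℤ} (ψ φ : S → ℂ) (n : ℤ) :
    zeroExt (ψ + φ) n = zeroExt ψ n + zeroExt φ n := by
  unfold zeroExt; split_ifs <;> simp

theorem zeroExt_smul {S : Set ℤ} (a : ℂ) (ψ : S → ℂ) (n : ℤ) :
    zeroExt (a • ψ) n = a * zeroExt ψ n := by
  unfold zeroExt; split_ifs <;> simp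

theorem zeroExt_zero {S : Set ℤ} (n : ℤ) : zeroExt (0 : S → ℂ) n = 0 := by
  unfold zeroExt; split_ifs <;> simp

theorem schrodingerExpr_add {S : Set ℤ} (V : ℤ → ℝ) (ψ φ : S → ℂ) :
    schrodingerExpr V (ψ + φ) = schrodingerExpr V ψ + schrodingerExpr V φ := by
  funext n
  simp only [schrodingerExpr, zeroExt_add, Pi.add_apply]
  ring

theorem schrodingerExpr_smul {S : Set ℤ} (V : ℤ → ℝ) (a : ℂ) (ψ : S → ℂ) :
    schrodingerExpr V (a • ψ) = a • schrodingerExpr V ψ := by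
  funext n
  simp only [schrodingerExpr, zeroExt_smul, Pi.smul_apply, smul_eq_mul]
  ring

theorem schrodingerExpr_zero {S : Set ℤ} (V : ℤ → ℝ) :
    schrodingerExpr V (0 : S → ℂ) = 0 := by
  funext n
  simp [schrodingerExpr, zeroExt_zero]

/-- The discrete Schrödinger operator `H` in `ℓ²(S)` with potential `V`, on its natural domain
`{ψ ∈ ℓ²(S) | H ψ ∈ ℓ²(S)}` (which is all of `ℓ²(S)` if `V` is bounded). -/
noncomputable def schrodinger (S : Set ℤ) (V : ℤ → ℝ) : Ell2 S →ₗ.[ℂ] Ell2 S where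
  domain :=
    { carrier := {ψ | Memℓp (schrodingerExpr V ψ) 2}
      zero_mem' := by
        rw [Set.mem_ofPred_eq, lp.coeFn_zero, schrodingerExpr_zero]
        exact zero_memℓp
      add_mem' := by
        intro ψ φ hψ hφ
        rw [Set.mem_ofPred_eq, lp.coeFn_add, schrodingerExpr_add]
        exact hψ.add hφ
      smul_mem' := by
        intro a ψ hψ
        rw [Set.mem_ofPred_eq, lp.coeFn_smul, schrodingerExpr_smul]
        exact hψ.const_smul a }
  toFun :=
    { toFun := fun ψ => ⟨schrodingerExpr V (ψ : Ell2 S), ψ.2⟩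
      map_add' := fun ψ φ => by
        apply lp.ext
        exact schrodingerExpr_add V _ _
      map_smul' := fun a ψ => by
        apply lp.ext
        exact schrodingerExpr_smul V _ _ }

/-- `ψ ∈ ℓ²(S)` is square-summable, and so is every translate of its extension by zero. -/
theorem summable_zeroExt {S : Set ℤ} (ψ : Ell2 S) :
    Summable (fun n : ℤ => ‖zeroExt ψ n‖ ^ (2 : ℝ)) ∧
      ∑' n : ℤ, ‖zeroExt ψ n‖ ^ (2 : ℝ) = ‖ψ‖ ^ (2 : ℝ) := by
  have h1 : HasSum (fun n : S => ‖ψ n‖ ^ (2 : ℝ)) (‖ψ‖ ^ (2 : ℝ)) := by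
    have := lp.hasSum_norm (p := 2) (by norm_num) ψ
    simpa using this
  have h2 : (fun n : S => ‖ψ n‖ ^ (2 : ℝ)) =
      (fun n : ℤ => ‖zeroExt ψ n‖ ^ (2 : ℝ)) ∘ ((↑) : S → ℤ) := by
    funext n
    simp [zeroExt]
  rw [h2] at h1
  have h3 := (Subtype.val_injective.hasSum_iff (f := fun n : ℤ => ‖zeroExt ψ n‖ ^ (2 : ℝ))
    (fun n hn => ?_)).1 h1
  · exact ⟨h3.summable, h3.tsum_eq⟩
  · have : n ∉ S := by simpa using hn
    simp [zeroExt, this]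

theorem summable_shift {S : Set ℤ} (ψ : Ell2 S) (k : ℤ) :
    Summable (fun n : S => ‖zeroExt ψ ((n : ℤ) + k)‖ ^ (2 : ℝ)) ∧
      ∑' n : S, ‖zeroExt ψ ((n : ℤ) + k)‖ ^ (2 : ℝ) ≤ ‖ψ‖ ^ (2 : ℝ) := by
  obtain ⟨h1, h2⟩ := summable_zeroExt ψ
  have hi : Function.Injective (fun n : S => (n : ℤ) + k) := fun a b h => by
    apply Subtype.ext; simpa using h
  have h3 : Summable (fun n : S => ‖zeroExt ψ ((n : ℤ) + k)‖ ^ (2 : ℝ)) := h1.comp_injective hi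
  refine ⟨h3, ?_⟩
  rw [← h2]
  exact h3.tsum_le_tsum_of_inj (fun n : S => (n : ℤ) + k) hi (fun _ _ => by positivity)
    (fun _ => le_rfl) h1

/-- The translation `(A ψ)(n) = ψ(n + k)` (with extension by zero) as a bounded operator. -/
noncomputable def shiftOp (S : Set ℤ) (k : ℤ) : Ell2 S →L[ℂ] Ell2 S :=
  LinearMap.mkContinuous
    { toFun := fun ψ => ⟨fun n => zeroExt ψ ((n : ℤ) + k),
        memℓp_gen (by simpa using (summable_shift ψ k).1)⟩
      map_add' := fun ψ φ => by
        apply lp.ext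
        funext n
        exact zeroExt_add _ _ _
      map_smul' := fun a ψ => by
        apply lp.ext
        funext n
        exact zeroExt_smul _ _ _ } 1 (fun ψ => by
      rw [one_mul]
      refine lp.norm_le_of_tsum_le (by norm_num) (norm_nonneg _) ?_
      simpa using (summable_shift ψ k).2)

theorem shiftOp_apply {S : Set ℤ} (k : ℤ) (ψ : Ell2 S) (n : S) :
    shiftOp S k ψ n = zeroExt ψ ((n : ℤ) + k) := rfl

theorem inner_shiftOp {S : Set ℤ} (k : ℤ) (φ ψ : Ell2 S) :
    inner ℂ φ (shiftOp S k ψ) = inner ℂ (shiftOp S (-k) φ) ψ := by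
  have h1 : ∀ (φ ψ : Ell2 S) (k : ℤ), inner ℂ φ (shiftOp S k ψ) =
      ∑' n : ℤ, inner ℂ (zeroExt φ n) (zeroExt ψ (n + k)) := by
    intro φ ψ k
    rw [lp.inner_eq_tsum]
    have h2 : (fun n : S => inner ℂ (φ n) (shiftOp S k ψ n)) =
        fun n : S => (fun n : ℤ => inner ℂ (zeroExt φ n) (zeroExt ψ (n + k))) n := by
      funext n
      rw [shiftOp_apply]
      simp [zeroExt]
    rw [h2]
    refine tsum_subtype_eq_of_support_subset (s := S)
      (f := fun n : ℤ => inner ℂ (zeroExt φ n) (zeroExt ψ (n + k))) ?_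
    intro n hn
    by_contra hS
    apply hn
    simp [zeroExt, hS]
  rw [h1, ← inner_conj_symm (shiftOp S (-k) φ) ψ, h1, Complex.conj_tsum]
  conv_rhs => rw [← (Equiv.addRight k).tsum_eq]
  refine tsum_congr fun n => ?_
  rw [inner_conj_symm]
  simp

/-- The free part `(Δ ψ)(n) = ψ(n + 1) + ψ(n - 1)`. -/
noncomputable def hopping (S : Set ℤ) : Ell2 S →L[ℂ] Ell2 S := shiftOp S 1 + shiftOp S (-1)

theorem inner_hopping {S : Set ℤ} (φ ψ : Ell2 S) :
    inner ℂ φ (hopping S ψ) = inner ℂ (hopping S φ) ψ := by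
  have h := inner_shiftOp (-1) φ ψ
  rw [neg_neg] at h
  rw [hopping, add_apply, add_apply, inner_add_right, inner_add_left,
    inner_shiftOp 1, h, add_comm]

theorem schrodingerExpr_eq {S : Set ℤ} (V : ℤ → ℝ) (ψ : Ell2 S) (n : S) :
    schrodingerExpr V ψ n = hopping S ψ n + (V n : ℂ) * ψ n := rfl

theorem schrodinger_apply {S : Set ℤ} (V : ℤ → ℝ) (ψ : (schrodinger S V).domain) (n : S) :
    schrodinger S V ψ n = hopping S (ψ : Ell2 S) n + (V n : ℂ) * (ψ : Ell2 S) n := rfl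

theorem schrodinger_symm {S : Set ℤ} {V : ℤ → ℝ} (φ ψ : (schrodinger S V).domain) :
    inner ℂ (φ : Ell2 S) (schrodinger S V ψ) = inner ℂ (schrodinger S V φ) (ψ : Ell2 S) := by
  have h : ∀ φ : (schrodinger S V).domain, ∀ n : S,
      (schrodinger S V φ - hopping S (φ : Ell2 S) : Ell2 S) n = (V n : ℂ) * (φ : Ell2 S) n := by
    intro φ n
    rw [lp.coeFn_sub, Pi.sub_apply, schrodinger_apply]
    ring
  have h1 : inner ℂ (φ : Ell2 S) (schrodinger S V ψ - hopping S (ψ : Ell2 S)) =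
      inner ℂ (schrodinger S V φ - hopping S (φ : Ell2 S)) (ψ : Ell2 S) := by
    rw [lp.inner_eq_tsum, lp.inner_eq_tsum]
    refine tsum_congr fun n => ?_
    rw [h, h]
    simp only [RCLike.inner_apply, map_mul, Complex.conj_ofReal]
    ring
  rw [inner_sub_right, inner_sub_left, inner_hopping] at h1
  exact sub_left_inj.1 h1

/-- The bounded diagonal operator `(V + ic)⁻¹`. -/
theorem exists_diagonal (S : Set ℤ) (V : ℤ → ℝ) (c : ℝ) (hc : c ≠ 0) :
    ∃ M : Ell2 S →L[ℂ] Ell2 S, ‖M‖ ≤ 1 / |c| ∧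
      ∀ ψ n, M ψ n = (1 / ((V n : ℂ) + Complex.I * c)) * ψ n := by
  have hc' : 0 < |c| := abs_pos.2 hc
  have hb : ∀ n : S, ‖1 / ((V n : ℂ) + Complex.I * c)‖ ≤ 1 / |c| := by
    intro n
    rw [norm_div, norm_one]
    refine one_div_le_one_div_of_le hc' ?_
    have := Complex.abs_im_le_norm ((V n : ℂ) + Complex.I * c)
    simpa using this
  have hb' : ∀ (ψ : Ell2 S) (n : S), ‖(1 / ((V n : ℂ) + Complex.I * c)) * ψ n‖ ≤
      ‖((1 / |c| : ℝ) : ℂ) • ψ n‖ := by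
    intro ψ n
    rw [norm_mul, norm_smul, Complex.norm_real, Real.norm_of_nonneg (by positivity)]
    gcongr
    exact hb n
  have hmem : ∀ ψ : Ell2 S, Memℓp (fun n : S => (1 / ((V n : ℂ) + Complex.I * c)) * ψ n) 2 :=
    fun ψ => (lp.memℓp (((1 / |c| : ℝ) : ℂ) • ψ)).mono' (hb' ψ)
  let L : Ell2 S →ₗ[ℂ] Ell2 S :=
    { toFun := fun ψ => ⟨_, hmem ψ⟩
      map_add' := fun ψ φ => by
        apply lp.ext
        funext n
        exact mul_add _ _ _
      map_smul' := fun a ψ => by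
        apply lp.ext
        funext n
        exact mul_left_comm _ _ _ }
  have hL : ∀ ψ, ‖L ψ‖ ≤ 1 / |c| * ‖ψ‖ := by
    intro ψ
    have h1 : ‖L ψ‖ ≤ ‖((1 / |c| : ℝ) : ℂ) • ψ‖ :=
      lp.norm_mono (by norm_num) (fun n => hb' ψ n)
    rwa [norm_smul, Complex.norm_real, Real.norm_of_nonneg (by positivity)] at h1
  exact ⟨L.mkContinuous _ hL, L.mkContinuous_norm_le (by positivity) hL, fun _ _ => rfl⟩

/-- `H + ic` is onto, with bounded right inverse, if `|c|` is large. -/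
theorem exists_rightInverse (S : Set ℤ) (V : ℤ → ℝ) (c : ℝ) (hc : ‖hopping S‖ < |c|) :
    ∃ R : Ell2 S →L[ℂ] Ell2 S, ∀ φ, ∃ h : R φ ∈ (schrodinger S V).domain,
      schrodinger S V ⟨R φ, h⟩ + (Complex.I * c) • R φ = φ := by
  have hc0 : 0 < |c| := (norm_nonneg _).trans_lt hc
  obtain ⟨M, hM, hMa⟩ := exists_diagonal S V c (abs_pos.1 hc0)
  have hlt : ‖-(hopping S * M)‖ < 1 := by
    rw [norm_neg]
    calc ‖hopping S * M‖ ≤ ‖hopping S‖ * ‖M‖ := norm_mul_le _ _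
      _ ≤ ‖hopping S‖ * (1 / |c|) := by gcongr
      _ < 1 := by rw [mul_one_div, div_lt_one hc0]; exact hc
  set N := Units.oneSub (-(hopping S * M)) hlt with hN
  have hNval : (N : Ell2 S →L[ℂ] Ell2 S) = 1 + hopping S * M := by
    rw [hN, Units.val_oneSub, sub_neg_eq_add]
  refine ⟨M * ((N⁻¹ : (Ell2 S →L[ℂ] Ell2 S)ˣ) : Ell2 S →L[ℂ] Ell2 S), fun φ => ?_⟩
  set η := ((N⁻¹ : (Ell2 S →L[ℂ] Ell2 S)ˣ) : Ell2 S →L[ℂ] Ell2 S) φ with hη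
  have hφ : η + hopping S (M η) = φ := by
    have h1 : (N : Ell2 S →L[ℂ] Ell2 S) * ((N⁻¹ : (Ell2 S →L[ℂ] Ell2 S)ˣ) : Ell2 S →L[ℂ] Ell2 S) = 1 :=
      N.mul_inv
    rw [hNval] at h1
    exact congrArg (fun A : Ell2 S →L[ℂ] Ell2 S => A φ) h1
  change ∃ h : M η ∈ (schrodinger S V).domain,
    schrodinger S V ⟨M η, h⟩ + (Complex.I * c) • M η = φ
  have hne : ∀ n : S, (V n : ℂ) + Complex.I * c ≠ 0 := by
    intro n h0
    have := congrArg Complex.im h0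
    simp at this
    exact (abs_pos.1 hc0) this
  have key : schrodingerExpr V (M η) = (φ - (Complex.I * c) • M η : Ell2 S) := by
    funext n
    rw [schrodingerExpr_eq, ← hφ]
    simp only [lp.coeFn_sub, lp.coeFn_add, lp.coeFn_smul, Pi.sub_apply, Pi.add_apply,
      Pi.smul_apply, smul_eq_mul, hMa]
    field_simp [hne n]
    ring
  have hmem : M η ∈ (schrodinger S V).domain := by
    change Memℓp (schrodingerExpr V (M η)) 2
    rw [key]
    exact lp.memℓp _
  refine ⟨hmem, ?_⟩
  have : schrodinger S V ⟨M η, hmem⟩ = φ - (Complex.I * c) • M η := lp.ext key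
  rw [this]
  abel

theorem exists_isResolventAt (S : Set ℤ) (V : ℤ → ℝ) :
    ∃ c R, IsResolventAt (schrodinger S V) c R := by
  set c : ℝ := ‖hopping S‖ + 1 with hc
  have hcpos : 0 < c := by positivity
  have hlt : ‖hopping S‖ < |c| := by rw [abs_of_pos hcpos]; linarith
  obtain ⟨R, hR⟩ := exists_rightInverse S V c hlt
  obtain ⟨Q, hQ⟩ := exists_rightInverse S V (-c) (by rwa [abs_neg])
  choose Rm hR using hR
  choose Qm hQ using hQ
  -- the two right inverses are adjoint to each other
  have adj1 : ∀ φ (ψ : (schrodinger S V).domain), inner ℂ (Q φ) (schrodinger S V ψ + (Complex.I * c) • (ψ : Ell2 S)) =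
      inner ℂ φ (ψ : Ell2 S) := by
    intro φ ψ
    conv_rhs => rw [← hQ φ]
    rw [inner_add_right, inner_add_left, inner_smul_right, inner_smul_left]
    have := schrodinger_symm ⟨Q φ, Qm φ⟩ ψ
    rw [this]
    simp
  have adj2 : ∀ φ (ψ : (schrodinger S V).domain), inner ℂ (R φ) (schrodinger S V ψ + (Complex.I * (-c : ℝ)) • (ψ : Ell2 S)) =
      inner ℂ φ (ψ : Ell2 S) := by
    intro φ ψ
    conv_rhs => rw [← hR φ]
    rw [inner_add_right, inner_add_left, inner_smul_right, inner_smul_left]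
    have := schrodinger_symm ⟨R φ, Rm φ⟩ ψ
    rw [this]
    simp
  have hRQ : star R = Q := by
    apply ContinuousLinearMap.ext
    intro φ
    refine ext_inner_right ℂ fun χ => ?_
    rw [ContinuousLinearMap.star_eq_adjoint, ContinuousLinearMap.adjoint_inner_left]
    have := adj1 φ ⟨R χ, Rm χ⟩
    rw [hR] at this
    exact this.symm
  have left1 : ∀ ψ : (schrodinger S V).domain, R (schrodinger S V ψ + (Complex.I * c) • (ψ : Ell2 S)) = ψ := by
    intro ψ
    refine ext_inner_left ℂ fun χ => ?_
    rw [← adj1 χ ψ, ← hRQ, ContinuousLinearMap.star_eq_adjoint,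
      ContinuousLinearMap.adjoint_inner_left]
  have left2 : ∀ ψ : (schrodinger S V).domain, Q (schrodinger S V ψ + (Complex.I * (-c : ℝ)) • (ψ : Ell2 S)) = ψ := by
    intro ψ
    refine ext_inner_left ℂ fun χ => ?_
    rw [← adj2 χ ψ, ← hRQ, ContinuousLinearMap.star_eq_adjoint,
      ContinuousLinearMap.adjoint_inner_right]
  have rel1 : R - Q = (-2 * Complex.I * c) • (R * Q) := by
    apply ContinuousLinearMap.ext
    intro φ
    have h1 := left1 ⟨Q φ, Qm φ⟩
    have h2 := hQ φ
    have h3 : schrodinger S V ⟨Q φ, Qm φ⟩ + (Complex.I * c) • Q φ = φ + (2 * Complex.I * c) • Q φ := by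
      rw [eq_sub_of_add_eq h2]
      push_cast
      module
    change R φ - Q φ = (-2 * Complex.I * c) • R (Q φ)
    simp only at h1
    rw [h3, map_add, map_smul] at h1
    nth_rewrite 1 [← h1]
    module
  have rel2 : R - Q = (-2 * Complex.I * c) • (Q * R) := by
    apply ContinuousLinearMap.ext
    intro φ
    have h1 := left2 ⟨R φ, Rm φ⟩
    have h2 := hR φ
    have h3 : schrodinger S V ⟨R φ, Rm φ⟩ + (Complex.I * (-c : ℝ)) • R φ = φ - (2 * Complex.I * c) • R φ := by
      rw [eq_sub_of_add_eq h2]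
      push_cast
      module
    change R φ - Q φ = (-2 * Complex.I * c) • Q (R φ)
    simp only at h1
    rw [h3, map_sub, map_smul] at h1
    nth_rewrite 1 [← h1]
    module
  have hne : (-2 * Complex.I * c) ≠ 0 := by
    simp [hcpos.ne']
  refine ⟨c, R, hcpos, Rm, hR, left1, ⟨?_⟩, ?_, ?_⟩
  · rw [hRQ]
    exact (smul_right_injective _ hne (rel1.symm.trans rel2)).symm
  · have h1 : (R : Ell2 S →ₗ[ℂ] Ell2 S).range.topologicalClosure = ⊤ := by
      rw [Submodule.topologicalClosure_eq_top_iff, Submodule.eq_bot_iff]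
      intro χ hχ
      have h2 : Q χ = 0 := by
        refine ext_inner_left ℂ fun φ => ?_
        rw [← hRQ, ContinuousLinearMap.star_eq_adjoint, ContinuousLinearMap.adjoint_inner_right,
          inner_zero_right]
        exact hχ (R φ) ⟨φ, rfl⟩
      have h3 := hQ χ
      have h4 : (⟨Q χ, Qm χ⟩ : (schrodinger S V).domain) = 0 := Subtype.ext h2
      rw [← h3, h4, h2, LinearPMap.map_zero]
      simp
    have h2 := (Submodule.dense_iff_topologicalClosure_eq_top).2 h1
    exact h2
  · rw [hRQ]
    exact rel1

theorem exists_isUnitaryGroup (S : Set ℤ) (V : ℤ → ℝ) :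
    ∃ U, IsUnitaryGroup (schrodinger S V) U := by
  obtain ⟨c, R, h⟩ := exists_isResolventAt S V
  exact exists_isUnitaryGroup_of_resolvent h

theorem exists_isSpectralMeasure (S : Set ℤ) (V : ℤ → ℝ) (φ : Ell2 S) :
    ∃ μ, IsSpectralMeasure (schrodinger S V) φ μ := by
  obtain ⟨c, R, h⟩ := exists_isResolventAt S V
  exact exists_isSpectralMeasure_of_resolvent h φ

/-- The unitary group `t ↦ exp(-itH)` on `ℓ²(S)`. -/
noncomputable def timeEvolution (S : Set ℤ) (V : ℤ → ℝ) : ℝ → Ell2 S →L[ℂ] Ell2 S :=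
  Classical.choose (exists_isUnitaryGroup S V)

theorem isUnitaryGroup_timeEvolution (S : Set ℤ) (V : ℤ → ℝ) :
    IsUnitaryGroup (schrodinger S V) (timeEvolution S V) :=
  Classical.choose_spec (exists_isUnitaryGroup S V)

/-- The spectral measure of the vector `φ ∈ ℓ²(S)` with respect to `H`. -/
noncomputable def spectralMeasure (S : Set ℤ) (V : ℤ → ℝ) (φ : Ell2 S) :
    MeasureTheory.Measure ℝ :=
  Classical.choose (exists_isSpectralMeasure S V φ)

theorem isSpectralMeasure_spectralMeasure (S : Set ℤ) (V : ℤ → ℝ) (φ : Ell2 S) :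
    IsSpectralMeasure (schrodinger S V) φ (spectralMeasure S V φ) :=
  Classical.choose_spec (exists_isSpectralMeasure S V φ)

/-- The unit vector `δ_m ∈ ℓ²(S)`, `m ∈ S` (and `0` if `m ∉ S`). -/
noncomputable def delta (S : Set ℤ) (m : ℤ) : Ell2 S :=
  open Classical in if h : m ∈ S then lp.single 2 (⟨m, h⟩ : S) (1 : ℂ) else 0

/-- The time-averaged probability
`a(n, T) = (2 / T) ∫₀^∞ exp(-2t/T) |⟨exp(-itH) δ₁, δ_n⟩|² dt`. -/
noncomputable def avgProb (S : Set ℤ) (V : ℤ → ℝ) (n : ℤ) (T : ℝ) : ℝ :=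
  2 / T * ∫ t in Set.Ioi (0 : ℝ), Real.exp (-2 * t / T) *
    ‖inner ℂ (delta S n) (timeEvolution S V t (delta S 1))‖ ^ 2

/-- The time-averaged moment `⟨|X|^p⟩(T) = ∑_n |n|^p a(n, T)`, a sum of non-negative terms with
values in `[0, ∞]`. -/
noncomputable def moment (S : Set ℤ) (V : ℤ → ℝ) (p T : ℝ) : ℝ≥0∞ :=
  ∑' n : S, ENNReal.ofReal (|((n : ℤ) : ℝ)| ^ p * avgProb S V n T)

/-- The lower growth exponent `β⁻(p) = liminf_{T → ∞} log ⟨|X|^p⟩(T) / log T`, in `[-∞, ∞]`. -/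
noncomputable def lowerExponent (S : Set ℤ) (V : ℤ → ℝ) (p : ℝ) : EReal :=
  Filter.liminf (fun T : ℝ => ENNReal.log (moment S V p T) / (Real.log T : EReal)) Filter.atTop

/-- `u` is a real solution of the difference equation at energy `E`: the equation holds at all
sites of `S`. (For `S = {1, 2, …}` the values of `u` that matter are `u 0, u 1, …`.) -/
def IsSolution (S : Set ℤ) (V : ℤ → ℝ) (E : ℝ) (u : ℤ → ℝ) : Prop :=
  ∀ n ∈ S, u (n + 1) + u (n - 1) + V n * u n = E * u n

/-- `|u(0)|² + |u(1)|² = 1`. -/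
def IsNormalized (u : ℤ → ℝ) : Prop := |u 0| ^ 2 + |u 1| ^ 2 = 1

/-- `‖u‖_L² = ∑_{n = 1}^{[L]} |u(n)|² + (L - [L]) |u([L] + 1)|²`, for `L ≥ 0`. -/
noncomputable def normSqUpTo (u : ℤ → ℝ) (L : ℝ) : ℝ :=
  ∑ n ∈ Finset.Icc 1 ⌊L⌋₊, |u (n : ℤ)| ^ 2 + (L - ⌊L⌋₊) * |u ((⌊L⌋₊ : ℤ) + 1)| ^ 2

/-- Power-law upper bound with exponent `α` on the set of energies `A`. -/
def PowerLawUpperBound (S : Set ℤ) (V : ℤ → ℝ) (A : Set ℝ) (α : ℝ) : Prop :=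
  ∃ C : ℝ, 0 < C ∧ ∀ E ∈ A, ∀ u : ℤ → ℝ, IsSolution S V E u → IsNormalized u →
    ∀ L : ℝ, 1 ≤ L → normSqUpTo u L ≤ C * L ^ (2 * α + 1)

/-- Scaling lower bound on the set of energies `A`. -/
def ScalingLowerBound (S : Set ℤ) (V : ℤ → ℝ) (A : Set ℝ) : Prop :=
  ∃ k γ L₀ : ℝ, 0 < k ∧ k < 1 ∧ 0 < γ ∧ γ < 1 ∧ 1 ≤ L₀ ∧
    ∀ E ∈ A, ∀ u : ℤ → ℝ, IsSolution S V E u →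
      ∀ L : ℝ, L₀ ≤ L → (1 + γ) * normSqUpTo u (k * L) ≤ normSqUpTo u L

/-- Power-law lower bound with exponent `κ` on the set of energies `A`. (The bound is required for
large `L` only: at `L = 1` it fails for the normalized solution with `u 1 = 0`.) -/
def PowerLawLowerBound (S : Set ℤ) (V : ℤ → ℝ) (A : Set ℝ) (κ : ℝ) : Prop :=
  ∃ D L₁ : ℝ, 0 < D ∧ 1 ≤ L₁ ∧ ∀ E ∈ A, ∀ u : ℤ → ℝ, IsSolution S V E u → IsNormalized u →
    ∀ L : ℝ, L₁ ≤ L → D * L ^ κ ≤ Real.sqrt (normSqUpTo u L)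

/-! Fix a large `T` and cut the energy axis into cells of length `1 / T`. With `s = (p + 2κ)/(α + κ
+ 1/2)`, call a cell meeting `A` big if its spectral mass exceeds `T ^ (-q)`, `q = s/(p + 1)`, and
small otherwise. The big cells or the small cells carry at least half of `μ(A)`, and each
alternative forces spreading.

Small cells (`ofReal_le_moment_of_cell_le`). The spectral projection of `δ₁` onto the small cells is
a state whose time-averaged probability at every single site is `O(T ^ (-q))`, by Strichartz'
estimate. Hence it is mostly outside a box of size `N`, a small multiple of `T ^ q`. Its overlap
with `exp(-itH) δ₁` is constant in time, so a fixed fraction of the latter is outside as well, and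
the moment is at least of order `T ^ (qp)`.

Big cells (`ofReal_le_moment_of_resolvent`). The Green function `G(n, E + i/T)` is the Fourier
transform of the damped amplitude at `n`, so `∫ |G(n, E + i/T)|² dE` over the cells is at most a
multiple of `T a(n, T)`. At `n = 1` it is the Borel transform of `μ`, of modulus at least `T/2`
times the mass of the cell of `E`. What remains is `∑ n ^ p |G(n)|² ≥ c T ^ s |G(1)|²`
(`exists_moment_le`). Summing over the big cells gives order `T ^ (s - q)`. The choice of `q` makes
`s - q = qp = sp/(p + 1)`, the asserted exponent.

For `exists_moment_le`, `ψ = G(·, z)` is compared with the solution `φ` at a real energy of `A` in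
the same cell which agrees with it at the sites 1 and 2. By variation of constants the relative
deviation on the scale `L` is at most `|z - E|²` times twice the Gram determinant of a basis of
solutions. That determinant is continuous in `L`, zero at `L = 1` and unbounded, so `L` can be
chosen where it equals a small multiple of `T²`. At this scale (b) survives for `ψ`: a fixed part of
the norm lies beyond `kL`, which yields the factor `L ^ p`. The norm of `φ` is bounded below by `L ^
(2κ)` from (c) and by determinant over trace, of order `T² / L ^ (2α + 1)`, from (a). The larger of
the two, times `L ^ p`, is at least of order `T ^ s` whatever `L` is, provided that `p ≤ 2α + 1`
(`le_mul_max`).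

A power law (c) follows by iterating (b). At `p = 2α + 1` the exponent is `(2α + 1)/(α + 1)`, free
of `κ`, and larger `p` follow from a comparison of moments of a probability distribution. -/

/-! ### Quadratic Fourier estimates: Bessel on bounded frequency sets, Strichartz on cells. -/

open MeasureTheory in
-- The square expands to a quadratic form in `h` whose kernel is the Fourier transform of `w` at `t
-- - s`, and Schur's test bounds it. Lebesgue measure with a Gaussian weight gives Bessel's
-- inequality; the spectral measure with an exponential weight gives Strichartz' estimate.
theorem integral_weight_mul_normSq_le {μ : Measure ℝ} [SFinite μ] {w : ℝ → ℝ}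
    (hw : Integrable w) (hw0 : ∀ x, 0 ≤ w x) {h : ℝ → ℂ} (h1 : Integrable h μ)
    (h2 : MemLp h 2 μ) {K : ℝ} (hK0 : 0 ≤ K)
    (hK : ∀ t : ℝ, ∫⁻ s, ‖∫ E : ℝ, (w E : ℂ) * Complex.exp (Complex.I * (E * (t - s)))‖ₑ ∂μ
      ≤ ENNReal.ofReal K) :
    ∫ E : ℝ, w E * ‖∫ t : ℝ, Complex.exp (Complex.I * (E * t)) * h t ∂μ‖ ^ 2 ≤
      K * ∫ t, ‖h t‖ ^ 2 ∂μ := by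
  set W : ℝ → ℂ := fun s => ∫ E : ℝ, (w E : ℂ) * Complex.exp (Complex.I * (E * s)) with hW
  have hK' : ∀ t, ∫⁻ s, ‖W (t - s)‖ₑ ∂μ ≤ ENNReal.ofReal K := by
    intro t
    refine le_trans (le_of_eq ?_) (hK t)
    simp [hW]
  have hcexp : ∀ x : ℝ, ‖Complex.exp (Complex.I * x)‖ = 1 := fun x => norm_expI x
  have e1 : ∀ E : ℝ, ((w E * ‖∫ t : ℝ, Complex.exp (Complex.I * (E * t)) * h t ∂μ‖ ^ 2 : ℝ) : ℂ) =
      ∫ p : ℝ × ℝ, (w E : ℂ) * Complex.exp (Complex.I * (E * (p.1 - p.2))) *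
        (h p.1 * star (h p.2)) ∂(μ.prod μ) := by
    intro E
    have : ∀ p : ℝ × ℝ, (w E : ℂ) * Complex.exp (Complex.I * (E * (p.1 - p.2))) *
        (h p.1 * star (h p.2)) = (w E : ℂ) * ((Complex.exp (Complex.I * (E * p.1)) * h p.1) *
          (star (Complex.exp (Complex.I * (E * p.2)) * h p.2))) := by
      intro p
      rw [star_mul', Complex.star_def, ← Complex.exp_conj]
      simp only [map_mul, Complex.conj_I, Complex.conj_ofReal]
      rw [show Complex.I * (E * ((p.1 : ℂ) - p.2)) = Complex.I * (E * p.1) + -Complex.I * (E * p.2)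
        by ring, Complex.exp_add]
      ring
    simp_rw [this]
    rw [integral_const_mul, integral_prod_mul (μ := μ) (ν := μ)
      (fun t : ℝ => Complex.exp (Complex.I * (E * t)) * h t)
      (fun t : ℝ => star (Complex.exp (Complex.I * (E * t)) * h t))]
    push_cast
    congr 1
    have := integral_conj (μ := μ) (f := fun t : ℝ => Complex.exp (Complex.I * (E * t)) * h t)
    simp only [Complex.star_def]
    rw [this, Complex.mul_conj']
  have hprod : Integrable (fun q : ℝ × (ℝ × ℝ) => (w q.1 : ℂ) *
      Complex.exp (Complex.I * (q.1 * (q.2.1 - q.2.2))) * (h q.2.1 * star (h q.2.2)))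
      (volume.prod (μ.prod μ)) := by
    have hs : Integrable (fun t => star (h t)) μ := by
      simpa using (Complex.conjCLE.toContinuousLinearMap.integrable_comp h1)
    have hb := (hw.ofReal (𝕜 := ℂ)).mul_prod (h1.mul_prod hs)
    have hm : AEStronglyMeasurable (fun q : ℝ × (ℝ × ℝ) =>
        Complex.exp (Complex.I * (q.1 * (q.2.1 - q.2.2)))) (volume.prod (μ.prod μ)) := by
      apply Continuous.aestronglyMeasurable
      fun_prop
    have := hb.bdd_mul (c := 1) hm (Filter.Eventually.of_forall fun q => by
      have := hcexp (q.1 * (q.2.1 - q.2.2))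
      push_cast at this
      exact this.le)
    refine this.congr (Filter.Eventually.of_forall fun q => ?_)
    simp only [RCLike.ofReal_eq_complex_ofReal]
    ring
  have e2 : ((∫ E : ℝ, w E * ‖∫ t : ℝ, Complex.exp (Complex.I * (E * t)) * h t ∂μ‖ ^ 2 : ℝ) : ℂ) =
      ∫ p : ℝ × ℝ, W (p.1 - p.2) * (h p.1 * star (h p.2)) ∂(μ.prod μ) := by
    rw [← integral_complex_ofReal]
    simp_rw [e1]
    rw [integral_integral_swap hprod]
    congr 1
    funext p
    rw [integral_mul_const]
    simp [hW]
  have Wcont : Continuous W := by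
    refine continuous_of_dominated (bound := fun E => w E) ?_ ?_ hw ?_
    · intro s
      exact ((hw.ofReal (𝕜 := ℂ)).aestronglyMeasurable.mul
        (by apply Continuous.aestronglyMeasurable; fun_prop))
    · intro s
      refine Filter.Eventually.of_forall fun E => ?_
      have := hcexp (E * s)
      push_cast at this
      rw [norm_mul, this, mul_one, Complex.norm_real, Real.norm_of_nonneg (hw0 _)]
    · refine Filter.Eventually.of_forall fun E => ?_
      fun_prop
  -- Since `w` is real, `|W|` is even, so one bound on its integrals serves for both variables of
  -- the kernel.
  have Wneg : ∀ s, ‖W (-s)‖ₑ = ‖W s‖ₑ := by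
    intro s
    have : W (-s) = star (W s) := by
      simp only [hW, Complex.star_def]
      rw [← integral_conj]
      congr 1
      funext E
      rw [map_mul, Complex.conj_ofReal, ← Complex.exp_conj]
      simp
    rw [this, enorm_eq_iff_norm_eq, norm_star]
  have hnn : 0 ≤ ∫ E : ℝ, w E * ‖∫ t : ℝ, Complex.exp (Complex.I * (E * t)) * h t ∂μ‖ ^ 2 :=
    integral_nonneg fun E => mul_nonneg (hw0 E) (by positivity)
  have hI : ∫⁻ t, ‖h t‖ₑ ^ 2 ∂μ = ENNReal.ofReal (∫ t, ‖h t‖ ^ 2 ∂μ) := by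
    rw [ofReal_integral_eq_lintegral_ofReal ((memLp_two_iff_integrable_sq_norm h1.1).1 h2)
      (Filter.Eventually.of_forall fun t => by positivity)]
    congr 1
    funext t
    rw [ENNReal.ofReal_pow (norm_nonneg _), ofReal_norm]
  have hae : AEMeasurable (fun t => ‖h t‖ₑ) μ := h1.aestronglyMeasurable.enorm
  have hWm : Measurable (fun s => ‖W s‖ₑ) := Wcont.measurable.enorm
  have hWm2 : Measurable (fun p : ℝ × ℝ => ‖W (p.1 - p.2)‖ₑ) :=
    hWm.comp (measurable_fst.sub measurable_snd)
  have A1 : ∫⁻ p : ℝ × ℝ, ‖W (p.1 - p.2)‖ₑ * ‖h p.1‖ₑ ^ 2 ∂(μ.prod μ) ≤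
      ENNReal.ofReal K * ∫⁻ t, ‖h t‖ₑ ^ 2 ∂μ := by
    rw [lintegral_prod (fun p : ℝ × ℝ => ‖W (p.1 - p.2)‖ₑ * ‖h p.1‖ₑ ^ 2)
        (hWm2.aemeasurable.mul ((hae.comp_fst).pow_const 2)),
      ← lintegral_const_mul'' _ (hae.pow_const 2)]
    refine lintegral_mono fun t => ?_
    dsimp only
    rw [lintegral_mul_const' _ _ (by simp)]
    gcongr
    exact hK' t
  have A2 : ∫⁻ p : ℝ × ℝ, ‖W (p.1 - p.2)‖ₑ * ‖h p.2‖ₑ ^ 2 ∂(μ.prod μ) ≤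
      ENNReal.ofReal K * ∫⁻ t, ‖h t‖ₑ ^ 2 ∂μ := by
    rw [← lintegral_prod_swap]
    refine le_trans (le_of_eq ?_) A1
    refine lintegral_congr fun p => ?_
    simp only [Prod.fst_swap, Prod.snd_swap]
    rw [← Wneg, neg_sub]
  have A3 : ‖∫ p : ℝ × ℝ, W (p.1 - p.2) * (h p.1 * star (h p.2)) ∂(μ.prod μ)‖ₑ ≤
      ENNReal.ofReal K * ∫⁻ t, ‖h t‖ₑ ^ 2 ∂μ := by
    refine (enorm_integral_le_lintegral_enorm _).trans ?_
    have B1 : ∀ a b : ℝ≥0∞, 2 * (a * b) ≤ a ^ 2 + b ^ 2 := by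
      intro a b
      rcases eq_or_ne a ⊤ with rfl | ha
      · simp
      rcases eq_or_ne b ⊤ with rfl | hb
      · simp
      lift a to NNReal using ha
      lift b to NNReal using hb
      norm_cast
      rw [← NNReal.coe_le_coe]
      push_cast
      nlinarith [sq_nonneg ((a : ℝ) - b)]
    have B2 : 2 * ∫⁻ p : ℝ × ℝ, ‖W (p.1 - p.2) * (h p.1 * star (h p.2))‖ₑ ∂(μ.prod μ) ≤
        2 * (ENNReal.ofReal K * ∫⁻ t, ‖h t‖ₑ ^ 2 ∂μ) := by
      rw [← lintegral_const_mul' _ _ (by simp)]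
      calc _ ≤ ∫⁻ p : ℝ × ℝ, (‖W (p.1 - p.2)‖ₑ * ‖h p.1‖ₑ ^ 2 +
            ‖W (p.1 - p.2)‖ₑ * ‖h p.2‖ₑ ^ 2) ∂(μ.prod μ) := by
            refine lintegral_mono fun p => ?_
            rw [enorm_mul, enorm_mul, enorm_eq_iff_norm_eq.2 (norm_star (h p.2)), ← mul_add]
            calc _ = ‖W (p.1 - p.2)‖ₑ * (2 * (‖h p.1‖ₑ * ‖h p.2‖ₑ)) := by ring
              _ ≤ _ := by gcongr; exact B1 _ _
        _ = _ := lintegral_add_left' (hWm2.aemeasurable.mul ((hae.comp_fst).pow_const 2)) _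
        _ ≤ _ := (add_le_add A1 A2).trans (by rw [two_mul])
    exact (ENNReal.mul_le_mul_iff_right (by simp) (by simp)).1 B2
  rw [← e2, hI] at A3
  have hI0 : 0 ≤ ∫ t, ‖h t‖ ^ 2 ∂μ := integral_nonneg fun t => by positivity
  rw [← ENNReal.ofReal_mul' hI0, ← ofReal_norm, Complex.norm_real, Real.norm_of_nonneg hnn] at A3
  exact (ENNReal.ofReal_le_ofReal_iff (mul_nonneg hK0 hI0)).1 A3

open MeasureTheory in
theorem norm_integral_exp_le {μ : Measure ℝ} (h : ℝ → ℂ) (E : ℝ) :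
    ‖∫ t : ℝ, Complex.exp (Complex.I * (E * t)) * h t ∂μ‖ ≤ ∫ t, ‖h t‖ ∂μ := by
  refine (norm_integral_le_integral_norm _).trans (le_of_eq ?_)
  congr 1
  funext t
  have := norm_expI (E * t)
  push_cast at this
  rw [norm_mul, this, one_mul]

open MeasureTheory in
theorem continuous_integral_exp {μ : Measure ℝ} {h : ℝ → ℂ} (h1 : Integrable h μ) :
    Continuous fun E : ℝ => ∫ t : ℝ, Complex.exp (Complex.I * (E * t)) * h t ∂μ := by
  refine continuous_of_dominated (bound := fun t => ‖h t‖) ?_ ?_ h1.norm ?_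
  · intro s
    exact (by apply Continuous.aestronglyMeasurable; fun_prop :
      AEStronglyMeasurable (fun t : ℝ => Complex.exp (Complex.I * (s * t))) μ).mul
        h1.aestronglyMeasurable
  · intro s
    refine Filter.Eventually.of_forall fun t => ?_
    have := norm_expI (s * t)
    push_cast at this
    rw [norm_mul, this, one_mul]
  · refine Filter.Eventually.of_forall fun E => ?_
    fun_prop

open MeasureTheory in
theorem integrable_weight_mul_normSq {μ : Measure ℝ} {w : ℝ → ℝ}
    (hw : Integrable w) {h : ℝ → ℂ} (h1 : Integrable h μ) :
    Integrable fun E : ℝ => w E * ‖∫ t : ℝ, Complex.exp (Complex.I * (E * t)) * h t ∂μ‖ ^ 2 := by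
  refine hw.mul_bdd (c := (∫ t, ‖h t‖ ∂μ) ^ 2)
    ((continuous_integral_exp h1).norm.pow 2).aestronglyMeasurable
    (Filter.Eventually.of_forall fun E => ?_)
  rw [norm_pow, norm_norm]
  gcongr
  exact norm_integral_exp_le h E

open MeasureTheory in
/-- Bessel's inequality for the Fourier transform, over bounded sets of frequencies. -/
theorem setIntegral_normSq_fourier_le {h : ℝ → ℂ} (h1 : Integrable h) (h2 : MemLp h 2)
    {B : Set ℝ} (hB : MeasurableSet B) {R : ℝ} (hR : ∀ E ∈ B, |E| ≤ R) :
    ∫ E in B, ‖∫ t : ℝ, Complex.exp (Complex.I * (E * t)) * h t‖ ^ 2 ≤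
      4 * Real.pi * ∫ t, ‖h t‖ ^ 2 := by
  -- With this width the Gaussian weight is at least `1/2` on `B`. Its Fourier transform has `L¹`
  -- norm `2π` for every `δ`, so the loss against Plancherel is only a factor 2.
  set δ : ℝ := 1 / (2 * (R ^ 2 + 1)) with hδ
  have hδ0 : 0 < δ := by positivity
  have hw : Integrable (fun x : ℝ => Real.exp (-δ * x ^ 2)) := integrable_exp_neg_mul_sq hδ0
  have key := integral_weight_mul_normSq_le (μ := volume) hw (fun x => (Real.exp_pos _).le) h1 h2
    (K := 2 * Real.pi) (by positivity) (fun t => by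
      have e1 : ∀ s : ℝ, ‖∫ E : ℝ, ((Real.exp (-δ * E ^ 2) : ℝ) : ℂ) *
          Complex.exp (Complex.I * (E * (t - s)))‖ₑ =
          ENNReal.ofReal (√(Real.pi / δ) * Real.exp (-(1 / (4 * δ)) * (t - s) ^ 2)) := by
        intro s
        have := fourierIntegral_gaussian (b := (δ : ℂ)) (by simpa using hδ0) ((t - s : ℝ) : ℂ)
        have e2 : ∫ E : ℝ, ((Real.exp (-δ * E ^ 2) : ℝ) : ℂ) *
          Complex.exp (Complex.I * (E * (t - s))) =
            ((√(Real.pi / δ) * Real.exp (-(1 / (4 * δ)) * (t - s) ^ 2) : ℝ) : ℂ) := by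
          calc _ = ∫ x : ℝ, Complex.exp (Complex.I * ((t - s : ℝ) : ℂ) * x) *
              Complex.exp (-(δ : ℂ) * x ^ 2) := by
                congr 1; funext x; rw [mul_comm]; push_cast; congr 2; ring
            _ = _ := by
                rw [this, Complex.ofReal_mul, Real.sqrt_eq_rpow,
                  Complex.ofReal_cpow (by positivity)]
                push_cast
                congr 2
                field_simp
        rw [e2, ← ofReal_norm, Complex.norm_real, Real.norm_of_nonneg (by positivity)]
      simp_rw [e1]
      have hi : Integrable (fun s : ℝ => √(Real.pi / δ) *
          Real.exp (-(1 / (4 * δ)) * (t - s) ^ 2)) := by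
        exact ((integrable_exp_neg_mul_sq (b := 1 / (4 * δ)) (by positivity)).comp_sub_left
          t).const_mul _
      rw [← ofReal_integral_eq_lintegral_ofReal hi
        (Filter.Eventually.of_forall fun s => by positivity)]
      apply ENNReal.ofReal_le_ofReal
      rw [integral_const_mul, integral_sub_left_eq_self
        (fun s : ℝ => Real.exp (-(1 / (4 * δ)) * s ^ 2)), integral_gaussian,
        ← Real.sqrt_mul (by positivity)]
      apply le_of_eq
      rw [Real.sqrt_eq_iff_mul_self_eq (by positivity) (by positivity)]
      field_simp
      ring)
  have hint := integrable_weight_mul_normSq hw h1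
  have : ∫ E in B, ‖∫ t : ℝ, Complex.exp (Complex.I * (E * t)) * h t‖ ^ 2 ≤
      ∫ E in B, 2 * (Real.exp (-δ * E ^ 2) *
        ‖∫ t : ℝ, Complex.exp (Complex.I * (E * t)) * h t‖ ^ 2) := by
    apply integral_mono_of_nonneg (Filter.Eventually.of_forall fun E => by positivity)
      (hint.integrableOn.const_mul 2)
    filter_upwards [ae_restrict_mem hB] with E hE
    have h3 : 1 / 2 ≤ Real.exp (-δ * E ^ 2) := by
      have h4 : δ * E ^ 2 ≤ 1 / 2 := by
        have : E ^ 2 ≤ R ^ 2 := by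
          rw [← sq_abs]; exact pow_le_pow_left₀ (abs_nonneg _) (hR E hE) 2
        rw [hδ, div_mul_eq_mul_div, div_le_div_iff₀ (by positivity) (by norm_num)]
        nlinarith
      linarith [Real.add_one_le_exp (-δ * E ^ 2)]
    have : (0 : ℝ) ≤ ‖∫ t : ℝ, Complex.exp (Complex.I * (E * t)) * h t‖ ^ 2 := by positivity
    nlinarith
  rw [integral_const_mul] at this
  have h5 := setIntegral_le_integral (s := B) hint
    (Filter.Eventually.of_forall fun E => by positivity)
  linarith

open MeasureTheory in
theorem integrable_exp_neg_mul_abs {a : ℝ} (ha : 0 < a) :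
    Integrable fun t : ℝ => Real.exp (-a * |t|) := by
  rw [← integrableOn_univ, ← Set.Iic_union_Ioi (a := (0 : ℝ))]
  refine IntegrableOn.union ?_ ?_
  · refine (integrableOn_exp_mul_Iic ha 0).congr_fun (fun t ht => ?_) measurableSet_Iic
    rw [abs_of_nonpos ht]; simp
  · refine (integrableOn_exp_mul_Ioi (a := -a) (by linarith) 0).congr_fun (fun t ht => ?_)
      measurableSet_Ioi
    rw [abs_of_pos ht]

open MeasureTheory in
-- The two half-lines contribute `1/(a + is)` and `1/(a - is)`; their sum is the Poisson kernel,
-- which is positive and decays quadratically.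
theorem integral_exp_neg_mul_abs_mul_exp {a : ℝ} (ha : 0 < a) (s : ℝ) :
    ∫ t : ℝ, ((Real.exp (-a * |t|) : ℝ) : ℂ) * Complex.exp (Complex.I * (t * s)) =
      ((2 * a / (a ^ 2 + s ^ 2) : ℝ) : ℂ) := by
  have hi : Integrable fun t : ℝ => ((Real.exp (-a * |t|) : ℝ) : ℂ) *
      Complex.exp (Complex.I * (t * s)) := by
    refine (integrable_exp_neg_mul_abs ha).ofReal.mul_bdd (c := 1)
      (by apply Continuous.aestronglyMeasurable; fun_prop)
      (Filter.Eventually.of_forall fun t => ?_)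
    have := norm_expI (t * s)
    push_cast at this
    exact this.le
  have h1 : ∫ t in Set.Iic (0 : ℝ), ((Real.exp (-a * |t|) : ℝ) : ℂ) *
      Complex.exp (Complex.I * (t * s)) = 1 / (a + Complex.I * s) := by
    have := integral_exp_mul_complex_Iic (a := (a : ℂ) + Complex.I * s) (by simpa using ha) 0
    simp only [Complex.ofReal_zero, mul_zero, Complex.exp_zero] at this
    rw [← this]
    refine setIntegral_congr_fun measurableSet_Iic fun t ht => ?_
    rw [abs_of_nonpos ht, Complex.ofReal_exp, ← Complex.exp_add]
    push_cast
    congr 1; ring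
  have h2 : ∫ t in Set.Ioi (0 : ℝ), ((Real.exp (-a * |t|) : ℝ) : ℂ) *
      Complex.exp (Complex.I * (t * s)) = 1 / (a - Complex.I * s) := by
    have := integral_exp_mul_complex_Ioi (a := -(a : ℂ) + Complex.I * s) (by simpa using ha) 0
    simp only [Complex.ofReal_zero, mul_zero, Complex.exp_zero] at this
    rw [show (1 : ℂ) / (a - Complex.I * s) = -1 / (-(a : ℂ) + Complex.I * s) by
      rw [← neg_div_neg_eq]; congr 1; ring, ← this]
    refine setIntegral_congr_fun measurableSet_Ioi fun t ht => ?_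
    rw [abs_of_pos ht, Complex.ofReal_exp, ← Complex.exp_add]
    push_cast
    congr 1; ring
  rw [← intervalIntegral.integral_Iic_add_Ioi (b := (0 : ℝ)) hi.integrableOn hi.integrableOn, h1, h2]
  have n1 : (a : ℂ) + Complex.I * s ≠ 0 := fun h => by
    have := congrArg Complex.re h; simp at this; linarith
  have n2 : (a : ℂ) - Complex.I * s ≠ 0 := fun h => by
    have := congrArg Complex.re h; simp at this; linarith
  have n3 : ((a : ℂ) ^ 2 + s ^ 2) ≠ 0 := by
    have : a ^ 2 + s ^ 2 ≠ 0 := by positivity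
    exact_mod_cast this
  push_cast
  rw [div_add_div _ _ n1 n2, div_eq_div_iff (mul_ne_zero n1 n2) n3]
  linear_combination (2 * (a : ℂ) * s ^ 2) * Complex.I_sq

/-- The `j`-th cell of the partition of the line into intervals of length `1 / T`. -/
def cell (T : ℝ) (j : ℤ) : Set ℝ := Set.Ico (j / T) ((j + 1) / T)

theorem measurableSet_cell (T : ℝ) (j : ℤ) : MeasurableSet (cell T j) := measurableSet_Ico

theorem mem_cell_floor {T : ℝ} (hT : 0 < T) (x : ℝ) : x ∈ cell T ⌊x * T⌋ :=
  ⟨by rw [div_le_iff₀ hT]; exact Int.floor_le _, by rw [lt_div_iff₀ hT]; exact Int.lt_floor_add_one _⟩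

theorem summable_inv_one_add_sq : Summable fun k : ℤ => 1 / (1 + (k : ℝ) ^ 2) := by
  have h1 : Summable fun k : ℤ => 1 / |(k : ℝ)| ^ (2 : ℝ) :=
    Real.summable_abs_int_rpow (b := 2) (by norm_num) |>.congr fun k => by
      rw [Real.rpow_neg (abs_nonneg _), one_div]
  refine Summable.of_norm_bounded_eventually h1 ?_
  rw [Filter.eventually_cofinite]
  refine (Set.finite_singleton (0 : ℤ)).subset fun k hk => ?_
  by_contra h0
  apply hk
  have hk0 : (k : ℝ) ≠ 0 := by exact_mod_cast h0
  rw [Real.norm_of_nonneg (by positivity)]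
  have : |(k : ℝ)| ^ (2 : ℝ) = (k : ℝ) ^ 2 := by
    rw [Real.rpow_two, sq_abs]
  rw [this]
  gcongr
  linarith

theorem pairwise_disjoint_cell {T : ℝ} (hT : 0 < T) :
    Pairwise (Function.onFun Disjoint (cell T)) := by
  have key : ∀ (x : ℝ) (j : ℤ), x ∈ cell T j → ⌊x * T⌋ = j := by
    intro x j hx
    rw [Int.floor_eq_iff]
    exact ⟨by rw [← div_le_iff₀ hT]; exact hx.1, by rw [← lt_div_iff₀ hT]; exact hx.2⟩
  intro i j hij
  refine Set.disjoint_left.2 fun x hi hj => hij ?_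
  rw [← key x i hi, key x j hj]

theorem sum_inv_one_add_sub_sq_le (i : ℤ) (J : Finset ℤ) :
    ∑ j ∈ J, 1 / (1 + ((i - j : ℤ) : ℝ) ^ 2) ≤ ∑' k : ℤ, 1 / (1 + (k : ℝ) ^ 2) := by
  have h0 := summable_inv_one_add_sq
  have hs : Summable ((fun k : ℤ => 1 / (1 + (k : ℝ) ^ 2)) ∘ Equiv.subLeft i) :=
    (Equiv.subLeft i).summable_iff.2 h0
  calc _ ≤ ∑' j, ((fun k : ℤ => 1 / (1 + (k : ℝ) ^ 2)) ∘ Equiv.subLeft i) j :=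
        hs.sum_le_tsum J fun j _ => by dsimp only [Function.comp_apply]; positivity
    _ = _ := (Equiv.subLeft i).tsum_eq (fun k : ℤ => 1 / (1 + (k : ℝ) ^ 2))

/-- The rescaled distance `(x - y) T` differs from `i - j` by at most 1, so at scale `1 / T` the
Poisson kernel may be replaced by a summable function of the difference of the cell indices. -/
theorem poisson_le_of_mem_cell {T : ℝ} (hT : 0 < T) {i j : ℤ} {x y : ℝ} (hx : x ∈ cell T i)
    (hy : y ∈ cell T j) : 2 * (2 / T) / ((2 / T) ^ 2 + (x - y) ^ 2) ≤
      8 * T * (1 / (1 + ((i - j : ℤ) : ℝ) ^ 2)) := by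
  obtain ⟨x1, x2⟩ := hx
  obtain ⟨y1, y2⟩ := hy
  rw [div_le_iff₀ hT] at x1 y1
  rw [lt_div_iff₀ hT] at x2 y2
  have e2 : 2 * (2 / T) / ((2 / T) ^ 2 + (x - y) ^ 2) =
      4 * T / (4 + ((x - y) * T) ^ 2) := by
    rw [div_eq_div_iff (by positivity) (by positivity)]
    field_simp
    ring
  rw [e2, mul_one_div, div_le_div_iff₀ (by positivity) (by positivity)]
  have h3 : ((i - j : ℤ) : ℝ) ^ 2 ≤ 2 + 2 * ((x - y) * T) ^ 2 := by
    push_cast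
    have h4 : |(i : ℝ) - j - (x - y) * T| ≤ 1 := by
      rw [abs_le]; constructor <;> nlinarith
    have h5 : ((i : ℝ) - j - (x - y) * T) ^ 2 ≤ 1 := by
      rw [← sq_abs]; nlinarith [abs_nonneg ((i : ℝ) - j - (x - y) * T)]
    nlinarith [sq_nonneg ((i : ℝ) - j - 2 * ((x - y) * T))]
  nlinarith

open MeasureTheory in
-- A cell `k` steps away from that of `x` contributes at most `8Tb/(1 + k²)`, so the bound does not
-- depend on the number of cells. This is the hypothesis of Schur's test.
theorem lintegral_poisson_le {μ : Measure ℝ} {T : ℝ} (hT : 0 < T)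
    (J : Finset ℤ) {b : ℝ} (hb0 : 0 ≤ b) (hb : ∀ j ∈ J, μ (cell T j) ≤ ENNReal.ofReal b) (x : ℝ) :
    ∫⁻ y in ⋃ j ∈ J, cell T j, ENNReal.ofReal (2 * (2 / T) / ((2 / T) ^ 2 + (x - y) ^ 2)) ∂μ ≤
      ENNReal.ofReal (8 * T * b * ∑' k : ℤ, 1 / (1 + (k : ℝ) ^ 2)) := by
  set i := ⌊x * T⌋ with hi
  have hx := mem_cell_floor hT x
  rw [← hi] at hx
  rw [lintegral_biUnion_finset ((pairwise_disjoint_cell hT).set_pairwise _)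
    (fun j _ => measurableSet_cell T j)]
  calc _ ≤ ∑ j ∈ J, ENNReal.ofReal (8 * T * b * (1 / (1 + ((i - j : ℤ) : ℝ) ^ 2))) := by
        refine Finset.sum_le_sum fun j hj => ?_
        calc _ ≤ ∫⁻ y in cell T j,
              ENNReal.ofReal (8 * T * (1 / (1 + ((i - j : ℤ) : ℝ) ^ 2))) ∂μ :=
              setLIntegral_mono measurable_const fun y hy =>
                ENNReal.ofReal_le_ofReal (poisson_le_of_mem_cell hT hx hy)
          _ ≤ ENNReal.ofReal (8 * T * (1 / (1 + ((i - j : ℤ) : ℝ) ^ 2))) * ENNReal.ofReal b := by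
              rw [setLIntegral_const]; gcongr; exact hb j hj
          _ = _ := by
              rw [← ENNReal.ofReal_mul (by positivity)]; congr 1; ring
    _ ≤ _ := by
        rw [← ENNReal.ofReal_sum_of_nonneg (fun j _ => by positivity), ← Finset.mul_sum]
        apply ENNReal.ofReal_le_ofReal
        exact mul_le_mul_of_nonneg_left (sum_inv_one_add_sub_sq_le i J) (by positivity)

open MeasureTheory in
/-- Strichartz' estimate: the time averages of the Fourier transform of `g dμ` are controlled by
the largest mass of a cell. -/
theorem timeAverage_normSq_le {μ : Measure ℝ} [IsFiniteMeasure μ] {T : ℝ} (hT : 0 < T)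
    (J : Finset ℤ) {b : ℝ} (hb0 : 0 ≤ b) (hb : ∀ j ∈ J, μ (cell T j) ≤ ENNReal.ofReal b)
    {g : ℝ → ℂ} (hg : MemLp g 2 (μ.restrict (⋃ j ∈ J, cell T j))) :
    2 / T * ∫ t in Set.Ioi (0 : ℝ), Real.exp (-2 * t / T) *
        ‖∫ x in ⋃ j ∈ J, cell T j, Complex.exp (Complex.I * (t * x)) * g x ∂μ‖ ^ 2 ≤
      16 * (∑' k : ℤ, 1 / (1 + (k : ℝ) ^ 2)) * b * ∫ x in ⋃ j ∈ J, cell T j, ‖g x‖ ^ 2 ∂μ := by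
  set A := ⋃ j ∈ J, cell T j with hA
  set S := ∑' k : ℤ, 1 / (1 + (k : ℝ) ^ 2) with hS
  have hS0 : 0 ≤ S := tsum_nonneg fun k => by positivity
  have hT2 : 0 < 2 / T := by positivity
  have g1 : Integrable g (μ.restrict A) := hg.integrable one_le_two
  have hw := integrable_exp_neg_mul_abs hT2
  have key := integral_weight_mul_normSq_le (μ := μ.restrict A) hw (fun x => (Real.exp_pos _).le)
    g1 hg (K := 8 * T * b * S) (by positivity) (fun x => by
      have e1 : ∀ y : ℝ, ‖∫ t : ℝ, ((Real.exp (-(2 / T) * |t|) : ℝ) : ℂ) *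
          Complex.exp (Complex.I * (t * (x - y)))‖ₑ =
          ENNReal.ofReal (2 * (2 / T) / ((2 / T) ^ 2 + (x - y) ^ 2)) := by
        intro y
        have := integral_exp_neg_mul_abs_mul_exp hT2 (x - y)
        push_cast at this
        push_cast
        rw [this, ← ofReal_norm]
        congr 1
        have h0 : 0 ≤ 2 * (2 / T) / ((2 / T) ^ 2 + (x - y) ^ 2) := by positivity
        rw [← Real.norm_of_nonneg h0, ← Complex.norm_real]
        push_cast
        rfl
      simp_rw [e1]
      exact lintegral_poisson_le hT J hb0 hb x)
  have hint := integrable_weight_mul_normSq hw g1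
  -- The one-sided time average is enlarged to the even weight on the line, whose Fourier transform
  -- is the Poisson kernel.
  have h1 : ∫ t in Set.Ioi (0 : ℝ), Real.exp (-2 * t / T) *
        ‖∫ x in A, Complex.exp (Complex.I * (t * x)) * g x ∂μ‖ ^ 2 ≤
      ∫ t : ℝ, Real.exp (-(2 / T) * |t|) *
        ‖∫ x in A, Complex.exp (Complex.I * (t * x)) * g x ∂μ‖ ^ 2 := by
    refine le_trans (le_of_eq ?_) (setIntegral_le_integral (s := Set.Ioi 0) hint
      (Filter.Eventually.of_forall fun E => by positivity))
    refine setIntegral_congr_fun measurableSet_Ioi fun t ht => ?_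
    rw [abs_of_pos ht]
    congr 2
    ring
  calc _ ≤ 2 / T * (8 * T * b * S * ∫ x in A, ‖g x‖ ^ 2 ∂μ) := by
        gcongr
        exact h1.trans key
    _ = _ := by field_simp; ring

/-! ### Resolvent, unitary group and spectral measure. -/

section unitaryGroup

variable {E : Type*} [NormedAddCommGroup E] [InnerProductSpace ℂ E] {T : E →ₗ.[ℂ] E}
  {U : ℝ → E →L[ℂ] E}

theorem IsUnitaryGroup.inner_map_map (hU : IsUnitaryGroup T U) (t : ℝ) (φ ψ : E) :
    inner ℂ (U t φ) (U t ψ) = inner ℂ φ ψ :=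
  LinearIsometry.inner_map_map (⟨(U t : E →ₗ[ℂ] E), hU.norm_map t⟩ : E →ₗᵢ[ℂ] E) φ ψ

theorem IsUnitaryGroup.inner_map_eq (hU : IsUnitaryGroup T U) (s t : ℝ) (φ ψ : E) :
    inner ℂ (U s φ) (U t ψ) = inner ℂ φ (U (t - s) ψ) := by
  rw [← hU.inner_map_map s φ, ← mul_apply_eq_comp, ← hU.add]
  simp

theorem IsUnitaryGroup.norm_inner_le (hU : IsUnitaryGroup T U) (χ φ : E) (t : ℝ) :
    ‖inner ℂ χ (U t φ)‖ ≤ ‖χ‖ * ‖φ‖ := by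
  have := norm_inner_le_norm (𝕜 := ℂ) χ (U t φ)
  rwa [hU.norm_map] at this

theorem IsUnitaryGroup.continuous_inner (hU : IsUnitaryGroup T U) (χ φ : E) :
    Continuous fun t => inner ℂ χ (U t φ) :=
  continuous_const.inner (hU.continuous φ)

/-- The group law transports the derivative at time 0. Writing it with `U t (T ψ)` instead of `T (U
t ψ)` avoids the invariance of the domain. -/
theorem IsUnitaryGroup.hasDerivAt_inner (hU : IsUnitaryGroup T U) (χ : E) (ψ : T.domain) (t : ℝ) :
    HasDerivAt (fun t => inner ℂ χ (U t (ψ : E))) (-Complex.I * inner ℂ χ (U t (T ψ))) t := by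
  have h1 : HasDerivAt (fun s => U t (U (s - t) (ψ : E))) (U t (-Complex.I • T ψ)) t := by
    have h0 : HasDerivAt (fun s => U s (ψ : E)) (-Complex.I • T ψ) (t - t) := by
      simpa using hU.hasDerivAt ψ
    have h2 : HasDerivAt (fun s => U (s - t) (ψ : E)) (-Complex.I • T ψ) t := by
      have := HasDerivAt.scomp (h := fun s : ℝ => s - t) t h0 ((hasDerivAt_id t).sub_const t)
      simpa [Function.comp_def] using this
    exact ((U t).restrictScalars ℝ).hasFDerivAt.comp_hasDerivAt t h2
  have h3 : (fun s => U t (U (s - t) (ψ : E))) = fun s => U s (ψ : E) := by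
    funext s
    rw [← mul_apply_eq_comp, ← hU.add]
    simp
  rw [h3] at h1
  have h4 := (hasDerivAt_const t χ).inner ℂ h1
  simpa [inner_smul_right] using h4

open MeasureTheory in
theorem integrableOn_exp_mul_of_bounded {f : ℝ → ℂ} (hf : Continuous f) {M : ℝ}
    (hM : ∀ t, ‖f t‖ ≤ M) {z : ℂ} (hz : 0 < z.im) :
    IntegrableOn (fun t : ℝ => Complex.exp (Complex.I * z * t) * f t) (Set.Ioi 0) :=
  (integrableOn_exp_mul_complex_Ioi (a := Complex.I * z) (by simpa using hz) 0).mul_bdd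
    (c := M) hf.aestronglyMeasurable (Filter.Eventually.of_forall hM)

theorem norm_exp_I_mul_mul (z : ℂ) (t : ℝ) :
    ‖Complex.exp (Complex.I * z * t)‖ = Real.exp (-(z.im * t)) := by
  rw [Complex.norm_exp]
  simp

open MeasureTheory in
/-- The resolvent is the Laplace transform of the unitary group. -/
theorem IsUnitaryGroup.inner_resolvent (hU : IsUnitaryGroup T U) (χ φ : E) {z : ℂ} (hz : 0 < z.im)
    (ψ : T.domain) (hψ : T ψ - z • (ψ : E) = φ) :
    inner ℂ χ (ψ : E) =
      Complex.I * ∫ t in Set.Ioi (0 : ℝ), Complex.exp (Complex.I * z * t) * inner ℂ χ (U t φ) := by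
  -- Because `(T - z) ψ = φ`, the derivative of `f` is `-i` times the Laplace integrand; `f` equals
  -- the left side at 0 and tends to 0 at infinity.
  set f : ℝ → ℂ := fun t => Complex.exp (Complex.I * z * t) * inner ℂ χ (U t (ψ : E)) with hf
  have hd : ∀ t ∈ Set.Ici (0 : ℝ), HasDerivAt f
      (-Complex.I * (Complex.exp (Complex.I * z * t) * inner ℂ χ (U t φ))) t := by
    intro t _
    have h1 : HasDerivAt (fun t : ℝ => Complex.exp (Complex.I * z * t))
        (Complex.exp (Complex.I * z * t) * (Complex.I * z)) t := by
      have h0 : HasDerivAt (fun t : ℝ => Complex.I * z * (t : ℂ)) (Complex.I * z) t := by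
        simpa using (Complex.ofRealCLM.hasDerivAt (x := t)).const_mul (Complex.I * z)
      exact h0.cexp
    have h2 := h1.mul (hU.hasDerivAt_inner χ ψ t)
    have e : -Complex.I * (Complex.exp (Complex.I * z * t) * inner ℂ χ (U t φ)) =
        Complex.exp (Complex.I * z * t) * (Complex.I * z) * inner ℂ χ (U t (ψ : E)) +
          Complex.exp (Complex.I * z * t) * (-Complex.I * inner ℂ χ (U t (T ψ))) := by
      rw [← hψ, map_sub, map_smul, inner_sub_right, inner_smul_right]
      ring
    rw [e]
    exact h2
  have hi := (integrableOn_exp_mul_of_bounded (hU.continuous_inner χ φ)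
    (hU.norm_inner_le χ φ) hz).const_mul (-Complex.I)
  have ht : Filter.Tendsto f Filter.atTop (nhds 0) := by
    have h1 : Filter.Tendsto (fun t : ℝ => Real.exp (-(z.im * t)) * (‖χ‖ * ‖(ψ : E)‖))
        Filter.atTop (nhds 0) := by
      have := (Real.tendsto_exp_neg_atTop_nhds_zero.comp
        (Filter.tendsto_id.const_mul_atTop hz)).mul_const (‖χ‖ * ‖(ψ : E)‖)
      simpa using this
    refine squeeze_zero_norm (fun t => ?_) h1
    rw [hf, norm_mul, norm_exp_I_mul_mul]
    gcongr
    exact hU.norm_inner_le _ _ _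
  have := integral_Ioi_of_hasDerivAt_of_tendsto' hd hi ht
  rw [integral_const_mul] at this
  have h0 : f 0 = inner ℂ χ (ψ : E) := by simp [hf, hU.zero]
  rw [h0] at this
  linear_combination this

open MeasureTheory in
-- Fubini, and the elementary integral of an exponential for each `x`. Thus the Fourier transform of
-- `μ` and the autocorrelation function have Laplace transforms that can be compared.
theorem laplace_fourier_measure (μ : Measure ℝ) [IsFiniteMeasure μ] {z : ℂ} (hz : 0 < z.im) :
    Complex.I * ∫ t in Set.Ioi (0 : ℝ), Complex.exp (Complex.I * z * t) *
      ∫ x : ℝ, Complex.exp (Complex.I * ((-t : ℝ) * x)) * 1 ∂μ = ∫ x : ℝ, 1 / ((x : ℂ) - z) ∂μ := by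
  have h1 : ∀ t : ℝ, Complex.exp (Complex.I * z * t) *
      ∫ x : ℝ, Complex.exp (Complex.I * ((-t : ℝ) * x)) * 1 ∂μ =
      ∫ x : ℝ, Complex.exp (Complex.I * (z - x) * t) ∂μ := by
    intro t
    rw [← integral_const_mul]
    congr 1
    funext x
    rw [mul_one, ← Complex.exp_add]
    congr 1
    push_cast
    ring
  simp_rw [h1]
  have hi : Integrable (fun q : ℝ × ℝ => Complex.exp (Complex.I * (z - q.2) * q.1))
      ((volume.restrict (Set.Ioi 0)).prod μ) := by
    have h2 : Integrable (fun q : ℝ × ℝ => Complex.exp (Complex.I * z * q.1) * (1 : ℂ))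
        ((volume.restrict (Set.Ioi 0)).prod μ) :=
      Integrable.mul_prod (f := fun t : ℝ => Complex.exp (Complex.I * z * t)) (g := fun _ => (1 : ℂ))
        (integrableOn_exp_mul_complex_Ioi (a := Complex.I * z) (by simpa using hz) 0)
        (integrable_const _)
    refine h2.mono (by apply Continuous.aestronglyMeasurable; fun_prop)
      (Filter.Eventually.of_forall fun q => ?_)
    rw [mul_one, norm_exp_I_mul_mul, norm_exp_I_mul_mul]
    simp
  rw [integral_integral_swap hi, ← integral_const_mul]
  congr 1
  funext x
  have hne : z - x ≠ 0 := fun h => by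
    have := congrArg Complex.im h; simp at this; linarith
  have hne' : (x : ℂ) - z ≠ 0 := by rw [← neg_sub]; exact neg_ne_zero.2 hne
  rw [integral_exp_mul_complex_Ioi (by simpa using hz)]
  simp only [Complex.ofReal_zero, mul_zero, Complex.exp_zero]
  field_simp [Complex.I_ne_zero]
  rw [← sub_eq_zero] 
  ring

open MeasureTheory in
-- On the line `Im z = 1` the Laplace transform is the Fourier transform of `exp(-t) d(t)` cut off
-- to `t > 0`, an integrable function continuous at each `t > 0`; Fourier inversion applies there.
theorem eq_zero_of_laplace_eq_zero {d : ℝ → ℂ} (hd : Continuous d) {M : ℝ} (hM : ∀ t, ‖d t‖ ≤ M)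
    (h0 : ∀ z : ℂ, 0 < z.im →
      ∫ t in Set.Ioi (0 : ℝ), Complex.exp (Complex.I * z * t) * d t = 0) {t : ℝ} (ht : 0 < t) :
    d t = 0 := by
  set h : ℝ → ℂ := Set.indicator (Set.Ioi 0) fun t => Complex.exp (Complex.I * Complex.I * t) * d t
    with hh
  have hi : Integrable h := by
    rw [hh, integrable_indicator_iff measurableSet_Ioi]
    exact integrableOn_exp_mul_of_bounded hd hM (by simp)
  have hF : FourierTransform.fourier h = (0 : ℝ → ℂ) := by
    funext ξ
    rw [Real.fourier_eq']
    have e1 : ∀ v : ℝ, Complex.exp (↑(-2 * Real.pi * inner ℝ v ξ) * Complex.I) • h v =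
        Set.indicator (Set.Ioi 0) (fun t : ℝ =>
          Complex.exp (Complex.I * ((-2 * Real.pi * ξ : ℝ) + Complex.I) * t) * d t) v := by
      intro v
      by_cases hv : v ∈ Set.Ioi (0 : ℝ)
      · rw [hh, Set.indicator_of_mem hv, Set.indicator_of_mem hv, smul_eq_mul, ← mul_assoc,
          ← Complex.exp_add]
        congr 2
        push_cast
        simp only [RCLike.inner_apply, conj_trivial, Complex.ofReal_mul]
        ring
      · rw [hh, Set.indicator_of_notMem hv, Set.indicator_of_notMem hv, smul_zero]
    simp_rw [e1]
    rw [integral_indicator measurableSet_Ioi]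
    exact h0 _ (by simp)
  have hc : ContinuousAt h t := by
    have h1 : ContinuousAt (fun t : ℝ => Complex.exp (Complex.I * Complex.I * t) * d t) t := by
      fun_prop
    refine h1.congr ?_
    filter_upwards [Ioi_mem_nhds ht] with s hs
    rw [hh, Set.indicator_of_mem hs]
  have h2 := hi.fourierInv_fourier_eq (by rw [hF]; exact integrable_zero _ _ _) hc
  rw [hF, Real.fourierInv_eq'] at h2
  simp only [Pi.zero_apply, smul_zero, integral_zero] at h2
  rw [hh, Set.indicator_of_mem (by exact ht)] at h2
  exact (mul_eq_zero.1 h2.symm).resolve_left (Complex.exp_ne_zero _)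

open MeasureTheory in
/-- The autocorrelation function is the Fourier transform of the spectral measure. -/
theorem IsUnitaryGroup.inner_self_eq (hU : IsUnitaryGroup T U) {φ : E} {μ : Measure ℝ}
    (hμ : IsSpectralMeasure T φ μ) (t : ℝ) :
    inner ℂ φ (U t φ) = ∫ x : ℝ, Complex.exp (Complex.I * ((-t : ℝ) * x)) * 1 ∂μ := by
  have := hμ.finite
  set d : ℝ → ℂ := fun t => inner ℂ φ (U t φ) -
    ∫ x : ℝ, Complex.exp (Complex.I * ((-t : ℝ) * x)) * 1 ∂μ with hd
  have c2 : Continuous fun t : ℝ => ∫ x : ℝ, Complex.exp (Complex.I * ((-t : ℝ) * x)) * 1 ∂μ :=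
    (continuous_integral_exp (μ := μ) (h := fun _ => 1) (integrable_const _)).comp continuous_neg
  have hc : Continuous d := (hU.continuous_inner φ φ).sub c2
  have b2 : ∀ t : ℝ, ‖∫ x : ℝ, Complex.exp (Complex.I * ((-t : ℝ) * x)) * 1 ∂μ‖ ≤
      ∫ x : ℝ, ‖(1 : ℂ)‖ ∂μ := fun t => norm_integral_exp_le (μ := μ) (fun _ => 1) (-t)
  have hpos : ∀ t, 0 < t → d t = 0 := by
    intro t ht
    refine eq_zero_of_laplace_eq_zero hc (M := ‖φ‖ * ‖φ‖ + ∫ x : ℝ, ‖(1 : ℂ)‖ ∂μ)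
      (fun t => (norm_sub_le _ _).trans (add_le_add (hU.norm_inner_le _ _ _) (b2 t))) ?_ ht
    intro z hz
    obtain ⟨ψ, h1, h2⟩ := hμ.borel z hz.ne'
    rw [hU.inner_resolvent φ φ hz ψ h1, ← laplace_fourier_measure μ hz] at h2
    have h3 := mul_left_cancel₀ Complex.I_ne_zero h2
    have h4 : ∀ t : ℝ, Complex.exp (Complex.I * z * t) * d t =
        Complex.exp (Complex.I * z * t) * inner ℂ φ (U t φ) - Complex.exp (Complex.I * z * t) *
          ∫ x : ℝ, Complex.exp (Complex.I * ((-t : ℝ) * x)) * 1 ∂μ := fun t => mul_sub _ _ _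
    simp_rw [h4]
    rw [integral_sub (integrableOn_exp_mul_of_bounded (hU.continuous_inner φ φ)
      (hU.norm_inner_le φ φ) hz) (integrableOn_exp_mul_of_bounded c2 b2 hz), h3, sub_self]
  have hnonneg : ∀ t, 0 ≤ t → d t = 0 := by
    intro t ht
    have hcl : IsClosed {t | d t = 0} := isClosed_eq hc continuous_const
    have : closure (Set.Ioi (0 : ℝ)) ⊆ {t | d t = 0} := hcl.closure_subset_iff.2 hpos
    rw [closure_Ioi] at this
    exact this ht
  -- Both functions are Hermitian in `t`, so negative times follow from positive ones.
  have hneg : ∀ t, d (-t) = star (d t) := by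
    intro t
    simp only [hd, star_sub]
    congr 1
    · have := hU.inner_map_eq t 0 φ φ
      rw [hU.zero, zero_sub] at this
      rw [← this, Complex.star_def, inner_conj_symm]
      rfl
    · rw [Complex.star_def, ← integral_conj]
      congr 1
      funext x
      rw [map_mul, ← Complex.exp_conj]
      simp
  have h5 : d t = 0 := by
    rcases le_total 0 t with h | h
    · exact hnonneg t h
    · have := hneg (-t)
      rw [neg_neg, hnonneg (-t) (by linarith), star_zero] at this
      exact this
  exact sub_eq_zero.1 h5

end unitaryGroup

/-! ### Uniqueness of Fourier transforms and density of the exponentials in `L²(μ)`. -/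

open MeasureTheory in
-- The positive and negative parts of `r` are densities of finite measures with the same
-- characteristic function, so the parts agree almost everywhere; as one of them vanishes at each
-- point, so does `r`.
theorem ae_eq_zero_of_fourier_eq_zero_real {μ : Measure ℝ} [IsFiniteMeasure μ] {r : ℝ → ℝ}
    (hr : Integrable r μ)
    (h : ∀ t : ℝ, ∫ x : ℝ, Complex.exp (Complex.I * (t * x)) * (r x : ℂ) ∂μ = 0) : r =ᵐ[μ] 0 := by
  have hm : AEMeasurable r μ := hr.aestronglyMeasurable.aemeasurable
  have mp : AEMeasurable (fun x => ENNReal.ofReal (r x)) μ := hm.ennreal_ofReal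
  have mn : AEMeasurable (fun x => ENNReal.ofReal (-r x)) μ := hm.neg.ennreal_ofReal
  have fp : ∫⁻ x, ENNReal.ofReal (r x) ∂μ ≠ ⊤ := hr.lintegral_lt_top.ne
  have fn : ∫⁻ x, ENNReal.ofReal (-r x) ∂μ ≠ ⊤ := hr.neg.lintegral_lt_top.ne
  have : IsFiniteMeasure (μ.withDensity fun x => ENNReal.ofReal (r x)) :=
    isFiniteMeasure_withDensity fp
  have : IsFiniteMeasure (μ.withDensity fun x => ENNReal.ofReal (-r x)) :=
    isFiniteMeasure_withDensity fn
  have key : (μ.withDensity fun x => ENNReal.ofReal (r x)) =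
      μ.withDensity fun x => ENNReal.ofReal (-r x) := by
    apply Measure.ext_of_charFun
    funext t
    rw [charFun_apply_real, charFun_apply_real,
      integral_withDensity_eq_integral_toReal_smul₀ mp (Filter.Eventually.of_forall fun x => by simp),
      integral_withDensity_eq_integral_toReal_smul₀ mn (Filter.Eventually.of_forall fun x => by simp),
      ← sub_eq_zero, ← integral_sub, ← h t]
    · congr 1
      funext x
      rw [← sub_smul, ENNReal.toReal_ofReal', ENNReal.toReal_ofReal']
      have : max (r x) 0 - max (-r x) 0 = r x := by
        rcases le_total 0 (r x) with h | h
        · rw [max_eq_left h, max_eq_right (by linarith), sub_zero]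
        · rw [max_eq_right h, max_eq_left (by linarith)]; ring
      rw [this, Complex.real_smul, mul_comm]
      congr 2
      ring
    · have e : Integrable (fun x => (ENNReal.ofReal (r x)).toReal) μ := by
        simp_rw [ENNReal.toReal_ofReal']; exact hr.pos_part
      exact e.smul_bdd 1 (by apply Continuous.aestronglyMeasurable; fun_prop)
        (Filter.Eventually.of_forall fun x => by
          have := Complex.norm_exp_ofReal_mul_I (t * x)
          push_cast at this
          exact this.le)
    · have e : Integrable (fun x => (ENNReal.ofReal (-r x)).toReal) μ := by
        simp_rw [ENNReal.toReal_ofReal']; exact hr.neg_part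
      exact e.smul_bdd 1 (by apply Continuous.aestronglyMeasurable; fun_prop)
        (Filter.Eventually.of_forall fun x => by
          have := Complex.norm_exp_ofReal_mul_I (t * x)
          push_cast at this
          exact this.le)
  rw [withDensity_eq_iff mp mn fp] at key
  filter_upwards [key] with x hx
  have := congrArg ENNReal.toReal hx
  rw [ENNReal.toReal_ofReal', ENNReal.toReal_ofReal'] at this
  rcases le_total 0 (r x) with h | h
  · rw [max_eq_left h, max_eq_right (by linarith)] at this; exact this
  · rw [max_eq_right h, max_eq_left (by linarith)] at this
    simp only [Pi.zero_apply]; linarith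

open MeasureTheory in
-- The hypothesis at `-t`, conjugated, is the hypothesis at `t` for the conjugate of `g`, so real
-- and imaginary parts can be treated separately.
theorem ae_eq_zero_of_fourier_eq_zero {μ : Measure ℝ} [IsFiniteMeasure μ] {g : ℝ → ℂ}
    (hg : Integrable g μ)
    (h : ∀ t : ℝ, ∫ x : ℝ, Complex.exp (Complex.I * (t * x)) * g x ∂μ = 0) : g =ᵐ[μ] 0 := by
  have bd : ∀ (f : ℝ → ℂ), Integrable f μ → ∀ t : ℝ,
      Integrable (fun x : ℝ => Complex.exp (Complex.I * (t * x)) * f x) μ := by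
    intro f hf t
    refine hf.bdd_mul (c := 1) (by apply Continuous.aestronglyMeasurable; fun_prop)
      (Filter.Eventually.of_forall fun x => ?_)
    have := norm_expI (t * x)
    push_cast at this
    exact this.le
  have hs : Integrable (fun x => star (g x)) μ := by
    simpa using (Complex.conjCLE.toContinuousLinearMap.integrable_comp hg)
  have h' : ∀ t : ℝ, ∫ x : ℝ, Complex.exp (Complex.I * (t * x)) * star (g x) ∂μ = 0 := by
    intro t
    have h1 := congrArg star (h (-t))
    rw [star_zero, Complex.star_def, ← integral_conj] at h1
    rw [← h1]
    congr 1
    funext x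
    rw [map_mul, ← Complex.exp_conj]
    simp
  have hre : (fun x => (g x).re) =ᵐ[μ] 0 := by
    refine ae_eq_zero_of_fourier_eq_zero_real hg.re fun t => ?_
    have e : ∀ x : ℝ, Complex.exp (Complex.I * (t * x)) * ((g x).re : ℂ) =
        (1 / 2 : ℂ) * (Complex.exp (Complex.I * (t * x)) * g x +
          Complex.exp (Complex.I * (t * x)) * star (g x)) := by
      intro x
      rw [Complex.re_eq_add_conj, Complex.star_def]
      ring
    simp_rw [e]
    rw [integral_const_mul, integral_add (bd _ hg t) (bd _ hs t), h, h']
    simp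
  have him : (fun x => (g x).im) =ᵐ[μ] 0 := by
    refine ae_eq_zero_of_fourier_eq_zero_real hg.im fun t => ?_
    have e : ∀ x : ℝ, Complex.exp (Complex.I * (t * x)) * ((g x).im : ℂ) =
        (1 / (2 * Complex.I) : ℂ) * (Complex.exp (Complex.I * (t * x)) * g x -
          Complex.exp (Complex.I * (t * x)) * star (g x)) := by
      intro x
      rw [Complex.im_eq_sub_conj, Complex.star_def]
      ring
    simp_rw [e]
    rw [integral_const_mul, integral_sub (bd _ hg t) (bd _ hs t), h, h']
    simp
  filter_upwards [hre, him] with x h1 h2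
  exact Complex.ext h1 h2

open MeasureTheory in
theorem memLp_exp (μ : Measure ℝ) [IsFiniteMeasure μ] (t : ℝ) :
    MemLp (fun x : ℝ => Complex.exp (Complex.I * ((-t : ℝ) * x))) 2 μ := by
  refine MemLp.of_bound (by apply Continuous.aestronglyMeasurable; fun_prop) 1
    (Filter.Eventually.of_forall fun x => ?_)
  have := norm_expI (-t * x)
  push_cast at this ⊢
  exact this.le

open MeasureTheory in
/-- The function `x ↦ exp(-itx)` as an element of `L²(μ)`. -/
noncomputable def expLp (μ : Measure ℝ) [IsFiniteMeasure μ] (t : ℝ) : Lp ℂ 2 μ :=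
  (memLp_exp μ t).toLp

open MeasureTheory in
theorem inner_expLp_left (μ : Measure ℝ) [IsFiniteMeasure μ] (t : ℝ) (g : Lp ℂ 2 μ) :
    inner ℂ (expLp μ t) g = ∫ x : ℝ, Complex.exp (Complex.I * (t * x)) * g x ∂μ := by
  rw [L2.inner_def]
  refine integral_congr_ae ?_
  filter_upwards [(memLp_exp μ t).coeFn_toLp] with x hx
  rw [expLp, hx, RCLike.inner_apply', ← Complex.exp_conj]
  congr 2
  simp

open MeasureTheory in
theorem inner_expLp_expLp (μ : Measure ℝ) [IsFiniteMeasure μ] (s t : ℝ) :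
    inner ℂ (expLp μ s) (expLp μ t) =
      ∫ x : ℝ, Complex.exp (Complex.I * ((-(t - s) : ℝ) * x)) * 1 ∂μ := by
  rw [inner_expLp_left]
  refine integral_congr_ae ?_
  filter_upwards [(memLp_exp μ t).coeFn_toLp] with x hx
  rw [expLp, hx, ← Complex.exp_add, mul_one]
  congr 1
  push_cast
  ring

open MeasureTheory in
-- A vector `g` orthogonal to all exponentials has vanishing Fourier transform of `g dμ`, hence is
-- zero.
theorem denseRange_linearCombination_expLp (μ : Measure ℝ) [IsFiniteMeasure μ] :
    DenseRange (Finsupp.linearCombination ℂ (expLp μ)) := by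
  have h1 : (LinearMap.range (Finsupp.linearCombination ℂ (expLp μ))).topologicalClosure = ⊤ := by
    rw [Submodule.topologicalClosure_eq_top_iff, Submodule.eq_bot_iff]
    intro g hg
    have h2 : ∀ t : ℝ, ∫ x : ℝ, Complex.exp (Complex.I * (t * x)) * g x ∂μ = 0 := by
      intro t
      rw [← inner_expLp_left]
      exact hg _ ⟨Finsupp.single t 1, by simp⟩
    have := ae_eq_zero_of_fourier_eq_zero ((Lp.memLp g).integrable one_le_two) h2
    exact (Lp.eq_zero_iff_ae_eq_zero).2 this
  exact (Submodule.dense_iff_topologicalClosure_eq_top).2 h1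

/-- The Gram matrix determines the norms of all linear combinations. This is what makes `exp(-itx) ↦
U t φ` extend to a well-defined isometry. -/
theorem norm_linearCombination_eq {ι E F : Type*} [NormedAddCommGroup E] [InnerProductSpace ℂ E]
    [NormedAddCommGroup F] [InnerProductSpace ℂ F] {v : ι → E} {w : ι → F}
    (h : ∀ i j, inner ℂ (v i) (v j) = inner ℂ (w i) (w j)) (a : ι →₀ ℂ) :
    ‖Finsupp.linearCombination ℂ v a‖ = ‖Finsupp.linearCombination ℂ w a‖ := by
  have : inner ℂ (Finsupp.linearCombination ℂ v a) (Finsupp.linearCombination ℂ v a) =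
      inner ℂ (Finsupp.linearCombination ℂ w a) (Finsupp.linearCombination ℂ w a) := by
    simp only [Finsupp.linearCombination_apply, Finsupp.sum, sum_inner, inner_sum, inner_smul_left,
      inner_smul_right, h]
  rw [inner_self_eq_norm_sq_to_K, inner_self_eq_norm_sq_to_K] at this
  have h2 : ‖Finsupp.linearCombination ℂ v a‖ ^ 2 = ‖Finsupp.linearCombination ℂ w a‖ ^ 2 := by
    exact_mod_cast this
  exact (sq_eq_sq₀ (norm_nonneg _) (norm_nonneg _)).1 h2

/-! ### The cyclic subspace and spreading from small spectral mass. -/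

section cyclic

variable {E : Type*} [NormedAddCommGroup E] [InnerProductSpace ℂ E] [CompleteSpace E]
  {T : E →ₗ.[ℂ] E} {U : ℝ → E →L[ℂ] E}

open MeasureTheory in
/-- The spectral representation of the cyclic subspace of `φ`. -/
theorem IsUnitaryGroup.exists_isometry (hU : IsUnitaryGroup T U) {φ : E} {μ : Measure ℝ}
    [IsFiniteMeasure μ] (hμ : IsSpectralMeasure T φ μ) :
    ∃ W : Lp ℂ 2 μ →L[ℂ] E, (∀ g, ‖W g‖ = ‖g‖) ∧ ∀ t, W (expLp μ t) = U t φ := by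
  set e := Finsupp.linearCombination ℂ (expLp μ) with he
  set f := Finsupp.linearCombination ℂ (fun t => U t φ) with hf
  have hd : DenseRange e := denseRange_linearCombination_expLp μ
  -- Both Gram matrices have as entries the Fourier transform of `μ` at the time difference.
  have hn : ∀ a, ‖f a‖ = ‖e a‖ := norm_linearCombination_eq fun s t => by
    rw [hU.inner_map_eq, hU.inner_self_eq hμ, inner_expLp_expLp]
  have hext : ∀ a, f.extendOfNorm e (e a) = f a := fun a =>
    LinearMap.extendOfNorm_eq hd ⟨1, fun x => by rw [hn, one_mul]⟩ a
  refine ⟨f.extendOfNorm e, fun g => ?_, fun t => ?_⟩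
  · refine hd.induction (P := fun g => ‖f.extendOfNorm e g‖ = ‖g‖) ?_
      (isClosed_eq (by fun_prop) (by fun_prop)) g
    rintro _ ⟨a, rfl⟩
    rw [hext, hn]
  · have := hext (Finsupp.single t 1)
    simpa [he, hf] using this

open MeasureTheory in
-- Here `f = W* χ`, and in the spectral representation `U t` acts as multiplication by `exp(-itx)`.
-- It suffices to check this on exponentials, which span a dense subspace.
theorem IsUnitaryGroup.exists_inner_map_eq (hU : IsUnitaryGroup T U) {φ : E} {μ : Measure ℝ}
    [IsFiniteMeasure μ] {W : Lp ℂ 2 μ →L[ℂ] E} (hW : ∀ g, ‖W g‖ = ‖g‖)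
    (hWe : ∀ t, W (expLp μ t) = U t φ) (χ : E) :
    ∃ f : Lp ℂ 2 μ, ‖f‖ ≤ ‖χ‖ ∧ ∀ (t : ℝ) (g : Lp ℂ 2 μ), inner ℂ χ (U t (W g)) =
      ∫ x : ℝ, star (Complex.exp (Complex.I * (t * x)) * f x) * g x ∂μ := by
  refine ⟨W.adjoint χ, ?_, fun t g => ?_⟩
  · have h1 : ‖W‖ ≤ 1 := W.opNorm_le_bound zero_le_one fun g => by rw [hW, one_mul]
    calc _ ≤ ‖W.adjoint‖ * ‖χ‖ := ContinuousLinearMap.le_opNorm _ _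
      _ ≤ 1 * ‖χ‖ := by gcongr; rw [LinearIsometryEquiv.norm_map]; exact h1
      _ = _ := one_mul _
  set f := W.adjoint χ with hf
  have hm : MemLp (fun x : ℝ => Complex.exp (Complex.I * (t * x)) * f x) 2 μ := by
    refine (Lp.memLp f).of_le ((by apply Continuous.aestronglyMeasurable; fun_prop :
      AEStronglyMeasurable (fun x : ℝ => Complex.exp (Complex.I * (t * x))) μ).mul
        (Lp.memLp f).1) (Filter.Eventually.of_forall fun x => ?_)
    have := norm_expI (t * x)
    push_cast at this
    rw [norm_mul, this, one_mul]
  have hr : ∀ g : Lp ℂ 2 μ, ∫ x : ℝ, star (Complex.exp (Complex.I * (t * x)) * f x) * g x ∂μ =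
      inner ℂ hm.toLp g := by
    intro g
    rw [L2.inner_def]
    refine integral_congr_ae ?_
    filter_upwards [hm.coeFn_toLp] with x hx
    rw [hx, RCLike.inner_apply', Complex.star_def]
  rw [hr]
  refine (denseRange_linearCombination_expLp μ).induction
    (P := fun g => inner ℂ χ (U t (W g)) = inner ℂ hm.toLp g) ?_
    (isClosed_eq (by fun_prop) (by fun_prop)) g
  rintro _ ⟨a, rfl⟩
  induction a using Finsupp.induction_linear with
  | zero => simp
  | add a b ha hb => rw [map_add, map_add, map_add, inner_add_right, inner_add_right, ha, hb]
  | single s c =>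
    rw [Finsupp.linearCombination_single, map_smul, map_smul, inner_smul_right, inner_smul_right,
      hWe, ← mul_apply_eq_comp, ← hU.add, ← hWe, ← ContinuousLinearMap.adjoint_inner_left, ← hf]
    congr 1
    rw [L2.inner_def, L2.inner_def]
    refine integral_congr_ae ?_
    filter_upwards [hm.coeFn_toLp, (memLp_exp μ s).coeFn_toLp, (memLp_exp μ (t + s)).coeFn_toLp]
      with x h1 h2 h3
    rw [h1, expLp, expLp, h2, h3, RCLike.inner_apply', RCLike.inner_apply', map_mul,
      ← Complex.exp_conj, mul_right_comm, ← Complex.exp_add, mul_comm]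
    congr 2
    simp
    ring

open MeasureTheory in
/-- A state which lives on a union of cells of small mass spreads: it does not
concentrate on any unit vector. -/
theorem IsUnitaryGroup.timeAverage_inner_le (hU : IsUnitaryGroup T U) {φ : E} {μ : Measure ℝ}
    [IsFiniteMeasure μ] {W : Lp ℂ 2 μ →L[ℂ] E} (hW : ∀ g, ‖W g‖ = ‖g‖)
    (hWe : ∀ t, W (expLp μ t) = U t φ) {τ : ℝ} (hτ : 0 < τ)
    (J : Finset ℤ) {b : ℝ} (hb0 : 0 ≤ b) (hb : ∀ j ∈ J, μ (cell τ j) ≤ ENNReal.ofReal b)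
    (hJ : MeasurableSet (⋃ j ∈ J, cell τ j)) (χ : E) :
    2 / τ * ∫ t in Set.Ioi (0 : ℝ), Real.exp (-2 * t / τ) *
        ‖inner ℂ χ (U t (W (indicatorConstLp 2 hJ (measure_ne_top μ _) (1 : ℂ))))‖ ^ 2 ≤
      16 * (∑' k : ℤ, 1 / (1 + (k : ℝ) ^ 2)) * b * ‖χ‖ ^ 2 := by
  obtain ⟨f, hf, hfU⟩ := hU.exists_inner_map_eq hW hWe χ
  -- The amplitude is the conjugate of the Fourier transform of `f dμ` restricted to the cells, so
  -- Strichartz' estimate applies with `f` as density.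
  have h1 : ∀ t : ℝ,
      ‖inner ℂ χ (U t (W (indicatorConstLp 2 hJ (measure_ne_top μ _) (1 : ℂ))))‖ =
      ‖∫ x in ⋃ j ∈ J, cell τ j, Complex.exp (Complex.I * (t * x)) * f x ∂μ‖ := by
    intro t
    rw [hfU, ← norm_star (∫ x in ⋃ j ∈ J, cell τ j, Complex.exp (Complex.I * (t * x)) * f x ∂μ),
      Complex.star_def, ← integral_conj, ← integral_indicator hJ]
    congr 1
    refine integral_congr_ae ?_
    filter_upwards [indicatorConstLp_coeFn (p := 2) (hs := hJ) (hμs := measure_ne_top μ _)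
      (c := (1 : ℂ))] with x hx
    rw [hx]
    by_cases hxA : x ∈ ⋃ j ∈ J, cell τ j
    · rw [Set.indicator_of_mem hxA, Set.indicator_of_mem hxA, mul_one]
    · rw [Set.indicator_of_notMem hxA, Set.indicator_of_notMem hxA, mul_zero]
  simp_rw [h1]
  refine (timeAverage_normSq_le hτ J hb0 hb ((Lp.memLp f).restrict _)).trans ?_
  have hS0 : 0 ≤ ∑' k : ℤ, 1 / (1 + (k : ℝ) ^ 2) := tsum_nonneg fun k => by positivity
  have h2 : ∫ x in ⋃ j ∈ J, cell τ j, ‖f x‖ ^ 2 ∂μ ≤ ‖χ‖ ^ 2 := by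
    have h3 : ‖f‖ ^ 2 = ∫ x, ‖f x‖ ^ 2 ∂μ := by
      have h4 : (inner ℂ f f) = ((‖f‖ : ℂ)) ^ 2 := inner_self_eq_norm_sq_to_K f
      rw [L2.inner_def] at h4
      have h5 : ((‖f‖ ^ 2 : ℝ) : ℂ) = ((∫ x, ‖f x‖ ^ 2 ∂μ : ℝ) : ℂ) := by
        rw [← integral_complex_ofReal]
        push_cast
        rw [← h4]
        congr 1
        funext x
        exact inner_self_eq_norm_sq_to_K (f x)
      exact_mod_cast h5
    calc _ ≤ ∫ x, ‖f x‖ ^ 2 ∂μ :=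
          setIntegral_le_integral ((memLp_two_iff_integrable_sq_norm (Lp.memLp f).1).1 (Lp.memLp f))
            (Filter.Eventually.of_forall fun x => by positivity)
      _ = ‖f‖ ^ 2 := h3.symm
      _ ≤ ‖χ‖ ^ 2 := by gcongr
  gcongr

end cyclic

/-! ### Perturbation of solutions in the energy. -/

section recurrence

variable {q : ℕ → ℝ} {u v : ℕ → ℝ}

/-- Constancy of the Wronskian. -/
theorem wronskian_eq (hu : ∀ n, u (n + 2) = q (n + 1) * u (n + 1) - u n)
    (hv : ∀ n, v (n + 2) = q (n + 1) * v (n + 1) - v n) (h0 : u 1 * v 0 - v 1 * u 0 = 1) (n : ℕ) :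
    u (n + 1) * v n - v (n + 1) * u n = 1 := by
  induction n with
  | zero => exact h0
  | succ n ih => rw [hu, hv]; linarith

/-- Variation of constants. -/
theorem variation_of_constants (hu : ∀ n, u (n + 2) = q (n + 1) * u (n + 1) - u n)
    (hv : ∀ n, v (n + 2) = q (n + 1) * v (n + 1) - v n) (h0 : u 1 * v 0 - v 1 * u 0 = 1)
    {w ρ : ℕ → ℂ} {ζ : ℂ} (h1 : w 1 = 0) (h2 : w 2 = 0) (hρ0 : ρ 0 = 0) (hρ1 : ρ 1 = 0)
    (hw : ∀ n, w (n + 3) = q (n + 2) * w (n + 2) - w (n + 1) + ζ * ρ (n + 2)) (n : ℕ) :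
    w (n + 1) = ζ * ∑ m ∈ Finset.range (n + 1),
      ((u (n + 1) * v m - v (n + 1) * u m : ℝ) : ℂ) * ρ m := by
  set s : ℕ → ℂ := fun n => ∑ m ∈ Finset.range n, ((u n * v m - v n * u m : ℝ) : ℂ) * ρ m with hs
  have hrec : ∀ n, s (n + 2) = q (n + 1) * s (n + 1) - s n + ρ (n + 1) := by
    intro n
    have hW := wronskian_eq hu hv h0 n
    -- The two added summands, `m = n` and `m = n + 1`, are 0 and `-ρ (n + 1)` by constancy of the
    -- Wronskian; this is where the source term appears.
    have e1 : ∑ m ∈ Finset.range (n + 2), ((u n * v m - v n * u m : ℝ) : ℂ) * ρ m =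
        s n - ρ (n + 1) := by
      rw [Finset.sum_range_succ, Finset.sum_range_succ]
      have h3 : u n * v n - v n * u n = 0 := by ring
      have h4 : u n * v (n + 1) - v n * u (n + 1) = -1 := by linarith
      rw [h3, h4]
      simp only [hs]
      push_cast
      ring
    have e2 : ∑ m ∈ Finset.range (n + 2), ((u (n + 1) * v m - v (n + 1) * u m : ℝ) : ℂ) * ρ m =
        s (n + 1) := by
      rw [Finset.sum_range_succ]
      have h3 : u (n + 1) * v (n + 1) - v (n + 1) * u (n + 1) = 0 := by ring
      rw [h3]
      simp only [hs]
      push_cast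
      ring
    calc s (n + 2) = ∑ m ∈ Finset.range (n + 2),
          (q (n + 1) * (((u (n + 1) * v m - v (n + 1) * u m : ℝ) : ℂ) * ρ m) -
            ((u n * v m - v n * u m : ℝ) : ℂ) * ρ m) := by
          refine Finset.sum_congr rfl fun m _ => ?_
          rw [hu, hv]
          push_cast
          ring
      _ = _ := by
          rw [Finset.sum_sub_distrib, ← Finset.mul_sum, e1, e2]
          ring
  have key : ∀ n, w (n + 1) = ζ * s (n + 1) ∧ w (n + 2) = ζ * s (n + 2) := by
    intro n
    induction n with
    | zero =>
      have s1 : s 1 = 0 := by simp [hs, hρ0]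
      have s2 : s 2 = 0 := by simp [hs, hρ0, hρ1, Finset.sum_range_succ]
      simp [h1, h2, s1, s2]
    | succ n ih =>
      refine ⟨ih.2, ?_⟩
      have := hw n
      rw [ih.1, ih.2] at this
      rw [show n + 1 + 2 = n + 3 by ring, this, hrec (n + 1)]
      ring
  exact (key n).1

/-- Lagrange's identity: the weighted Hilbert-Schmidt norm of the variation-of-constants kernel is
twice a Gram determinant. -/
theorem sum_sum_wronskian_sq (s : Finset ℕ) (c u v : ℕ → ℝ) :
    ∑ n ∈ s, ∑ m ∈ s, c n * c m * (u n * v m - v n * u m) ^ 2 =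
      2 * ((∑ n ∈ s, c n * u n ^ 2) * (∑ n ∈ s, c n * v n ^ 2) - (∑ n ∈ s, c n * (u n * v n)) ^ 2) := by
  calc _ = ∑ n ∈ s, ∑ m ∈ s, ((c n * u n ^ 2) * (c m * v m ^ 2) + (c n * v n ^ 2) * (c m * u m ^ 2) -
        2 * (c n * (u n * v n)) * (c m * (u m * v m))) :=
        Finset.sum_congr rfl fun n _ => Finset.sum_congr rfl fun m _ => by ring
    _ = _ := by
        simp only [Finset.sum_add_distrib, Finset.sum_sub_distrib, ← Finset.mul_sum,
          ← Finset.sum_mul]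
        ring

/-- The deviation of a solution at the energy `z` from the one at the energy `E` with the same
initial data is controlled by the Gram determinant of a basis of solutions. -/
theorem sum_normSq_deviation_le (hu : ∀ n, u (n + 2) = q (n + 1) * u (n + 1) - u n)
    (hv : ∀ n, v (n + 2) = q (n + 1) * v (n + 1) - v n) (h0 : u 1 * v 0 - v 1 * u 0 = 1)
    {ψ w : ℕ → ℂ} {ζ : ℂ} (h1 : w 1 = 0) (h2 : w 2 = 0)
    (hw : ∀ n, w (n + 3) = q (n + 2) * w (n + 2) - w (n + 1) + ζ * ψ (n + 2))
    {c : ℕ → ℝ} (hc0 : ∀ n, 0 ≤ c n) (hc : ∀ m n, m < n → c n ≠ 0 → c m = 1) (N : ℕ) :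
    ∑ n ∈ Finset.Icc 1 N, c n * ‖w n‖ ^ 2 ≤ ‖ζ‖ ^ 2 *
      (2 * ((∑ n ∈ Finset.Icc 1 N, c n * u n ^ 2) * (∑ n ∈ Finset.Icc 1 N, c n * v n ^ 2) -
        (∑ n ∈ Finset.Icc 1 N, c n * (u n * v n)) ^ 2)) *
      ∑ n ∈ Finset.Icc 1 N, c n * ‖ψ n‖ ^ 2 := by
  -- The deviation vanishes at the sites 1 and 2, so sources act only from site 2 on; the values of
  -- `ψ` below are irrelevant.
  set ρ : ℕ → ℂ := fun n => if n < 2 then 0 else ψ n with hρ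
  have hwn := variation_of_constants hu hv h0 (w := w) (ρ := ρ) (ζ := ζ) h1 h2 (by simp [hρ])
    (by simp [hρ]) (fun n => by rw [hw]; simp [hρ])
  have hρψ : ∀ n, ‖ρ n‖ ^ 2 ≤ ‖ψ n‖ ^ 2 := by
    intro n
    simp only [hρ]
    split_ifs
    · simp
    · exact le_rfl
  rw [← sum_sum_wronskian_sq, mul_assoc, Finset.sum_mul, Finset.mul_sum]
  refine Finset.sum_le_sum fun n hn => ?_
  obtain ⟨hn1, hnN⟩ := Finset.mem_Icc.1 hn
  by_cases hcn : c n = 0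
  · simp [hcn]
  have hsub : Finset.Ico 1 n ⊆ Finset.Icc 1 N := fun m hm => by
    rw [Finset.mem_Ico] at hm; rw [Finset.mem_Icc]; omega
  -- Below a site of nonzero weight all weights are 1, so the unweighted Cauchy-Schwarz inequality
  -- over `m < n` is dominated by the weighted sums.
  have hcm : ∀ m ∈ Finset.Ico 1 n, c m = 1 := fun m hm => hc m n (Finset.mem_Ico.1 hm).2 hcn
  have e1 : w n = ζ * ∑ m ∈ Finset.Ico 1 n, ((u n * v m - v n * u m : ℝ) : ℂ) * ρ m := by
    obtain ⟨k, rfl⟩ : ∃ k, n = k + 1 := ⟨n - 1, by omega⟩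
    rw [hwn k, Finset.range_eq_Ico, Finset.sum_eq_sum_Ico_succ_bot (Nat.succ_pos k)]
    simp [hρ]
  have b1 : ‖∑ m ∈ Finset.Ico 1 n, ((u n * v m - v n * u m : ℝ) : ℂ) * ρ m‖ ^ 2 ≤
      (∑ m ∈ Finset.Ico 1 n, (u n * v m - v n * u m) ^ 2) * ∑ m ∈ Finset.Ico 1 n, ‖ρ m‖ ^ 2 := by
    have h3 : ‖∑ m ∈ Finset.Ico 1 n, ((u n * v m - v n * u m : ℝ) : ℂ) * ρ m‖ ≤
        ∑ m ∈ Finset.Ico 1 n, |u n * v m - v n * u m| * ‖ρ m‖ := by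
      refine (norm_sum_le _ _).trans (le_of_eq (Finset.sum_congr rfl fun m _ => ?_))
      rw [norm_mul, Complex.norm_real, Real.norm_eq_abs]
    calc _ ≤ (∑ m ∈ Finset.Ico 1 n, |u n * v m - v n * u m| * ‖ρ m‖) ^ 2 := by gcongr
      _ ≤ _ := by
        have := Finset.sum_mul_sq_le_sq_mul_sq (Finset.Ico 1 n)
          (fun m => |u n * v m - v n * u m|) (fun m => ‖ρ m‖)
        simpa only [sq_abs] using this
  have b2 : ∑ m ∈ Finset.Ico 1 n, ‖ρ m‖ ^ 2 ≤ ∑ m ∈ Finset.Icc 1 N, c m * ‖ψ m‖ ^ 2 := by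
    calc _ ≤ ∑ m ∈ Finset.Ico 1 n, c m * ‖ψ m‖ ^ 2 := Finset.sum_le_sum fun m hm => by
          rw [hcm m hm, one_mul]; exact hρψ m
      _ ≤ _ := Finset.sum_le_sum_of_subset_of_nonneg hsub fun m _ _ =>
          mul_nonneg (hc0 m) (by positivity)
  have b3 : c n * ∑ m ∈ Finset.Ico 1 n, (u n * v m - v n * u m) ^ 2 ≤
      ∑ m ∈ Finset.Icc 1 N, c n * c m * (u n * v m - v n * u m) ^ 2 := by
    rw [Finset.mul_sum]
    calc _ = ∑ m ∈ Finset.Ico 1 n, c n * c m * (u n * v m - v n * u m) ^ 2 :=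
          Finset.sum_congr rfl fun m hm => by rw [hcm m hm, mul_one]
      _ ≤ _ := Finset.sum_le_sum_of_subset_of_nonneg hsub fun m _ _ =>
          mul_nonneg (mul_nonneg (hc0 n) (hc0 m)) (by positivity)
  have hP : 0 ≤ ∑ m ∈ Finset.Icc 1 N, c m * ‖ψ m‖ ^ 2 :=
    Finset.sum_nonneg fun m _ => mul_nonneg (hc0 m) (by positivity)
  rw [e1, norm_mul, mul_pow]
  calc _ ≤ c n * (‖ζ‖ ^ 2 * ((∑ m ∈ Finset.Ico 1 n, (u n * v m - v n * u m) ^ 2) *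
        ∑ m ∈ Finset.Icc 1 N, c m * ‖ψ m‖ ^ 2)) := by
        refine mul_le_mul_of_nonneg_left (mul_le_mul_of_nonneg_left (b1.trans ?_) (by positivity))
          (hc0 n)
        exact mul_le_mul_of_nonneg_left b2 (Finset.sum_nonneg fun m _ => by positivity)
    _ = ‖ζ‖ ^ 2 * ((c n * ∑ m ∈ Finset.Ico 1 n, (u n * v m - v n * u m) ^ 2) *
        ∑ m ∈ Finset.Icc 1 N, c m * ‖ψ m‖ ^ 2) := by ring
    _ ≤ _ := by
        refine mul_le_mul_of_nonneg_left (mul_le_mul_of_nonneg_right b3 hP) (by positivity)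

theorem norm_add_sq_le_mul {a b : ℂ} {δ : ℝ} (hδ : 0 < δ) :
    ‖a + b‖ ^ 2 ≤ (1 + δ) * ‖a‖ ^ 2 + (1 + 1 / δ) * ‖b‖ ^ 2 := by
  have h1 : ‖a + b‖ ^ 2 ≤ (‖a‖ + ‖b‖) ^ 2 := by gcongr; exact norm_add_le a b
  have h2 : 2 * ‖a‖ * ‖b‖ ≤ δ * ‖a‖ ^ 2 + 1 / δ * ‖b‖ ^ 2 := by
    have h3 : δ * ‖a‖ ^ 2 + 1 / δ * ‖b‖ ^ 2 - 2 * ‖a‖ * ‖b‖ = (δ * ‖a‖ - ‖b‖) ^ 2 / δ := by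
      field_simp; ring
    have : 0 ≤ (δ * ‖a‖ - ‖b‖) ^ 2 / δ := by positivity
    linarith
  nlinarith

/-- The scaling property is stable under small perturbations. -/
theorem scaling_of_deviation_le {s : Finset ℕ} {c c' : ℕ → ℝ} (hc' : ∀ n, 0 ≤ c' n)
    (hcc : ∀ n, c' n ≤ c n) {ψ φ w : ℕ → ℂ} (hψ : ∀ n ∈ s, ψ n = φ n + w n) {γ : ℝ} (hγ : 0 < γ)
    (hγ1 : γ < 1) (hw : ∑ n ∈ s, c n * ‖w n‖ ^ 2 ≤ γ ^ 2 / 512 * ∑ n ∈ s, c n * ‖ψ n‖ ^ 2)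
    (hφ : (1 + γ) * ∑ n ∈ s, c' n * ‖φ n‖ ^ 2 ≤ ∑ n ∈ s, c n * ‖φ n‖ ^ 2) :
    γ / 16 * ∑ n ∈ s, c n * ‖φ n‖ ^ 2 ≤ ∑ n ∈ s, (c n - c' n) * ‖ψ n‖ ^ 2 := by
  -- The gain is `1 + 8δ`, while each passage between `ψ` and `φ` costs a factor `1 + δ`; the
  -- smallness of `W` is `δ²/8`, which makes the cross terms at most `(δ/4) P`.
  set δ := γ / 8 with hδ
  have hδ0 : 0 < δ := by positivity
  set P := ∑ n ∈ s, c n * ‖ψ n‖ ^ 2 with hP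
  set P' := ∑ n ∈ s, c' n * ‖ψ n‖ ^ 2 with hP'
  set F := ∑ n ∈ s, c n * ‖φ n‖ ^ 2 with hF
  set F' := ∑ n ∈ s, c' n * ‖φ n‖ ^ 2 with hF'
  set W := ∑ n ∈ s, c n * ‖w n‖ ^ 2 with hW
  have hc : ∀ n, 0 ≤ c n := fun n => (hc' n).trans (hcc n)
  have hP0 : 0 ≤ P := Finset.sum_nonneg fun n _ => mul_nonneg (hc n) (by positivity)
  have hF'0 : 0 ≤ F' := Finset.sum_nonneg fun n _ => mul_nonneg (hc' n) (by positivity)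
  have h1 : P' ≤ (1 + δ) * F' + (1 + 1 / δ) * W := by
    rw [hF', hW, Finset.mul_sum, Finset.mul_sum, ← Finset.sum_add_distrib]
    refine Finset.sum_le_sum fun n hn => ?_
    have h3 := norm_add_sq_le_mul (a := φ n) (b := w n) hδ0
    rw [← hψ n hn] at h3
    have h4 : (1 + 1 / δ) * (c' n * ‖w n‖ ^ 2) ≤ (1 + 1 / δ) * (c n * ‖w n‖ ^ 2) := by
      gcongr; exact hcc n
    nlinarith [mul_le_mul_of_nonneg_left h3 (hc' n)]
  have h2 : F ≤ (1 + δ) * P + (1 + 1 / δ) * W := by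
    rw [hP, hW, Finset.mul_sum, Finset.mul_sum, ← Finset.sum_add_distrib]
    refine Finset.sum_le_sum fun n hn => ?_
    have h3 := norm_add_sq_le_mul (a := ψ n) (b := -w n) hδ0
    rw [show ψ n + -w n = φ n by rw [hψ n hn]; ring, norm_neg] at h3
    nlinarith [mul_le_mul_of_nonneg_left h3 (hc n)]
  have h3 : (1 + 1 / δ) * W ≤ δ / 4 * P := by
    have e : γ ^ 2 / 512 = δ ^ 2 / 8 := by rw [hδ]; ring
    rw [e] at hw
    have h5 : (1 + 1 / δ) * W ≤ (1 + 1 / δ) * (δ ^ 2 / 8 * P) :=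
      mul_le_mul_of_nonneg_left hw (by positivity)
    have h6 : (1 + 1 / δ) * (δ ^ 2 / 8 * P) = (δ + 1) * δ / 8 * P := by field_simp
    have h7 : (δ + 1) * δ / 8 * P ≤ δ / 4 * P := by
      apply mul_le_mul_of_nonneg_right _ hP0
      nlinarith
    linarith
  have e0 : ∑ n ∈ s, (c n - c' n) * ‖ψ n‖ ^ 2 = P - P' := by
    rw [hP, hP', ← Finset.sum_sub_distrib]
    exact Finset.sum_congr rfl fun n _ => sub_mul _ _ _
  rw [e0]
  have hγδ : γ = 8 * δ := by rw [hδ]; ring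
  rw [hγδ] at hφ hγ1 ⊢
  have h4 : F ≤ (1 + 5 / 4 * δ) * P := by linarith
  have h5 : (1 + 8 * δ) * P' ≤ (1 + 8 * δ) * ((1 - δ) * P) := by
    have a1 : (1 + 8 * δ) * P' ≤ (1 + δ) * F + (1 + 8 * δ) * (δ / 4 * P) := by
      have : P' ≤ (1 + δ) * F' + δ / 4 * P := by linarith
      calc _ ≤ (1 + 8 * δ) * ((1 + δ) * F' + δ / 4 * P) := by gcongr
        _ = (1 + δ) * ((1 + 8 * δ) * F') + (1 + 8 * δ) * (δ / 4 * P) := by ring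
        _ ≤ _ := by gcongr
    have a2 : (1 + δ) * F ≤ (1 + δ) * ((1 + 5 / 4 * δ) * P) := by gcongr
    have a3 : ((1 + δ) * (1 + 5 / 4 * δ) + (1 + 8 * δ) * (δ / 4)) * P ≤
        ((1 + 8 * δ) * (1 - δ)) * P := by
      apply mul_le_mul_of_nonneg_right _ hP0
      nlinarith
    linarith
  -- Thus the difference `P - P'` is at least `δP`, and `F ≤ 2P` turns this into `δ/2 = γ/16` times
  -- `F`.
  have h6 : P' ≤ (1 - δ) * P := le_of_mul_le_mul_left h5 (by positivity)
  have h7 : F ≤ 2 * P := h4.trans (mul_le_mul_of_nonneg_right (by linarith) hP0)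
  nlinarith

end recurrence

/-! ### Real solutions and their truncated norms. -/

section solutions

/-- The weight of the site `n` in the truncated norm `‖·‖_L`. -/
noncomputable def cut (L : ℝ) (n : ℕ) : ℝ := max 0 (min 1 (L + 1 - n))

theorem cut_nonneg (L : ℝ) (n : ℕ) : 0 ≤ cut L n := le_max_left _ _

theorem cut_le_one (L : ℝ) (n : ℕ) : cut L n ≤ 1 := max_le zero_le_one (min_le_left _ _)

theorem cut_mono {K L : ℝ} (h : K ≤ L) (n : ℕ) : cut K n ≤ cut L n := by
  unfold cut; gcongr

theorem cut_eq_one {L : ℝ} {n : ℕ} (h : (n : ℝ) ≤ L) : cut L n = 1 := by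
  unfold cut
  rw [min_eq_left (by linarith), max_eq_right zero_le_one]

theorem cut_eq_zero {L : ℝ} {n : ℕ} (h : L + 1 ≤ n) : cut L n = 0 := by
  unfold cut
  exact max_eq_left ((min_le_right _ _).trans (by linarith))

theorem cut_eq_one_of_lt {L : ℝ} {m n : ℕ} (h : m < n) (hn : cut L n ≠ 0) : cut L m = 1 := by
  apply cut_eq_one
  by_contra hc
  apply hn
  apply cut_eq_zero
  have : (m : ℝ) + 1 ≤ n := by exact_mod_cast h
  linarith

theorem continuous_cut (n : ℕ) : Continuous fun L => cut L n := by
  unfold cut; fun_prop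

/-- The upper summation limit is free, so several values of `L` share one finite sum in which `L`
enters only through weights continuous in `L`. -/
theorem normSqUpTo_eq_sum (u : ℤ → ℝ) {L : ℝ} (hL : 0 ≤ L) {N : ℕ} (hN : ⌊L⌋₊ + 1 ≤ N) :
    normSqUpTo u L = ∑ n ∈ Finset.Icc 1 N, cut L n * u n ^ 2 := by
  set M := ⌊L⌋₊ with hM
  have h1 : ∑ n ∈ Finset.Icc 1 N, cut L n * u n ^ 2 =
      ∑ n ∈ Finset.Icc 1 (M + 1), cut L n * u n ^ 2 := by
    symm
    refine Finset.sum_subset (Finset.Icc_subset_Icc_right hN) fun n _ hn => ?_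
    have h2 : M + 1 < n := by
      rw [Finset.mem_Icc] at *; omega
    have h3 : ((M + 1 : ℕ) : ℝ) + 1 ≤ n := by exact_mod_cast h2
    have h4 := Nat.lt_floor_add_one L
    rw [cut_eq_zero (by push_cast at h3; rw [← hM] at h4; linarith), zero_mul]
  rw [h1, Finset.sum_Icc_succ_top (by omega), normSqUpTo]
  have h5 : (M : ℝ) ≤ L := Nat.floor_le hL
  congr 1
  · refine Finset.sum_congr rfl fun n hn => ?_
    have : (n : ℝ) ≤ M := by exact_mod_cast (Finset.mem_Icc.1 hn).2
    rw [cut_eq_one (this.trans h5), one_mul, sq_abs]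
  · have h4 := Nat.lt_floor_add_one L
    rw [← hM] at h4
    have : cut L (M + 1) = L - M := by
      unfold cut
      push_cast
      rw [min_eq_right (by linarith), max_eq_right (by linarith)]
      ring
    rw [this, sq_abs]
    push_cast
    rfl

/-- The forward solution of `f (n + 2) = q (n + 1) f (n + 1) - f n` with given initial values. -/
def forwardSol (q : ℕ → ℝ) (a b : ℝ) : ℕ → ℝ
  | 0 => a
  | 1 => b
  | n + 2 => q (n + 1) * forwardSol q a b (n + 1) - forwardSol q a b n

/-- The solution at the energy `E` on the whole line with `u 0 = a` and `u 1 = b`. -/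
def lineSol (V : ℤ → ℝ) (E a b : ℝ) (n : ℤ) : ℝ :=
  if 0 ≤ n then forwardSol (fun m => E - V m) a b n.toNat
  else forwardSol (fun m => E - V (1 - m)) b a (1 - n).toNat

theorem lineSol_natCast (V : ℤ → ℝ) (E a b : ℝ) (n : ℕ) :
    lineSol V E a b n = forwardSol (fun m => E - V m) a b n := by
  simp [lineSol]

/-- The reflection `n ↦ 1 - n` interchanges the sites 0 and 1 and turns the backward recursion into
a forward one with reflected potential; the two descriptions overlap at these sites. -/
theorem lineSol_neg (V : ℤ → ℝ) (E a b : ℝ) (n : ℕ) :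
    lineSol V E a b (1 - n) = forwardSol (fun m => E - V (1 - m)) b a n := by
  unfold lineSol
  split_ifs with h
  · have : n = 0 ∨ n = 1 := by omega
    rcases this with rfl | rfl <;> simp [forwardSol]
  · congr 1
    omega

theorem lineSol_zero (V : ℤ → ℝ) (E a b : ℝ) : lineSol V E a b 0 = a := by
  simpa [forwardSol] using lineSol_natCast V E a b 0

theorem lineSol_one (V : ℤ → ℝ) (E a b : ℝ) : lineSol V E a b 1 = b := by
  simpa [forwardSol] using lineSol_natCast V E a b 1

theorem isSolution_lineSol (S : Set ℤ) (V : ℤ → ℝ) (E a b : ℝ) :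
    IsSolution S V E (lineSol V E a b) := by
  intro n _
  rcases le_or_gt 1 n with h | h
  · obtain ⟨m, rfl⟩ : ∃ m : ℕ, n = (m : ℤ) + 1 := ⟨(n - 1).toNat, by omega⟩
    have e0 := lineSol_natCast V E a b m
    have e1 := lineSol_natCast V E a b (m + 1)
    have e2 := lineSol_natCast V E a b (m + 2)
    push_cast at e1 e2
    rw [show (m : ℤ) + 1 + 1 = m + 2 by ring, show (m : ℤ) + 1 - 1 = m by ring, e0, e1, e2,
      forwardSol]
    push_cast
    ring
  · obtain ⟨m, rfl⟩ : ∃ m : ℕ, n = 1 - ((m + 1 : ℕ) : ℤ) := ⟨(-n).toNat, by omega⟩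
    have e0 := lineSol_neg V E a b m
    have e1 := lineSol_neg V E a b (m + 1)
    have e2 := lineSol_neg V E a b (m + 2)
    rw [show (1 : ℤ) - ((m + 1 : ℕ) : ℤ) + 1 = 1 - m by push_cast; ring,
      show (1 : ℤ) - ((m + 1 : ℕ) : ℤ) - 1 = 1 - ((m + 2 : ℕ) : ℤ) by push_cast; ring, e0, e1, e2,
      forwardSol]
    ring

theorem IsSolution.linearComb {S : Set ℤ} {V : ℤ → ℝ} {E : ℝ} {u v : ℤ → ℝ}
    (hu : IsSolution S V E u) (hv : IsSolution S V E v) (a b : ℝ) :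
    IsSolution S V E fun n => a * u n + b * v n := by
  intro n hn
  have h1 := hu n hn
  have h2 := hv n hn
  simp only
  linear_combination a * h1 + b * h2

theorem normSqUpTo_smul (u : ℤ → ℝ) (r L : ℝ) :
    normSqUpTo (fun n => r * u n) L = r ^ 2 * normSqUpTo u L := by
  simp only [normSqUpTo, abs_mul, mul_pow, sq_abs, mul_add, Finset.mul_sum]
  ring

theorem normSqUpTo_nonneg (u : ℤ → ℝ) {L : ℝ} (hL : 0 ≤ L) : 0 ≤ normSqUpTo u L := by
  rw [normSqUpTo_eq_sum u hL le_rfl]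
  exact Finset.sum_nonneg fun n _ => mul_nonneg (cut_nonneg _ _) (by positivity)

theorem exists_normalized {S : Set ℤ} {V : ℤ → ℝ} {E : ℝ} {u : ℤ → ℝ} (hu : IsSolution S V E u)
    (h : u 0 ^ 2 + u 1 ^ 2 ≠ 0) : ∃ v, IsSolution S V E v ∧ IsNormalized v ∧
      ∀ L, normSqUpTo u L = (u 0 ^ 2 + u 1 ^ 2) * normSqUpTo v L := by
  set r := √(u 0 ^ 2 + u 1 ^ 2) with hr
  have hpos : 0 < u 0 ^ 2 + u 1 ^ 2 := lt_of_le_of_ne (by positivity) h.symm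
  have hr0 : 0 < r := Real.sqrt_pos.2 hpos
  have hr2 : r ^ 2 = u 0 ^ 2 + u 1 ^ 2 := Real.sq_sqrt hpos.le
  refine ⟨fun n => r⁻¹ * u n, ?_, ?_, fun L => ?_⟩
  · simpa using hu.linearComb hu r⁻¹ 0
  · rw [IsNormalized, sq_abs, sq_abs, mul_pow, mul_pow, ← mul_add, ← hr2, ← mul_pow,
      inv_mul_cancel₀ hr0.ne', one_pow]
  · rw [normSqUpTo_smul, ← hr2, ← mul_assoc, ← mul_pow, mul_inv_cancel₀ hr0.ne', one_pow, one_mul]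

/-- By homogeneity a bound on normalized solutions is a bound of quadratic forms in the initial
data, zero data included. -/
theorem mul_le_normSqUpTo {S : Set ℤ} {V : ℤ → ℝ} {E : ℝ} {L b : ℝ} (hL : 0 ≤ L)
    (h : ∀ u, IsSolution S V E u → IsNormalized u → b ≤ normSqUpTo u L) {u : ℤ → ℝ}
    (hu : IsSolution S V E u) : b * (u 0 ^ 2 + u 1 ^ 2) ≤ normSqUpTo u L := by
  by_cases h0 : u 0 ^ 2 + u 1 ^ 2 = 0
  · rw [h0, mul_zero]; exact normSqUpTo_nonneg u hL
  · obtain ⟨v, h1, h2, h3⟩ := exists_normalized hu h0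
    rw [h3, mul_comm]
    exact mul_le_mul_of_nonneg_left (h v h1 h2) (by positivity)

end solutions

/-! ### Gram determinants, the choice of scale, and moments of resolvent solutions. -/

/-- If both eigenvalues of a symmetric 2×2 matrix are at least `m`, its determinant is at least
`m²`. The test vector `(-B, A)` brings in the determinant. -/
theorem le_gram_of_le {A B C m : ℝ} (hm : 0 < m)
    (h : ∀ a b : ℝ, m * (a ^ 2 + b ^ 2) ≤ a ^ 2 * A + 2 * (a * b) * B + b ^ 2 * C) :
    m ^ 2 ≤ A * C - B ^ 2 := by
  have hA : m ≤ A := by simpa using h 1 0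
  have h1 := h (-B) A
  have h2 : m * A ^ 2 ≤ A * (A * C - B ^ 2) := by nlinarith [sq_nonneg B]
  have h3 : m * A ≤ A * C - B ^ 2 := by
    refine le_of_mul_le_mul_left (a := A) ?_ (by linarith)
    nlinarith
  nlinarith

/-- Cayley-Hamilton: the right side minus the left side is the squared length of the image of `(a,
b)`. For a positive matrix this bounds the form below by determinant over trace. -/
theorem gram_mul_le (A B C a b : ℝ) :
    (A * C - B ^ 2) * (a ^ 2 + b ^ 2) ≤ (A + C) * (a ^ 2 * A + 2 * (a * b) * B + b ^ 2 * C) := by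
  nlinarith [sq_nonneg (a * A + b * B), sq_nonneg (a * B + b * C)]

section growth

variable {S : Set ℤ} {V : ℤ → ℝ} {E α κ C D k γ L₀ L₁ : ℝ}

/-- The Gram determinant of two sequences with respect to the truncated inner product. -/
noncomputable def gram (N : ℕ) (u v : ℤ → ℝ) (L : ℝ) : ℝ :=
  (∑ n ∈ Finset.Icc 1 N, cut L n * u n ^ 2) * (∑ n ∈ Finset.Icc 1 N, cut L n * v n ^ 2) -
    (∑ n ∈ Finset.Icc 1 N, cut L n * (u n * v n)) ^ 2

theorem sum_linearComb_sq (s : Finset ℕ) (c : ℕ → ℝ) (u v : ℤ → ℝ) (a b : ℝ) :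
    ∑ n ∈ s, c n * (a * u n + b * v n) ^ 2 = a ^ 2 * ∑ n ∈ s, c n * u n ^ 2 +
      2 * (a * b) * ∑ n ∈ s, c n * (u n * v n) + b ^ 2 * ∑ n ∈ s, c n * v n ^ 2 := by
  rw [Finset.mul_sum, Finset.mul_sum, Finset.mul_sum, ← Finset.sum_add_distrib,
    ← Finset.sum_add_distrib]
  exact Finset.sum_congr rfl fun n _ => by ring

/-- At `L = 1` only the site 1 has positive weight, and any two vectors in a one-dimensional space
are dependent. This is the lower endpoint for the intermediate value theorem. -/
theorem gram_one (N : ℕ) (u v : ℤ → ℝ) : gram N u v 1 = 0 := by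
  have key : ∀ f : ℕ → ℝ, ∑ n ∈ Finset.Icc 1 N, cut 1 n * f n =
      if 1 ≤ N then f 1 else 0 := by
    intro f
    split_ifs with h
    · rw [Finset.sum_eq_single_of_mem 1 (by rw [Finset.mem_Icc]; omega) fun n hn h1 => ?_]
      · rw [cut_eq_one (by simp), one_mul]
      · have : 2 ≤ n := by rw [Finset.mem_Icc] at hn; omega
        have : (2 : ℝ) ≤ n := by exact_mod_cast this
        rw [cut_eq_zero (by linarith), zero_mul]
    · rw [Finset.Icc_eq_empty (by omega), Finset.sum_empty]
  rw [gram, key fun n => u n ^ 2, key fun n => v n ^ 2, key fun n => u n * v n]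
  split_ifs
  · push_cast; ring
  · ring

theorem continuous_gram (N : ℕ) (u v : ℤ → ℝ) : Continuous (gram N u v) := by
  have key : ∀ f : ℕ → ℝ, Continuous fun L => ∑ n ∈ Finset.Icc 1 N, cut L n * f n := fun f =>
    continuous_finsetSum _ fun n _ => (continuous_cut n).mul_const _
  exact ((key _).mul (key _)).sub ((key _).pow 2)

/-- The initial data of `u` and `v` are orthonormal, so the lower bound on normalized solutions is a
lower bound on the eigenvalues of their Gram matrix. -/
theorem sq_le_gram {N : ℕ} {u v : ℤ → ℝ} {L b : ℝ} (hb : 0 < b)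
    (hu : IsSolution S V E u) (hv : IsSolution S V E v)
    (hu0 : u 0 = 0) (hu1 : u 1 = 1) (hv0 : v 0 = 1) (hv1 : v 1 = 0)
    (h : ∀ u, IsSolution S V E u → IsNormalized u → b ≤ normSqUpTo u L)
    (hL : 0 ≤ L) (hN : ⌊L⌋₊ + 1 ≤ N) : b ^ 2 ≤ gram N u v L := by
  refine le_gram_of_le hb fun x y => ?_
  rw [← sum_linearComb_sq]
  have h1 := mul_le_normSqUpTo hL h (hu.linearComb hv x y)
  rw [normSqUpTo_eq_sum _ hL hN] at h1
  simp only [hu0, hu1, hv0, hv1] at h1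
  refine le_trans (le_of_eq ?_) h1
  ring

/-- The Gram determinant is continuous in `L`, zero at `L = 1`, and at least `(1 + τ)⁴` once `D L ^
κ ≥ 1 + τ`. This attaches a length scale to each prescribed size of the determinant. -/
theorem exists_gram_eq {u v : ℤ → ℝ} (hD : 0 < D) (hκ : 0 < κ) (hL₁ : 1 ≤ L₁)
    (hu : IsSolution S V E u) (hv : IsSolution S V E v)
    (hu0 : u 0 = 0) (hu1 : u 1 = 1) (hv0 : v 0 = 1) (hv1 : v 1 = 0)
    (hlow : ∀ u, IsSolution S V E u → IsNormalized u →
      ∀ L, L₁ ≤ L → D * L ^ κ ≤ √(normSqUpTo u L)) {τ : ℝ} (hτ : 0 ≤ τ) :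
    ∃ L : ℝ, ∃ N : ℕ, 1 ≤ L ∧ ⌊L⌋₊ + 1 ≤ N ∧ gram N u v L = τ := by
  have ht : Filter.Tendsto (fun L : ℝ => D * L ^ κ) Filter.atTop Filter.atTop :=
    (tendsto_rpow_atTop hκ).const_mul_atTop hD
  obtain ⟨M, h1, h2⟩ := ((ht.eventually_ge_atTop (1 + τ)).and
    (Filter.eventually_ge_atTop L₁)).exists
  have hM1 : 1 ≤ M := hL₁.trans h2
  have h3 : (((1 + τ) ^ 2) ^ 2) ≤ gram (⌊M⌋₊ + 1) u v M := by
    refine sq_le_gram (by positivity) hu hv hu0 hu1 hv0 hv1 (fun w hw hwn => ?_) (by linarith) le_rfl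
    have h4 := h1.trans (hlow w hw hwn M h2)
    exact (Real.le_sqrt (by positivity) (normSqUpTo_nonneg w (by linarith))).1 h4
  have h5 : τ ∈ Set.Icc (gram (⌊M⌋₊ + 1) u v 1) (gram (⌊M⌋₊ + 1) u v M) := by
    rw [gram_one]
    refine ⟨hτ, le_trans ?_ h3⟩
    nlinarith [sq_nonneg τ, mul_nonneg hτ hτ]
  obtain ⟨L, hL, hLτ⟩ := intermediate_value_Icc hM1 (continuous_gram _ u v).continuousOn h5
  exact ⟨L, _, hL.1, Nat.succ_le_succ (Nat.floor_mono hL.2), hLτ⟩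

theorem gram_le {N : ℕ} {u v : ℤ → ℝ} {L : ℝ} :
    gram N u v L ≤ (∑ n ∈ Finset.Icc 1 N, cut L n * u n ^ 2) *
      (∑ n ∈ Finset.Icc 1 N, cut L n * v n ^ 2) := by
  have := sq_nonneg (∑ n ∈ Finset.Icc 1 N, cut L n * (u n * v n))
  rw [gram]; linarith

/-- Real and imaginary parts are real solutions, so bounds on real solutions pass to complex
combinations. -/
theorem sum_complex_normSq (s : Finset ℕ) (c : ℕ → ℝ) (u v : ℤ → ℝ) (a b : ℂ) :
    ∑ n ∈ s, c n * ‖a * (u n : ℂ) + b * (v n : ℂ)‖ ^ 2 =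
      ∑ n ∈ s, c n * (a.re * u n + b.re * v n) ^ 2 +
        ∑ n ∈ s, c n * (a.im * u n + b.im * v n) ^ 2 := by
  rw [← Finset.sum_add_distrib]
  refine Finset.sum_congr rfl fun n _ => ?_
  rw [← mul_add, Complex.sq_norm, Complex.normSq_apply]
  simp only [Complex.add_re, Complex.mul_re, Complex.ofReal_re, Complex.ofReal_im, Complex.add_im,
    Complex.mul_im]
  ring

/-- The two lower bounds balance, up to constants, at `L = X`, where `L ^ (2κ + 2α + 1) = T²`. Times
`L ^ p`, the first increases in `L` and the second does not increase as `p ≤ 2α + 1`; at `X` both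
have order `T ^ s`. This removes the dependence on the implicitly chosen `L`. -/
theorem le_mul_max {T s p L d e : ℝ} (hs : 0 < α + κ + 1 / 2) (hp : 0 < p) (hpα : p ≤ 2 * α + 1)
    (hκ : 0 < κ) (hT : 0 < T) (hL : 0 < L) (hd : 0 < d) (he : 0 < e)
    (hse : s = (p + 2 * κ) / (α + κ + 1 / 2)) :
    min d e * T ^ s ≤ L ^ p * max (d * L ^ (2 * κ)) (e * T ^ 2 / L ^ (2 * α + 1)) := by
  set X := T ^ (1 / (α + κ + 1 / 2)) with hX
  have hX0 : 0 < X := Real.rpow_pos_of_pos hT _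
  have hXs : X ^ (p + 2 * κ) = T ^ s := by
    rw [hX, ← Real.rpow_mul hT.le, hse]; congr 1; ring
  have hTs : 0 ≤ T ^ s := Real.rpow_nonneg hT.le _
  rcases le_total X L with h | h
  · calc min d e * T ^ s ≤ d * T ^ s := by gcongr; exact min_le_left _ _
      _ ≤ d * L ^ (p + 2 * κ) := by
          rw [← hXs]; gcongr
      _ = L ^ p * (d * L ^ (2 * κ)) := by rw [Real.rpow_add hL]; ring
      _ ≤ _ := by gcongr; exact le_max_left _ _
  · calc min d e * T ^ s ≤ e * T ^ s := by gcongr; exact min_le_right _ _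
      _ = e * (T ^ 2 * X ^ (p - (2 * α + 1))) := by
          rw [hX, ← Real.rpow_mul hT.le, ← Real.rpow_natCast T 2, ← Real.rpow_add hT, hse]
          congr 2
          have h0 := hs.ne'
          rw [Nat.cast_ofNat, div_eq_iff h0, add_mul, mul_right_comm, one_div_mul_cancel h0]
          ring
      _ ≤ e * (T ^ 2 * L ^ (p - (2 * α + 1))) := by
          have := Real.rpow_le_rpow_of_nonpos hL h (sub_nonpos.2 hpα)
          gcongr
      _ = L ^ p * (e * T ^ 2 / L ^ (2 * α + 1)) := by
          rw [Real.rpow_sub hL]; field_simp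
      _ ≤ _ := by gcongr; exact le_max_right _ _

set_option maxHeartbeats 400000 in
/-- The resolvent solutions at complex energies close to `E` have large `p`-th moments. -/
theorem exists_moment_le {p T : ℝ} (hS : Set.Ici 1 ⊆ S)
    (hα : 0 < α) (hκ : 0 < κ) (hC : 0 < C) (hD : 0 < D) (hk : 0 < k) (hk1 : k < 1) (hγ : 0 < γ)
    (hγ1 : γ < 1) (hL₀ : 1 ≤ L₀) (hL₁ : 1 ≤ L₁) (hp : 0 < p) (hpα : p ≤ 2 * α + 1)
    (hT : 64 * C * (max L₀ L₁) ^ (2 * α + 1) / γ < T)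
    (hup : ∀ u, IsSolution S V E u → IsNormalized u →
      ∀ L, 1 ≤ L → normSqUpTo u L ≤ C * L ^ (2 * α + 1))
    (hsc : ∀ u, IsSolution S V E u → ∀ L, L₀ ≤ L →
      (1 + γ) * normSqUpTo u (k * L) ≤ normSqUpTo u L)
    (hlow : ∀ u, IsSolution S V E u → IsNormalized u →
      ∀ L, L₁ ≤ L → D * L ^ κ ≤ √(normSqUpTo u L)) :
    ∃ N : ℕ, ∀ (z : ℂ) (ψ : ℕ → ℂ), ‖z - E‖ ^ 2 ≤ 2 / T ^ 2 →
      (∀ n : ℕ, ψ (n + 3) + ψ (n + 1) + (V ((n : ℤ) + 2) : ℂ) * ψ (n + 2) = z * ψ (n + 2)) →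
      k ^ p * (γ / 16) * min (D ^ 2) (γ ^ 2 / (4096 * C)) *
        T ^ ((p + 2 * κ) / (α + κ + 1 / 2)) * ‖ψ 1‖ ^ 2 ≤
      ∑ n ∈ Finset.Icc 1 N, (n : ℝ) ^ p * ‖ψ n‖ ^ 2 := by
  have hLm : 1 ≤ max L₀ L₁ := le_max_of_le_left hL₀
  have hLmp : 0 < (max L₀ L₁) ^ (2 * α + 1) := Real.rpow_pos_of_pos (by linarith) _
  have hT0 : 0 < T := lt_of_le_of_lt (by positivity) hT
  set u := lineSol V E 0 1
  set v := lineSol V E 1 0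
  have hu : IsSolution S V E u := isSolution_lineSol S V E 0 1
  have hv : IsSolution S V E v := isSolution_lineSol S V E 1 0
  have hu0 : u 0 = 0 := lineSol_zero _ _ _ _
  have hu1 : u 1 = 1 := lineSol_one _ _ _ _
  have hv0 : v 0 = 1 := lineSol_zero _ _ _ _
  have hv1 : v 1 = 0 := lineSol_one _ _ _ _
  have hun : IsNormalized u := by simp [IsNormalized, hu0, hu1]
  have hvn : IsNormalized v := by simp [IsNormalized, hv0, hv1]
  have hrec : ∀ x, IsSolution S V E x → ∀ n : ℕ, x ((n + 2 : ℕ) : ℤ) =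
      (E - V ((n + 1 : ℕ) : ℤ)) * x ((n + 1 : ℕ) : ℤ) - x (n : ℤ) := by
    intro x hx n
    have := hx ((n : ℤ) + 1) (hS (by simp))
    rw [show (n : ℤ) + 1 + 1 = ((n + 2 : ℕ) : ℤ) by push_cast; ring, add_sub_cancel_right] at this
    push_cast at this ⊢
    linarith
  -- With `|z - E|² ≤ 2/T²`, this value of the determinant makes the relative deviation exactly the
  -- `γ²/512` allowed by `scaling_of_deviation_le`.
  obtain ⟨L, N, hL1, hN, hdet⟩ := exists_gram_eq hD hκ hL₁ hu hv hu0 hu1 hv0 hv1 hlow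
    (τ := γ ^ 2 / 2048 * T ^ 2) (by positivity)
  have hL0 : 0 < L := by linarith
  have hA := hup u hu hun L hL1
  have hB := hup v hv hvn L hL1
  rw [normSqUpTo_eq_sum _ hL0.le hN] at hA hB
  set A := ∑ n ∈ Finset.Icc 1 N, cut L n * u n ^ 2 with hAdef
  set B := ∑ n ∈ Finset.Icc 1 N, cut L n * v n ^ 2 with hBdef
  have hA0 : 0 ≤ A := Finset.sum_nonneg fun n _ => mul_nonneg (cut_nonneg _ _) (by positivity)
  have hB0 : 0 ≤ B := Finset.sum_nonneg fun n _ => mul_nonneg (cut_nonneg _ _) (by positivity)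
  have hLp : 0 < L ^ (2 * α + 1) := Real.rpow_pos_of_pos hL0 _
  have hdet_pos : 0 < gram N u v L := by rw [hdet]; positivity
  have hdAB : gram N u v L ≤ A * B := gram_le
  -- The upper bound (a) limits the determinant by `(C L ^ (2α + 1))²`, so a determinant of order
  -- `T²` with `T` large forces `L` into the range where (b) and (c) hold.
  have hLbig : max L₀ L₁ ≤ L := by
    by_contra hc
    have h1 : L ^ (2 * α + 1) ≤ (max L₀ L₁) ^ (2 * α + 1) :=
      Real.rpow_le_rpow hL0.le (not_le.1 hc).le (by linarith)
    have h2 : A * B ≤ (C * (max L₀ L₁) ^ (2 * α + 1)) ^ 2 := by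
      rw [pow_two]
      exact mul_le_mul (hA.trans (by gcongr)) (hB.trans (by gcongr)) hB0 (by positivity)
    rw [div_lt_iff₀ hγ] at hT
    have h3 : (64 * C * (max L₀ L₁) ^ (2 * α + 1)) ^ 2 < (T * γ) ^ 2 :=
      pow_lt_pow_left₀ hT (by positivity) (by norm_num)
    nlinarith [mul_pos hC hLmp]
  have hLL0 : L₀ ≤ L := (le_max_left _ _).trans hLbig
  have hLL1 : L₁ ≤ L := (le_max_right _ _).trans hLbig
  have hkL0 : 0 ≤ k * L := by positivity
  have hkL : k * L ≤ L := by nlinarith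
  have hNk : ⌊k * L⌋₊ + 1 ≤ N := le_trans (Nat.succ_le_succ (Nat.floor_mono hkL)) hN
  refine ⟨N, fun z ψ hz hψ => ?_⟩
  set a : ℂ := ψ 1 with ha
  -- This is the value at site 0 for which the real-energy solution `φ` agrees with `ψ` at the sites
  -- 1 and 2. The true `ψ 0` cannot be used, since `ψ` need not satisfy the equation at site 1.
  set b : ℂ := ((E - V 1 : ℝ) : ℂ) * ψ 1 - ψ 2 with hb
  set φ : ℕ → ℂ := fun n => a * (u n : ℂ) + b * (v n : ℂ) with hφ
  set w : ℕ → ℂ := fun n => ψ n - φ n with hw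
  have hu2 : u 2 = E - V 1 := by
    have := hrec u hu 0
    push_cast at this
    rw [hu1, hu0] at this
    linarith
  have hv2 : v 2 = -1 := by
    have := hrec v hv 0
    push_cast at this
    rw [hv1, hv0] at this
    linarith
  have hφrec : ∀ n : ℕ, φ (n + 2) = ((E - V ((n + 1 : ℕ) : ℤ) : ℝ) : ℂ) * φ (n + 1) - φ n := by
    intro n
    simp only [hφ]
    rw [hrec u hu n, hrec v hv n]
    push_cast
    ring
  have hdev := sum_normSq_deviation_le (q := fun n => E - V n) (u := fun n => u n)
    (v := fun n => v n) (hrec u hu) (hrec v hv) (by simp [hu0, hu1, hv0, hv1]) (ψ := ψ) (w := w)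
    (ζ := z - E) (by simp [hw, hφ, hu1, hv1, ha])
    (by simp only [hw, hφ, Nat.cast_ofNat, hu2, hv2, ha, hb]; push_cast; ring)
    (fun n => by
      have h1 := hψ n
      have h2 := hφrec (n + 1)
      simp only [hw]
      rw [show n + 1 + 2 = n + 3 by ring, show n + 1 + 1 = n + 2 by ring] at h2
      rw [h2]
      push_cast
      linear_combination h1)
    (cut_nonneg L) (fun m n => cut_eq_one_of_lt) N
  have hP0 : 0 ≤ ∑ n ∈ Finset.Icc 1 N, cut L n * ‖ψ n‖ ^ 2 :=
    Finset.sum_nonneg fun n _ => mul_nonneg (cut_nonneg _ _) (by positivity)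
  have hdev2 : ∑ n ∈ Finset.Icc 1 N, cut L n * ‖w n‖ ^ 2 ≤
      γ ^ 2 / 512 * ∑ n ∈ Finset.Icc 1 N, cut L n * ‖ψ n‖ ^ 2 := by
    refine hdev.trans (mul_le_mul_of_nonneg_right ?_ hP0)
    change ‖z - E‖ ^ 2 * (2 * gram N u v L) ≤ _
    rw [hdet]
    calc _ ≤ 2 / T ^ 2 * (2 * (γ ^ 2 / 2048 * T ^ 2)) := by gcongr
      _ = γ ^ 2 / 512 := by field_simp; norm_num
  have scale : ∀ x y : ℝ, (1 + γ) * ∑ n ∈ Finset.Icc 1 N, cut (k * L) n * (x * u n + y * v n) ^ 2 ≤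
      ∑ n ∈ Finset.Icc 1 N, cut L n * (x * u n + y * v n) ^ 2 := by
    intro x y
    have := hsc _ (hu.linearComb hv x y) L hLL0
    rwa [normSqUpTo_eq_sum _ hL0.le hN, normSqUpTo_eq_sum _ hkL0 hNk] at this
  have hF := scaling_of_deviation_le (s := Finset.Icc 1 N) (cut_nonneg (k * L)) (cut_mono hkL)
    (ψ := ψ) (φ := φ) (w := w) (fun n _ => by simp [hw]) hγ hγ1 hdev2 (by
      simp only [hφ]
      rw [sum_complex_normSq, sum_complex_normSq, mul_add]
      exact add_le_add (scale _ _) (scale _ _))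
  have hlow1 : ∀ x y : ℝ, (D ^ 2 * L ^ (2 * κ)) * (x ^ 2 + y ^ 2) ≤
      ∑ n ∈ Finset.Icc 1 N, cut L n * (x * u n + y * v n) ^ 2 := by
    intro x y
    have h1 := mul_le_normSqUpTo hL0.le (b := D ^ 2 * L ^ (2 * κ)) (fun x hx hxn => by
      have h2 := hlow x hx hxn L hLL1
      rw [Real.le_sqrt (by positivity) (normSqUpTo_nonneg x hL0.le)] at h2
      refine le_trans (le_of_eq ?_) h2
      rw [mul_pow, ← Real.rpow_mul_natCast hL0.le, mul_comm κ]
      norm_num) (hu.linearComb hv x y)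
    rw [normSqUpTo_eq_sum _ hL0.le hN] at h1
    simp only [hu0, hu1, hv0, hv1] at h1
    refine le_trans (le_of_eq ?_) h1
    ring
  -- Determinant over trace: by (a) the trace is at most `2C L ^ (2α + 1)`.
  have hlow2 : ∀ x y : ℝ, (γ ^ 2 / (4096 * C) * T ^ 2 / L ^ (2 * α + 1)) * (x ^ 2 + y ^ 2) ≤
      ∑ n ∈ Finset.Icc 1 N, cut L n * (x * u n + y * v n) ^ 2 := by
    intro x y
    have h1 := gram_mul_le A (∑ n ∈ Finset.Icc 1 N, cut L n * (u n * v n)) B x y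
    rw [hAdef, hBdef, ← sum_linearComb_sq, ← hAdef, ← hBdef] at h1
    change gram N u v L * _ ≤ _ at h1
    rw [hdet] at h1
    have h2 : A + B ≤ 2 * C * L ^ (2 * α + 1) := by linarith
    have h3 : 0 ≤ ∑ n ∈ Finset.Icc 1 N, cut L n * (x * u n + y * v n) ^ 2 :=
      Finset.sum_nonneg fun n _ => mul_nonneg (cut_nonneg _ _) (by positivity)
    have h4 := h1.trans (mul_le_mul_of_nonneg_right h2 h3)
    have e : γ ^ 2 / (4096 * C) * T ^ 2 / L ^ (2 * α + 1) * (x ^ 2 + y ^ 2) =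
        (γ ^ 2 / 2048 * T ^ 2 * (x ^ 2 + y ^ 2)) / (2 * C * L ^ (2 * α + 1)) := by
      field_simp
      ring
    rw [e, div_le_iff₀ (by positivity)]
    linarith
  set G := max (D ^ 2 * L ^ (2 * κ)) (γ ^ 2 / (4096 * C) * T ^ 2 / L ^ (2 * α + 1)) with hG
  have hG0 : 0 ≤ G := le_max_of_le_left (by positivity)
  have hlow3 : ∀ x y : ℝ, G * (x ^ 2 + y ^ 2) ≤
      ∑ n ∈ Finset.Icc 1 N, cut L n * (x * u n + y * v n) ^ 2 := by
    intro x y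
    rw [hG, max_mul_of_nonneg _ _ (by positivity)]
    exact max_le (hlow1 x y) (hlow2 x y)
  -- Only the share of the datum at site 1 is kept; that of `b` is nonnegative and dropped.
  have hφlow : G * ‖ψ 1‖ ^ 2 ≤ ∑ n ∈ Finset.Icc 1 N, cut L n * ‖φ n‖ ^ 2 := by
    simp only [hφ]
    rw [sum_complex_normSq]
    have h1 := hlow3 a.re b.re
    have h2 := hlow3 a.im b.im
    have h3 : ‖ψ 1‖ ^ 2 = a.re ^ 2 + a.im ^ 2 := by
      rw [Complex.sq_norm, Complex.normSq_apply]; ring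
    have h4 := mul_nonneg hG0 (sq_nonneg b.re)
    have h5 := mul_nonneg hG0 (sq_nonneg b.im)
    rw [mul_add] at h1 h2
    rw [h3, mul_add]
    linarith
  -- The difference of the two cut-offs vanishes up to `kL`, so every surviving site has `n > kL`.
  have hmom : (k * L) ^ p * ∑ n ∈ Finset.Icc 1 N, (cut L n - cut (k * L) n) * ‖ψ n‖ ^ 2 ≤
      ∑ n ∈ Finset.Icc 1 N, (n : ℝ) ^ p * ‖ψ n‖ ^ 2 := by
    rw [Finset.mul_sum]
    refine Finset.sum_le_sum fun n _ => ?_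
    rw [← mul_assoc]
    refine mul_le_mul_of_nonneg_right ?_ (by positivity)
    rcases le_or_gt (n : ℝ) (k * L) with h | h
    · rw [cut_eq_one h, cut_eq_one (h.trans hkL), sub_self, mul_zero]
      positivity
    · have h1 : cut L n - cut (k * L) n ≤ 1 := by
        linarith [cut_le_one L n, cut_nonneg (k * L) n]
      calc _ ≤ (k * L) ^ p * 1 := by gcongr
        _ ≤ (n : ℝ) ^ p := by rw [mul_one]; exact Real.rpow_le_rpow hkL0 h.le hp.le
  have hmax := le_mul_max (T := T) (L := L) (d := D ^ 2) (e := γ ^ 2 / (4096 * C)) (α := α) (κ := κ)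
    (p := p) (by linarith) hp hpα hκ hT0 hL0 (by positivity) (by positivity) rfl
  rw [← hG] at hmax
  calc _ = k ^ p * (γ / 16) * (min (D ^ 2) (γ ^ 2 / (4096 * C)) *
        T ^ ((p + 2 * κ) / (α + κ + 1 / 2))) * ‖ψ 1‖ ^ 2 := by ring
    _ ≤ k ^ p * (γ / 16) * (L ^ p * G) * ‖ψ 1‖ ^ 2 := by gcongr
    _ = (k * L) ^ p * (γ / 16 * (G * ‖ψ 1‖ ^ 2)) := by
        rw [Real.mul_rpow hk.le hL0.le]; ring
    _ ≤ (k * L) ^ p * (γ / 16 * ∑ n ∈ Finset.Icc 1 N, cut L n * ‖φ n‖ ^ 2) := by gcongr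
    _ ≤ (k * L) ^ p * ∑ n ∈ Finset.Icc 1 N, (cut L n - cut (k * L) n) * ‖ψ n‖ ^ 2 := by gcongr
    _ ≤ _ := hmom

end growth

/-! ### The site basis. -/

section deltaVectors

variable {S : Set ℤ} {V : ℤ → ℝ}

theorem inner_delta (n : ℤ) (ψ : Ell2 S) : inner ℂ (delta S n) ψ = zeroExt ψ n := by
  unfold delta zeroExt
  split_ifs with h
  · rw [lp.inner_single_left]; simp
  · simp

theorem orthonormal_delta : Orthonormal ℂ fun n : S => delta S n := by
  classical
  rw [orthonormal_iff_ite]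
  intro i j
  rw [inner_delta]
  simp only [zeroExt, delta, dif_pos i.2, dif_pos j.2, Subtype.coe_eta]
  rw [lp.single_apply, Pi.single_apply]

theorem norm_delta {n : ℤ} (hn : n ∈ S) : ‖delta S n‖ = 1 := orthonormal_delta.norm_eq_one ⟨n, hn⟩

theorem tsum_ofReal_inner_delta (ψ : Ell2 S) :
    ∑' n : S, ENNReal.ofReal (‖inner ℂ (delta S n) ψ‖ ^ 2) = ENNReal.ofReal (‖ψ‖ ^ 2) := by
  have h1 : HasSum (fun n : S => ‖ψ n‖ ^ 2) (‖ψ‖ ^ 2) := by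
    have := lp.hasSum_norm (p := 2) (by norm_num) ψ
    simpa using this
  have h2 : ∀ n : S, ‖inner ℂ (delta S n) ψ‖ ^ 2 = ‖ψ n‖ ^ 2 := fun n => by
    rw [inner_delta, zeroExt, dif_pos n.2]
  simp_rw [h2]
  rw [← ENNReal.ofReal_tsum_of_nonneg (fun n => by positivity) h1.summable, h1.tsum_eq]

/-- Split `v` into its projection onto the span of `F` and the rest. If `w` has little mass on `F`,
then its overlap with `v` must come from the part of `v` outside `F`. -/
theorem norm_inner_sq_le_of_orthonormal {E ι : Type*} [NormedAddCommGroup E]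
    [InnerProductSpace ℂ E] {e : ι → E} (he : Orthonormal ℂ e) (F : Finset ι) (v w : E)
    (hv : ‖v‖ = 1) : ‖inner ℂ w v‖ ^ 2 ≤ 2 * ∑ n ∈ F, ‖inner ℂ (e n) w‖ ^ 2 +
      2 * ‖w‖ ^ 2 * (1 - ∑ n ∈ F, ‖inner ℂ (e n) v‖ ^ 2) := by
  set P := ∑ n ∈ F, inner ℂ (e n) v • e n with hP
  have hPv : ∀ x : E, inner ℂ x P = ∑ n ∈ F, inner ℂ (e n) v * inner ℂ x (e n) := by
    intro x
    rw [hP, inner_sum]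
    exact Finset.sum_congr rfl fun n _ => inner_smul_right _ _ _
  have hvP : inner ℂ v P = ((∑ n ∈ F, ‖inner ℂ (e n) v‖ ^ 2 : ℝ) : ℂ) := by
    rw [hPv]
    push_cast
    refine Finset.sum_congr rfl fun n _ => ?_
    rw [← inner_conj_symm v (e n), Complex.mul_conj']
  have hPP : ‖P‖ ^ 2 = ∑ n ∈ F, ‖inner ℂ (e n) v‖ ^ 2 := by
    have h1 : inner ℂ P P = ((∑ n ∈ F, ‖inner ℂ (e n) v‖ ^ 2 : ℝ) : ℂ) := by
      rw [hP, he.inner_sum]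
      push_cast
      refine Finset.sum_congr rfl fun n _ => ?_
      rw [Complex.conj_mul']
    rw [inner_self_eq_norm_sq_to_K] at h1
    have h2 : ((‖P‖ ^ 2 : ℝ) : ℂ) = ((∑ n ∈ F, ‖inner ℂ (e n) v‖ ^ 2 : ℝ) : ℂ) := by
      rw [← h1]; push_cast; rfl
    exact Complex.ofReal_injective h2
  have hd : ‖v - P‖ ^ 2 = 1 - ∑ n ∈ F, ‖inner ℂ (e n) v‖ ^ 2 := by
    rw [norm_sub_sq (𝕜 := ℂ), hvP, hPP, hv]
    simp only [RCLike.re_eq_complex_re, Complex.ofReal_re]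
    ring
  have hle1 : ∑ n ∈ F, ‖inner ℂ (e n) v‖ ^ 2 ≤ 1 := by
    have := sq_nonneg ‖v - P‖
    rw [hd] at this
    linarith
  have h1 : ‖inner ℂ w P‖ ^ 2 ≤ ∑ n ∈ F, ‖inner ℂ (e n) w‖ ^ 2 := by
    have h2 : ‖inner ℂ w P‖ ≤ ∑ n ∈ F, ‖inner ℂ (e n) v‖ * ‖inner ℂ (e n) w‖ := by
      rw [hPv]
      refine (norm_sum_le _ _).trans (le_of_eq (Finset.sum_congr rfl fun n _ => ?_))
      rw [norm_mul, norm_inner_symm w]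
    calc _ ≤ (∑ n ∈ F, ‖inner ℂ (e n) v‖ * ‖inner ℂ (e n) w‖) ^ 2 := by gcongr
      _ ≤ (∑ n ∈ F, ‖inner ℂ (e n) v‖ ^ 2) * ∑ n ∈ F, ‖inner ℂ (e n) w‖ ^ 2 :=
          Finset.sum_mul_sq_le_sq_mul_sq _ _ _
      _ ≤ 1 * ∑ n ∈ F, ‖inner ℂ (e n) w‖ ^ 2 := by gcongr
      _ = _ := one_mul _
  have h2 : ‖inner ℂ w (v - P)‖ ^ 2 ≤ ‖w‖ ^ 2 * (1 - ∑ n ∈ F, ‖inner ℂ (e n) v‖ ^ 2) := by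
    rw [← hd, ← mul_pow]
    gcongr
    exact norm_inner_le_norm _ _
  have h3 : inner ℂ w v = inner ℂ w P + inner ℂ w (v - P) := by rw [← inner_add_right]; congr 1; abel
  have h4 : ‖inner ℂ w v‖ ≤ ‖inner ℂ w P‖ + ‖inner ℂ w (v - P)‖ := by
    rw [h3]; exact norm_add_le _ _
  have h5 : ‖inner ℂ w v‖ ^ 2 ≤ (‖inner ℂ w P‖ + ‖inner ℂ w (v - P)‖) ^ 2 := by gcongr
  nlinarith [sq_nonneg (‖inner ℂ w P‖ - ‖inner ℂ w (v - P)‖)]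

end deltaVectors

/-! ### Time-averaged probabilities and the small-cell mechanism. -/

section averages

open MeasureTheory

variable {S : Set ℤ} {V : ℤ → ℝ} {T : ℝ}

theorem integrableOn_exp_mul_normSq {f : ℝ → ℂ} (hT : 0 < T) (hf : Continuous f) {M : ℝ}
    (hM : ∀ t, ‖f t‖ ≤ M) :
    IntegrableOn (fun t => Real.exp (-2 * t / T) * ‖f t‖ ^ 2) (Set.Ioi 0) := by
  have h1 : IntegrableOn (fun t : ℝ => Real.exp (-2 * t / T)) (Set.Ioi 0) := by
    have := integrableOn_exp_mul_Ioi (a := -2 / T) (div_neg_of_neg_of_pos (by norm_num) hT) 0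
    refine this.congr_fun (fun t _ => ?_) measurableSet_Ioi
    dsimp only
    congr 1
    ring
  refine h1.mul_bdd (c := M ^ 2) (hf.norm.pow 2).aestronglyMeasurable
    (Filter.Eventually.of_forall fun t => ?_)
  rw [norm_pow, norm_norm]
  have := norm_nonneg (f t)
  gcongr
  exact hM t

theorem integrableOn_exp_avg (hT : 0 < T) :
    IntegrableOn (fun t : ℝ => Real.exp (-2 * t / T)) (Set.Ioi 0) := by
  simpa using integrableOn_exp_mul_normSq (f := fun _ => 1) hT continuous_const (M := 1) (by simp)

theorem avg_one (hT : 0 < T) : 2 / T * ∫ t in Set.Ioi (0 : ℝ), Real.exp (-2 * t / T) = 1 := by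
  have := integral_exp_mul_Ioi (a := -2 / T) (div_neg_of_neg_of_pos (by norm_num) hT) 0
  simp only [mul_zero, Real.exp_zero] at this
  have e : ∀ t : ℝ, Real.exp (-2 * t / T) = Real.exp (-2 / T * t) := fun t => by congr 1; ring
  simp_rw [e, this]
  field_simp

theorem avgProb_nonneg (n : ℤ) (hT : 0 < T) : 0 ≤ avgProb S V n T :=
  mul_nonneg (by positivity) (integral_nonneg fun t => by positivity)

/-- Parseval and unitarity at each time, then Tonelli; the averaging weight has total mass 1. -/
theorem tsum_avgProb (h1 : (1 : ℤ) ∈ S) (hT : 0 < T) :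
    ∑' n : S, ENNReal.ofReal (avgProb S V n T) = 1 := by
  have hU := isUnitaryGroup_timeEvolution S V
  have key : ∀ n : S, ENNReal.ofReal (avgProb S V n T) = ENNReal.ofReal (2 / T) *
      ∫⁻ t in Set.Ioi (0 : ℝ), ENNReal.ofReal (Real.exp (-2 * t / T)) *
        ENNReal.ofReal (‖inner ℂ (delta S n) (timeEvolution S V t (delta S 1))‖ ^ 2) := by
    intro n
    rw [avgProb, ENNReal.ofReal_mul (by positivity), ofReal_integral_eq_lintegral_ofReal
      (integrableOn_exp_mul_normSq hT (hU.continuous_inner _ _) (hU.norm_inner_le _ _))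
      (Filter.Eventually.of_forall fun t => by positivity)]
    congr 1
    refine lintegral_congr fun t => ?_
    rw [ENNReal.ofReal_mul (Real.exp_pos _).le]
  simp_rw [key]
  rw [ENNReal.tsum_mul_left, ← lintegral_tsum]
  · have e : ∀ t : ℝ, ∑' n : S, ENNReal.ofReal (Real.exp (-2 * t / T)) *
        ENNReal.ofReal (‖inner ℂ (delta S n) (timeEvolution S V t (delta S 1))‖ ^ 2) =
        ENNReal.ofReal (Real.exp (-2 * t / T)) := by
      intro t
      rw [ENNReal.tsum_mul_left, tsum_ofReal_inner_delta, hU.norm_map, norm_delta h1]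
      simp
    simp_rw [e]
    rw [← ofReal_integral_eq_lintegral_ofReal (integrableOn_exp_avg hT)
      (Filter.Eventually.of_forall fun t => (Real.exp_pos _).le), ← ENNReal.ofReal_mul (by positivity),
      avg_one hT, ENNReal.ofReal_one]
  · intro n
    have : Continuous fun t : ℝ => Real.exp (-2 * t / T) := by fun_prop
    exact ((this.measurable.ennreal_ofReal).mul (((hU.continuous_inner _ _).norm.pow 2).measurable.ennreal_ofReal)).aemeasurable

/-- Markov's inequality: the averaged probabilities sum to 1 and outside `F` the weight is at least
`R ^ p`. -/
theorem ofReal_le_moment {p R : ℝ} (hp : 0 ≤ p) (hR : 0 ≤ R) (h1 : (1 : ℤ) ∈ S) (hT : 0 < T) (F : Finset S)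
    (hF : ∀ n : S, n ∉ F → R ≤ |((n : ℤ) : ℝ)|) :
    ENNReal.ofReal (R ^ p * (1 - ∑ n ∈ F, avgProb S V n T)) ≤ moment S V p T := by
  classical
  have hRp : 0 ≤ R ^ p := Real.rpow_nonneg hR p
  have h2 : ENNReal.ofReal (R ^ p) ≤
      ∑ n ∈ F, ENNReal.ofReal (R ^ p * avgProb S V n T) + moment S V p T := by
    calc ENNReal.ofReal (R ^ p) = ∑' n : S, ENNReal.ofReal (R ^ p * avgProb S V n T) := by
          simp_rw [ENNReal.ofReal_mul hRp]
          rw [ENNReal.tsum_mul_left, tsum_avgProb h1 hT, mul_one]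
      _ ≤ ∑' n : S, ((if n ∈ F then ENNReal.ofReal (R ^ p * avgProb S V n T) else 0) +
            ENNReal.ofReal (|((n : ℤ) : ℝ)| ^ p * avgProb S V n T)) := by
          refine ENNReal.tsum_le_tsum fun n => ?_
          split_ifs with h
          · exact le_self_add
          · rw [zero_add]
            exact ENNReal.ofReal_le_ofReal (mul_le_mul_of_nonneg_right
              (Real.rpow_le_rpow hR (hF n h) hp) (avgProb_nonneg _ hT))
      _ = _ := by
          rw [ENNReal.tsum_add, moment]
          congr 1
          rw [tsum_eq_sum (s := F) fun n hn => if_neg hn]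
          exact Finset.sum_congr rfl fun n hn => if_pos hn
  rw [← ENNReal.ofReal_sum_of_nonneg fun n _ => mul_nonneg hRp (avgProb_nonneg _ hT),
    ← Finset.mul_sum] at h2
  rw [mul_sub, mul_one, ENNReal.ofReal_sub _
    (mul_nonneg hRp (Finset.sum_nonneg fun n _ => avgProb_nonneg _ hT))]
  exact tsub_le_iff_left.2 h2

/-- Spreading caused by the smallness of the spectral measure of the cells. -/
theorem ofReal_le_moment_of_cell_le {p b : ℝ} (hp : 0 ≤ p) (h1 : (1 : ℤ) ∈ S) (hT : 0 < T)
    (J : Finset ℤ) (hb0 : 0 ≤ b)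
    (hb : ∀ j ∈ J, spectralMeasure S V (delta S 1) (cell T j) ≤ ENNReal.ofReal b)
    {m : ℝ} (hm0 : 0 < m)
    (hm : (spectralMeasure S V (delta S 1)).real (⋃ j ∈ J, cell T j) = m) (N : ℕ)
    (hN : 64 * (∑' k : ℤ, 1 / (1 + (k : ℝ) ^ 2)) * b * (2 * N + 1) ≤ m ^ 2) :
    ENNReal.ofReal ((N : ℝ) ^ p * (m / 4)) ≤ moment S V p T := by
  classical
  have hU := isUnitaryGroup_timeEvolution S V
  have hμ := isSpectralMeasure_spectralMeasure S V (delta S 1)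
  set μ := spectralMeasure S V (delta S 1) with hμdef
  have := hμ.finite
  obtain ⟨W, hW, hWe⟩ := hU.exists_isometry hμ
  set K := 16 * (∑' k : ℤ, 1 / (1 + (k : ℝ) ^ 2)) * b with hK
  have hA : MeasurableSet (⋃ j ∈ J, cell T j) :=
    Finset.measurableSet_biUnion _ fun j _ => measurableSet_cell T j
  -- `W g` is the spectral projection of `δ₁` onto the cells, so its overlap with `δ₁` and its
  -- squared norm are both `m`.
  set g := indicatorConstLp 2 hA (measure_ne_top μ _) (1 : ℂ) with hg
  have hav := hU.timeAverage_inner_le hW hWe hT J hb0 hb hA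
  rw [← hg, ← hK] at hav
  have hWin : ∀ x y, inner ℂ (W x) (W y) = inner ℂ x y := fun x y =>
    LinearIsometry.inner_map_map (⟨(W : Lp ℂ 2 μ →ₗ[ℂ] Ell2 S), hW⟩ : Lp ℂ 2 μ →ₗᵢ[ℂ] Ell2 S) x y
  have hgδ : inner ℂ (W g) (delta S 1) = (m : ℂ) := by
    have h2 : delta S 1 = W (expLp μ 0) := by rw [hWe, hU.zero]; rfl
    rw [h2, hWin, ← inner_conj_symm, inner_expLp_left, ← hm]
    have h3 : ∫ x : ℝ, Complex.exp (Complex.I * ((0 : ℝ) * x)) * g x ∂μ = ∫ x, (g x : ℂ) ∂μ := by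
      congr 1; funext x; simp
    rw [h3, hg, integral_indicatorConstLp]
    simp
  have hgg : ‖W g‖ ^ 2 = m := by
    rw [hW, hg, norm_indicatorConstLp two_ne_zero ENNReal.ofNat_ne_top, hm]
    rw [norm_one, one_mul, ENNReal.toReal_ofNat, ← Real.sqrt_eq_rpow, Real.sq_sqrt hm0.le]
  set F : Finset S := Finset.subtype (· ∈ S) (Finset.Icc (-N : ℤ) N) with hF
  have hFcard : (F.card : ℝ) ≤ 2 * N + 1 := by
    have h2 : F.card ≤ (Finset.Icc (-N : ℤ) N).card := by
      rw [hF, Finset.card_subtype]; exact Finset.card_filter_le _ _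
    rw [Int.card_Icc] at h2
    have h3 : F.card ≤ 2 * N + 1 := by omega
    exact_mod_cast h3
  -- The overlap is constant in time, so the comparison of `w = exp(-itH) W g` with `v = exp(-itH)
  -- δ₁` holds at every time with the same left side.
  have pw : ∀ t : ℝ, m ^ 2 ≤
      2 * ∑ n ∈ F, ‖inner ℂ (delta S n) (timeEvolution S V t (W g))‖ ^ 2 +
      2 * m * (1 - ∑ n ∈ F, ‖inner ℂ (delta S n) (timeEvolution S V t (delta S 1))‖ ^ 2) := by
    intro t
    have := norm_inner_sq_le_of_orthonormal (orthonormal_delta (S := S)) F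
      (timeEvolution S V t (delta S 1)) (timeEvolution S V t (W g))
      (by rw [hU.norm_map, norm_delta h1])
    rw [hU.inner_map_map, hU.norm_map, hgg, hgδ, Complex.norm_real, Real.norm_of_nonneg hm0.le] at this
    exact this
  have i0 := integrableOn_exp_avg hT
  have i1 : ∀ n : S, IntegrableOn (fun t => Real.exp (-2 * t / T) *
      ‖inner ℂ (delta S n) (timeEvolution S V t (W g))‖ ^ 2) (Set.Ioi 0) := fun n =>
    integrableOn_exp_mul_normSq hT (hU.continuous_inner _ _) (hU.norm_inner_le _ _)
  have i2 : ∀ n : S, IntegrableOn (fun t => Real.exp (-2 * t / T) *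
      ‖inner ℂ (delta S n) (timeEvolution S V t (delta S 1))‖ ^ 2) (Set.Ioi 0) := fun n =>
    integrableOn_exp_mul_normSq hT (hU.continuous_inner _ _) (hU.norm_inner_le _ _)
  have j1 := integrable_finsetSum F fun n _ => i1 n
  have j2 := integrable_finsetSum F fun n _ => i2 n
  have i3 : Integrable (fun t : ℝ => 2 * m * (Real.exp (-2 * t / T) - ∑ n ∈ F, Real.exp (-2 * t / T) *
      ‖inner ℂ (delta S n) (timeEvolution S V t (delta S 1))‖ ^ 2))
      (volume.restrict (Set.Ioi 0)) := (i0.sub j2).const_mul (2 * m)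
  have hint : m ^ 2 * (∫ t in Set.Ioi (0 : ℝ), Real.exp (-2 * t / T)) ≤
      2 * (∑ n ∈ F, ∫ t in Set.Ioi (0 : ℝ), Real.exp (-2 * t / T) *
        ‖inner ℂ (delta S n) (timeEvolution S V t (W g))‖ ^ 2) +
      2 * m * ((∫ t in Set.Ioi (0 : ℝ), Real.exp (-2 * t / T)) -
        ∑ n ∈ F, ∫ t in Set.Ioi (0 : ℝ), Real.exp (-2 * t / T) *
        ‖inner ℂ (delta S n) (timeEvolution S V t (delta S 1))‖ ^ 2) := by
    rw [← integral_finsetSum F fun n _ => i1 n, ← integral_finsetSum F fun n _ => i2 n,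
      ← integral_sub i0 j2, ← integral_const_mul, ← integral_const_mul, ← integral_const_mul,
      ← integral_add (j1.const_mul 2) i3]
    refine integral_mono (i0.const_mul (m ^ 2))
      ((j1.const_mul 2).add i3) fun t => ?_
    have h2 := mul_le_mul_of_nonneg_left (pw t) (Real.exp_pos (-2 * t / T)).le
    dsimp only
    rw [← Finset.mul_sum, ← Finset.mul_sum]
    linarith
  have h2T : 0 < 2 / T := by positivity
  have hint2 := mul_le_mul_of_nonneg_left hint h2T.le
  have havg : m ^ 2 ≤ 2 * ∑ n ∈ F, (2 / T * ∫ t in Set.Ioi (0 : ℝ), Real.exp (-2 * t / T) *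
        ‖inner ℂ (delta S n) (timeEvolution S V t (W g))‖ ^ 2) +
      2 * m * (1 - ∑ n ∈ F, avgProb S V n T) := by
    simp only [avgProb]
    rw [← Finset.mul_sum, ← Finset.mul_sum]
    have h3 := avg_one hT
    have h4 : 2 / T * (m ^ 2 * ∫ t in Set.Ioi (0 : ℝ), Real.exp (-2 * t / T)) = m ^ 2 := by
      rw [mul_left_comm, h3, mul_one]
    rw [h4, mul_add, mul_left_comm _ (2 * m), mul_sub, h3, mul_left_comm _ (2 : ℝ)] at hint2
    exact hint2
  -- At most `2N + 1` sites, each with averaged probability at most `K`; the hypothesis on `N` says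
  -- `(2N + 1) K ≤ m²/4`.
  have hin : ∑ n ∈ F, (2 / T * ∫ t in Set.Ioi (0 : ℝ), Real.exp (-2 * t / T) *
        ‖inner ℂ (delta S n) (timeEvolution S V t (W g))‖ ^ 2) ≤ m ^ 2 / 4 := by
    have hS0 : 0 ≤ ∑' k : ℤ, 1 / (1 + (k : ℝ) ^ 2) := tsum_nonneg fun k => by positivity
    have hK0 : 0 ≤ K := by positivity
    calc _ ≤ ∑ n ∈ F, K := Finset.sum_le_sum fun n _ => by
          refine (hav (delta S n)).trans ?_
          rw [norm_delta n.2]; simp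
      _ = F.card * K := by rw [Finset.sum_const, nsmul_eq_mul]
      _ ≤ (2 * N + 1) * K := by gcongr
      _ ≤ m ^ 2 / 4 := by
          have : 64 * (∑' k : ℤ, 1 / (1 + (k : ℝ) ^ 2)) * b = 4 * K := by rw [hK]; ring
          rw [this] at hN
          linarith
  have hout : m / 4 ≤ 1 - ∑ n ∈ F, avgProb S V n T := by
    have h3 : m ^ 2 / 2 ≤ 2 * m * (1 - ∑ n ∈ F, avgProb S V n T) := by linarith
    refine le_of_mul_le_mul_left (a := 2 * m) ?_ (by positivity)
    linarith
  refine le_trans (ENNReal.ofReal_le_ofReal ?_)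
    (ofReal_le_moment (R := N) hp (Nat.cast_nonneg _) h1 hT F fun n hn => ?_)
  · gcongr
  · rw [hF, Finset.mem_subtype, Finset.mem_Icc, not_and_or, not_le, not_le] at hn
    have : (N : ℤ) ≤ |(n : ℤ)| := by
      rcases hn with h | h
      · rw [abs_of_neg (by omega)]; omega
      · rw [abs_of_pos (by omega)]; omega
    exact_mod_cast this

end averages

/-! ### The Green function and the big-cell mechanism. -/

section greenFunction

open MeasureTheory

variable {S : Set ℤ} {V : ℤ → ℝ} {T : ℝ}

/-- The damped amplitude `t ↦ exp(-t/T) ⟨δ_n, exp(-itH) δ₁⟩` for `t > 0`, and `0` for `t ≤ 0`. -/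
noncomputable def dampedAmplitude (S : Set ℤ) (V : ℤ → ℝ) (T : ℝ) (n : ℤ) : ℝ → ℂ :=
  (Set.Ioi (0 : ℝ)).indicator fun t => (Real.exp (-(1 / T * t)) : ℂ) *
    inner ℂ (delta S n) (timeEvolution S V t (delta S 1))

theorem integrable_dampedAmplitude (hT : 0 < T) (n : ℤ) : Integrable (dampedAmplitude S V T n) := by
  have hU := isUnitaryGroup_timeEvolution S V
  rw [dampedAmplitude, integrable_indicator_iff measurableSet_Ioi]
  have h := integrableOn_exp_mul_of_bounded (hU.continuous_inner (delta S n) (delta S 1))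
    (hU.norm_inner_le _ _) (z := Complex.I * (1 / T : ℝ)) (by simpa using hT)
  refine h.congr_fun (fun t _ => ?_) measurableSet_Ioi
  dsimp only
  rw [Complex.ofReal_exp, ← mul_assoc Complex.I, Complex.I_mul_I]
  push_cast
  ring_nf

theorem norm_dampedAmplitude_sq (n : ℤ) (t : ℝ) :
    ‖dampedAmplitude S V T n t‖ ^ 2 = (Set.Ioi (0 : ℝ)).indicator (fun t => Real.exp (-2 * t / T) *
      ‖inner ℂ (delta S n) (timeEvolution S V t (delta S 1))‖ ^ 2) t := by
  rw [dampedAmplitude]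
  by_cases ht : t ∈ Set.Ioi (0 : ℝ)
  · rw [Set.indicator_of_mem ht, Set.indicator_of_mem ht, norm_mul, mul_pow, Complex.norm_real,
      Real.norm_of_nonneg (Real.exp_pos _).le, ← Real.exp_nat_mul]
    congr 2
    push_cast
    ring
  · rw [Set.indicator_of_notMem ht, Set.indicator_of_notMem ht]
    simp

theorem memLp_dampedAmplitude (hT : 0 < T) (n : ℤ) : MemLp (dampedAmplitude S V T n) 2 := by
  have hU := isUnitaryGroup_timeEvolution S V
  rw [memLp_two_iff_integrable_sq_norm (integrable_dampedAmplitude hT n).aestronglyMeasurable]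
  simp_rw [norm_dampedAmplitude_sq]
  rw [integrable_indicator_iff measurableSet_Ioi]
  exact integrableOn_exp_mul_normSq hT (hU.continuous_inner _ _) (hU.norm_inner_le _ _)

theorem integral_norm_dampedAmplitude_sq (hT : 0 < T) (n : ℤ) :
    ∫ t, ‖dampedAmplitude S V T n t‖ ^ 2 = T / 2 * avgProb S V n T := by
  simp_rw [norm_dampedAmplitude_sq]
  rw [integral_indicator measurableSet_Ioi, avgProb]
  field_simp

/-- The damping `exp(-t/T)` is the imaginary part `1 / T` of the energy. Hence integrals of the
squared Green function along this line are controlled by time averages. -/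
theorem inner_delta_resolvent (hT : 0 < T) (n : ℤ) (E : ℝ) (ψ : (schrodinger S V).domain)
    (hψ : schrodinger S V ψ - ((E : ℂ) + Complex.I * (1 / T : ℝ)) • (ψ : Ell2 S) = delta S 1) :
    zeroExt (ψ : Ell2 S) n =
      Complex.I * ∫ t : ℝ, Complex.exp (Complex.I * (E * t)) * dampedAmplitude S V T n t := by
  have hU := isUnitaryGroup_timeEvolution S V
  rw [← inner_delta, hU.inner_resolvent (delta S n) (delta S 1) (by simpa using hT) ψ hψ,
    ← integral_indicator measurableSet_Ioi]
  congr 2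
  funext t
  rw [dampedAmplitude]
  by_cases ht : t ∈ Set.Ioi (0 : ℝ)
  · rw [Set.indicator_of_mem ht, Set.indicator_of_mem ht, ← mul_assoc, Complex.ofReal_exp,
      ← Complex.exp_add, mul_add, add_mul, ← mul_assoc Complex.I Complex.I, Complex.I_mul_I]
    congr 2
    push_cast
    ring
  · rw [Set.indicator_of_notMem ht, Set.indicator_of_notMem ht, mul_zero]

/-- The source `δ₁` vanishes at the sites from 2 on, whence the shift by 2 in the indices. -/
theorem zeroExt_resolvent_recurrence (hS : Set.Ici 1 ⊆ S) {z : ℂ} (ψ : (schrodinger S V).domain)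
    (hψ : schrodinger S V ψ - z • (ψ : Ell2 S) = delta S 1) (n : ℕ) :
    zeroExt (ψ : Ell2 S) ((n + 3 : ℕ) : ℤ) + zeroExt (ψ : Ell2 S) ((n + 1 : ℕ) : ℤ) +
      (V ((n : ℤ) + 2) : ℂ) * zeroExt (ψ : Ell2 S) ((n + 2 : ℕ) : ℤ) =
      z * zeroExt (ψ : Ell2 S) ((n + 2 : ℕ) : ℤ) := by
  have hm : ((n : ℤ) + 2) ∈ S := hS (by simp only [Set.mem_Ici]; omega)
  have h1 : (1 : ℤ) ∈ S := hS (by simp)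
  have h2 := congrArg (fun φ : Ell2 S => zeroExt φ ((n : ℤ) + 2)) hψ
  have h3 : zeroExt (delta S 1) ((n : ℤ) + 2) = 0 := by
    rw [← inner_delta]
    exact (orthonormal_delta (S := S)).2 (i := ⟨(n : ℤ) + 2, hm⟩) (j := ⟨1, h1⟩)
      (fun h => by have := congrArg Subtype.val h; simp only at this; omega)
  have h4 : ∀ φ : Ell2 S, zeroExt φ ((n : ℤ) + 2) = φ ⟨(n : ℤ) + 2, hm⟩ := fun φ => dif_pos hm
  simp only [h3] at h2
  rw [h4, lp.coeFn_sub, Pi.sub_apply, lp.coeFn_smul, Pi.smul_apply, smul_eq_mul, ← h4 ψ,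
    schrodinger_apply, ← schrodingerExpr_eq, schrodingerExpr, ← h4 ψ] at h2
  push_cast
  have e3 : (n : ℤ) + 2 + 1 = n + 3 := by ring
  have e1 : (n : ℤ) + 2 - 1 = n + 1 := by ring
  simp only [e1, e3] at h2
  linear_combination h2

/-- The imaginary part of the Borel transform is a Poisson integral, and its kernel is at least
`T/2` for `|x - E| ≤ 1/T`, hence on the whole cell of `E`. -/
theorem half_mul_cell_le_norm (hT : 0 < T) {j : ℤ} {E : ℝ} (hE : E ∈ cell T j)
    {μ : Measure ℝ} [IsFiniteMeasure μ] :
    T / 2 * μ.real (cell T j) ≤ ‖∫ x : ℝ, 1 / ((x : ℂ) - (E + Complex.I * (1 / T : ℝ))) ∂μ‖ := by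
  have hTi : 0 < 1 / T := by positivity
  have hden : ∀ x : ℝ, (x : ℂ) - (E + Complex.I * (1 / T : ℝ)) ≠ 0 := by
    intro x h
    have := congrArg Complex.im h
    simp at this
    exact hT.ne' this
  have him : ∀ x : ℝ, (1 / ((x : ℂ) - (E + Complex.I * (1 / T : ℝ)))).im =
      (1 / T) / ((x - E) ^ 2 + (1 / T) ^ 2) := by
    intro x
    rw [one_div, Complex.inv_im, Complex.normSq_apply]
    simp only [Complex.sub_im, Complex.sub_re, Complex.add_im, Complex.add_re, Complex.ofReal_im,
      Complex.ofReal_re, Complex.mul_im, Complex.mul_re, Complex.I_re, Complex.I_im]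
    ring_nf
  have hint : Integrable (fun x : ℝ => 1 / ((x : ℂ) - (E + Complex.I * (1 / T : ℝ)))) μ := by
    refine Integrable.of_bound (C := T) ?_ (Filter.Eventually.of_forall fun x => ?_)
    · refine (Continuous.div continuous_const (by fun_prop) hden).aestronglyMeasurable
    · rw [norm_div, norm_one, div_le_iff₀ (norm_pos_iff.2 (hden x))]
      have := Complex.abs_im_le_norm ((x : ℂ) - (E + Complex.I * (1 / T : ℝ)))
      have e : ((x : ℂ) - (E + Complex.I * (1 / T : ℝ))).im = -(1 / T) := by simp
      rw [e, abs_neg, abs_of_pos hTi] at this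
      calc (1 : ℝ) = T * (1 / T) := by field_simp
        _ ≤ _ := by gcongr
  refine le_trans ?_ (Complex.abs_im_le_norm _)
  refine le_trans ?_ (le_abs_self _)
  have h1 : (∫ x : ℝ, 1 / ((x : ℂ) - (E + Complex.I * (1 / T : ℝ))) ∂μ).im =
      ∫ x : ℝ, (1 / T) / ((x - E) ^ 2 + (1 / T) ^ 2) ∂μ := by
    simp_rw [← him]
    exact (integral_im hint).symm
  rw [h1]
  have hint' : Integrable (fun x : ℝ => (1 / T) / ((x - E) ^ 2 + (1 / T) ^ 2)) μ := by
    simp_rw [← him]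
    exact hint.im
  calc T / 2 * μ.real (cell T j) = ∫ x in cell T j, T / 2 ∂μ := by
        rw [setIntegral_const, smul_eq_mul, mul_comm]
    _ ≤ ∫ x in cell T j, (1 / T) / ((x - E) ^ 2 + (1 / T) ^ 2) ∂μ := by
        refine setIntegral_mono_on (integrableOn_const (measure_ne_top _ _)) hint'.integrableOn
          (measurableSet_cell T j) fun x hx => ?_
        have hx1 : (x - E) ^ 2 ≤ (1 / T) ^ 2 := by
          rw [sq_le_sq, abs_of_pos hTi, abs_le]
          rw [cell, Set.mem_Ico, add_div] at hE hx
          constructor <;> linarith [hE.1, hE.2, hx.1, hx.2]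
        calc T / 2 = (1 / T) / ((1 / T) ^ 2 + (1 / T) ^ 2) := by field_simp; ring
          _ ≤ _ := by gcongr
    _ ≤ ∫ x : ℝ, (1 / T) / ((x - E) ^ 2 + (1 / T) ^ 2) ∂μ :=
        setIntegral_le_integral hint' (Filter.Eventually.of_forall fun x => by positivity)

theorem volume_real_cell (hT : 0 < T) (j : ℤ) : volume.real (cell T j) = 1 / T := by
  rw [cell, Real.volume_real_Ico_of_le (by gcongr; linarith)]
  ring

theorem abs_le_of_mem_cell (hT : 0 < T) {j : ℤ} {E : ℝ} (hE : E ∈ cell T j) :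
    |E| ≤ (|(j : ℝ)| + 1) / T := by
  rw [cell, Set.mem_Ico, div_le_iff₀ hT, lt_div_iff₀ hT] at hE
  have h : |E| * T = |E * T| := by rw [abs_mul, abs_of_pos hT]
  rw [le_div_iff₀ hT, h, abs_le]
  constructor
  · linarith [hE.1, neg_abs_le (j : ℝ)]
  · linarith [hE.2, le_abs_self (j : ℝ)]

/-- Spreading caused by the size of the Green function near the cells of the set `J`. -/
theorem ofReal_le_moment_of_resolvent {p K : ℝ} (hS : Set.Ici 1 ⊆ S) (hT : 0 < T) (J : Finset ℤ)
    (hK : 0 ≤ K) (N : ℕ)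
    (hres : ∀ j ∈ J, ∀ E ∈ cell T j, ∀ ψ : ℕ → ℂ,
      (∀ n : ℕ, ψ (n + 3) + ψ (n + 1) + (V ((n : ℤ) + 2) : ℂ) * ψ (n + 2) =
        ((E : ℂ) + Complex.I * (1 / T : ℝ)) * ψ (n + 2)) →
      K * ‖ψ 1‖ ^ 2 ≤ ∑ n ∈ Finset.Icc 1 N, (n : ℝ) ^ p * ‖ψ n‖ ^ 2) :
    ENNReal.ofReal (K / (8 * Real.pi) *
      ∑ j ∈ J, (spectralMeasure S V (delta S 1)).real (cell T j) ^ 2) ≤ moment S V p T := by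
  classical
  have hμ := isSpectralMeasure_spectralMeasure S V (delta S 1)
  set μ := spectralMeasure S V (delta S 1) with hμdef
  have := hμ.finite
  -- Defining the Green function as a Fourier transform makes its continuity in `E` immediate; it is
  -- identified with the resolvent for each `E` separately.
  set G : ℤ → ℝ → ℂ := fun n E => Complex.I * ∫ t : ℝ, Complex.exp (Complex.I * (E * t)) *
    dampedAmplitude S V T n t with hG
  have hz : ∀ E : ℝ, ((E : ℂ) + Complex.I * (1 / T : ℝ)).im ≠ 0 := by
    intro E
    simp [hT.ne']
  have hex : ∀ E : ℝ, (∀ n : ℕ, G (n + 3 : ℕ) E + G (n + 1 : ℕ) E +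
      (V ((n : ℤ) + 2) : ℂ) * G (n + 2 : ℕ) E =
        ((E : ℂ) + Complex.I * (1 / T : ℝ)) * G (n + 2 : ℕ) E) ∧
      G 1 E = ∫ x : ℝ, 1 / ((x : ℂ) - (E + Complex.I * (1 / T : ℝ))) ∂μ := by
    intro E
    obtain ⟨ψ, hψ, hψ2⟩ := hμ.borel _ (hz E)
    have hn : ∀ n, G n E = zeroExt (ψ : Ell2 S) n := fun n =>
      (inner_delta_resolvent hT n E ψ hψ).symm
    refine ⟨fun n => ?_, ?_⟩
    · simp only [hn]
      exact zeroExt_resolvent_recurrence hS ψ hψ n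
    · rw [hn, ← hψ2, inner_delta]
  have hGc : ∀ n, Continuous (G n) := fun n =>
    continuous_const.mul (continuous_integral_exp (integrable_dampedAmplitude hT n))
  have hGi : ∀ n j, IntegrableOn (fun E => ‖G n E‖ ^ 2) (cell T j) := fun n j =>
    (((hGc n).norm.pow 2).continuousOn.integrableOn_Icc).mono_set Set.Ico_subset_Icc_self
  -- Integrating `K |G(1)|² ≥ K (T μ(cell)/2)²` over a cell of length `1 / T` leaves the factor
  -- `T/4`.
  have hcell : ∀ j ∈ J, K * (T / 4) * μ.real (cell T j) ^ 2 ≤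
      ∑ n ∈ Finset.Icc 1 N, (n : ℝ) ^ p * ∫ E in cell T j, ‖G n E‖ ^ 2 := by
    intro j hj
    have hi : ∀ n : ℕ, IntegrableOn (fun E => (n : ℝ) ^ p * ‖G n E‖ ^ 2) (cell T j) := fun n =>
      (hGi n j).const_mul _
    calc K * (T / 4) * μ.real (cell T j) ^ 2 =
          ∫ E in cell T j, K * (T / 2 * μ.real (cell T j)) ^ 2 := by
          rw [setIntegral_const, volume_real_cell hT, smul_eq_mul]
          field_simp
          ring
      _ ≤ ∫ E in cell T j, ∑ n ∈ Finset.Icc 1 N, (n : ℝ) ^ p * ‖G n E‖ ^ 2 := by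
          refine setIntegral_mono_on (integrableOn_const (by simp [cell])) ?_
            (measurableSet_cell T j) fun E hE => ?_
          · exact integrable_finsetSum _ fun n _ => hi n
          · refine le_trans ?_ (hres j hj E hE (fun n => G n E) (hex E).1)
            gcongr
            rw [Nat.cast_one, (hex E).2]
            exact half_mul_cell_le_norm hT hE
      _ = _ := by
          rw [integral_finsetSum _ fun n _ => hi n]
          exact Finset.sum_congr rfl fun n _ => integral_const_mul _ _
  -- Bessel's constant `4π` times the squared norm `(T/2) a(n, T)` of the damped amplitude.
  have hn : ∀ n : ℤ, ∑ j ∈ J, ∫ E in cell T j, ‖G n E‖ ^ 2 ≤ 2 * Real.pi * T * avgProb S V n T := by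
    intro n
    rw [← integral_biUnion_finset J (fun j _ => measurableSet_cell T j)
      (fun i _ j _ hij => pairwise_disjoint_cell hT hij) fun j _ => hGi n j]
    have := setIntegral_normSq_fourier_le (integrable_dampedAmplitude (S := S) (V := V) hT n)
      (memLp_dampedAmplitude hT n) (B := ⋃ j ∈ J, cell T j)
      (Finset.measurableSet_biUnion _ fun j _ => measurableSet_cell T j)
      (R := ∑ j ∈ J, (|(j : ℝ)| + 1) / T) (fun E hE => by
        simp only [Set.mem_iUnion] at hE
        obtain ⟨j, hj, hE⟩ := hE
        exact (abs_le_of_mem_cell hT hE).trans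
          (Finset.single_le_sum (f := fun j : ℤ => (|(j : ℝ)| + 1) / T)
            (fun i _ => by positivity) hj))
    rw [integral_norm_dampedAmplitude_sq hT] at this
    simp only [hG, norm_mul, Complex.norm_I, one_mul]
    linarith
  have hsum : K / (8 * Real.pi) * ∑ j ∈ J, μ.real (cell T j) ^ 2 ≤
      ∑ n ∈ Finset.Icc 1 N, (n : ℝ) ^ p * avgProb S V n T := by
    have h1 : K * (T / 4) * ∑ j ∈ J, μ.real (cell T j) ^ 2 ≤
        2 * Real.pi * T * ∑ n ∈ Finset.Icc 1 N, (n : ℝ) ^ p * avgProb S V n T := by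
      rw [Finset.mul_sum]
      refine (Finset.sum_le_sum hcell).trans ?_
      rw [Finset.sum_comm, Finset.mul_sum]
      refine Finset.sum_le_sum fun n _ => ?_
      rw [← Finset.mul_sum]
      calc _ ≤ (n : ℝ) ^ p * (2 * Real.pi * T * avgProb S V n T) := by
            gcongr
            exact hn n
        _ = _ := by ring
    refine le_of_mul_le_mul_left (a := 2 * Real.pi * T) ?_ (by positivity)
    refine le_trans (le_of_eq ?_) h1
    have := Real.pi_pos
    field_simp
    ring
  refine (ENNReal.ofReal_le_ofReal hsum).trans ?_
  rw [ENNReal.ofReal_sum_of_nonneg fun n _ => mul_nonneg (by positivity) (avgProb_nonneg _ hT),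
    moment]
  -- Embeds the positive sites into `S`; the value at 0 is a dummy and is never summed.
  set ι : ℕ → S := fun n => if h : 1 ≤ n then ⟨n, hS (by simpa using h)⟩ else ⟨1, hS (by simp)⟩
  have hι : ∀ n, 1 ≤ n → ((ι n : S) : ℤ) = n := fun n h => by simp [ι, h]
  have hinj : Set.InjOn ι (Finset.Icc 1 N) := by
    intro a ha b hb hab
    simp only [Finset.coe_Icc, Set.mem_Icc] at ha hb
    have := congrArg (Subtype.val) hab
    rw [hι a ha.1, hι b hb.1] at this
    exact_mod_cast this
  calc _ = ∑ n ∈ (Finset.Icc 1 N).image ι,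
        ENNReal.ofReal (|((n : ℤ) : ℝ)| ^ p * avgProb S V n T) := by
        rw [Finset.sum_image hinj]
        refine Finset.sum_congr rfl fun n h => ?_
        rw [hι n (Finset.mem_Icc.1 h).1]
        simp
    _ ≤ _ := ENNReal.sum_le_tsum _

end greenFunction

/-! ### From scaling to power laws, and from moments to growth exponents. -/

section growth

open MeasureTheory Filter

variable {S : Set ℤ} {V : ℤ → ℝ} {A : Set ℝ}

theorem normSqUpTo_two (u : ℤ → ℝ) : normSqUpTo u 2 = u 1 ^ 2 + u 2 ^ 2 := by
  simp [normSqUpTo, Finset.sum_Icc_succ_top]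

theorem normSqUpTo_mono (u : ℤ → ℝ) {K L : ℝ} (hK : 0 ≤ K) (h : K ≤ L) :
    normSqUpTo u K ≤ normSqUpTo u L := by
  have h1 : ⌊K⌋₊ + 1 ≤ ⌊L⌋₊ + 1 := by gcongr
  rw [normSqUpTo_eq_sum u hK h1, normSqUpTo_eq_sum u (hK.trans h) le_rfl]
  exact Finset.sum_le_sum fun n _ => mul_le_mul_of_nonneg_right (cut_mono h n) (by positivity)

/-- The solution with `u 0 = 0`, `u 1 = 1` has `u 2 = E - V 1`, which (a) bounds at `L = 2`. So `A`
is bounded, and finitely many cells suffice later. -/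
theorem PowerLawUpperBound.exists_abs_sub_le {α : ℝ} (h : PowerLawUpperBound S V A α)
    (h1 : (1 : ℤ) ∈ S) : ∃ W, 0 < W ∧ ∀ E ∈ A, |E - V 1| ≤ W := by
  obtain ⟨C, hC, h⟩ := h
  refine ⟨√(C * 2 ^ (2 * α + 1)), by positivity, fun E hE => ?_⟩
  have hu := isSolution_lineSol S V E 0 1
  have h2 := h E hE _ hu (by simp [IsNormalized, lineSol_zero, lineSol_one]) 2 (by norm_num)
  have h3 := hu 1 h1
  norm_num [lineSol_zero, lineSol_one] at h3
  rw [normSqUpTo_two, lineSol_one] at h2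
  apply Real.abs_le_sqrt
  have e : E - V 1 = lineSol V E 0 1 2 := by linarith
  rw [e]
  linarith

/-- The equation at site 1 recovers `u 0` from `u 1` and `u 2` with a bounded coefficient. Length 2
is needed, as `u 1` may vanish. -/
theorem IsSolution.le_normSqUpTo_two {E W : ℝ} {u : ℤ → ℝ} (hu : IsSolution S V E u)
    (h1 : (1 : ℤ) ∈ S) (hW : |E - V 1| ≤ W) (hn : IsNormalized u) :
    1 / (2 * W ^ 2 + 2) ≤ normSqUpTo u 2 := by
  have h2 := hu 1 h1
  norm_num at h2
  have h0 : u 0 = (E - V 1) * u 1 - u 2 := by linarith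
  have hW2 : (E - V 1) ^ 2 ≤ W ^ 2 := sq_le_sq' (by linarith [neg_abs_le (E - V 1)])
    ((le_abs_self _).trans hW)
  rw [IsNormalized, sq_abs, sq_abs, h0] at hn
  rw [normSqUpTo_two, div_le_iff₀ (by positivity)]
  nlinarith [sq_nonneg ((E - V 1) * u 1 + u 2), mul_le_mul_of_nonneg_right hW2 (sq_nonneg (u 1)),
    mul_nonneg (sq_nonneg W) (sq_nonneg (u 2)), sq_nonneg (u 1)]

/-- Each contraction of the length by `k` gains a factor `1 + γ`, as long as the length stays above
both `L₀` and 2. -/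
theorem pow_mul_le_of_scaling {u : ℤ → ℝ} {k γ L₀ : ℝ} (hk : 0 < k) (hk1 : k < 1) (hγ : 0 < γ)
    (hsc : ∀ L, L₀ ≤ L → (1 + γ) * normSqUpTo u (k * L) ≤ normSqUpTo u L) (j : ℕ) :
    ∀ L, max L₀ 2 ≤ k ^ j * L → (1 + γ) ^ j * normSqUpTo u 2 ≤ normSqUpTo u L := by
  induction j with
  | zero =>
    intro L hL
    rw [pow_zero, one_mul] at hL ⊢
    exact normSqUpTo_mono u (by norm_num) ((le_max_right _ _).trans hL)
  | succ j ih =>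
    intro L hL
    have hL0 : 0 ≤ L := by
      by_contra hc
      have : k ^ (j + 1) * L ≤ 0 :=
        mul_nonpos_of_nonneg_of_nonpos (by positivity) (not_le.1 hc).le
      linarith [le_max_right L₀ 2]
    have h1 := ih (k * L) (by rw [← mul_assoc, ← pow_succ]; exact hL)
    have h2 : k ^ (j + 1) * L ≤ L := mul_le_of_le_one_left hL0 (pow_le_one₀ hk.le hk1.le)
    calc _ = (1 + γ) * ((1 + γ) ^ j * normSqUpTo u 2) := by ring
      _ ≤ (1 + γ) * normSqUpTo u (k * L) := by gcongr
      _ ≤ _ := hsc L ((le_max_left _ _).trans (hL.trans h2))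

/-- The scaling lower bound, iterated, gives a power-law lower bound. -/
theorem ScalingLowerBound.exists_powerLawLowerBound {α : ℝ} (ha : PowerLawUpperBound S V A α)
    (hb : ScalingLowerBound S V A) (h1 : (1 : ℤ) ∈ S) :
    ∃ κ : ℝ, 0 < κ ∧ PowerLawLowerBound S V A κ := by
  obtain ⟨W, hW, hWE⟩ := ha.exists_abs_sub_le h1
  obtain ⟨k, γ, L₀, hk, hk1, hγ, hγ1, hL₀, hsc⟩ := hb
  set M := max L₀ 2 with hM
  have hM0 : 0 < M := lt_of_lt_of_le two_pos (le_max_right _ _)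
  -- This is the exponent with `k ^ (-ρ) = 1 + γ`. It governs the squared norm, so `κ = ρ / 2`.
  set ρ := Real.log (1 + γ) / -Real.log k with hρ
  have hlk : 0 < -Real.log k := by linarith [Real.log_neg hk hk1]
  have hlγ : 0 < Real.log (1 + γ) := Real.log_pos (by linarith)
  have hρ0 : 0 < ρ := div_pos hlγ hlk
  set c := 1 / (2 * W ^ 2 + 2) with hc
  have hc0 : 0 < c := by positivity
  set D2 := c / (1 + γ) / M ^ ρ with hD2
  have hD20 : 0 < D2 := by positivity
  refine ⟨ρ / 2, by positivity, √D2, M, Real.sqrt_pos.2 hD20, hL₀.trans (le_max_left _ _), ?_⟩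
  intro E hE u hu hn L hL
  have hL0 : 0 < L := hM0.trans_le hL
  have h2 := hu.le_normSqUpTo_two h1 (hWE E hE) hn
  -- The real number of contractions leading from `L` to `M`. Rounding it down costs at most one
  -- factor `1 + γ`, which is divided out in `D2`.
  set x := Real.log (L / M) / -Real.log k with hx
  have hLM : 1 ≤ L / M := (one_le_div hM0).2 hL
  have hx0 : 0 ≤ x := div_nonneg (Real.log_nonneg hLM) hlk.le
  have h3 : M ≤ k ^ ⌊x⌋₊ * L := by
    have h4 : k ^ x * L = M := by
      have e : k ^ x = M / L := by
        rw [Real.rpow_def_of_pos hk, ← Real.exp_log (div_pos hM0 hL0)]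
        congr 1
        rw [hx, ← inv_div L M, Real.log_inv]
        have := (Real.log_neg hk hk1).ne
        field_simp
      rw [e]
      field_simp
    calc M = k ^ x * L := h4.symm
      _ ≤ k ^ (⌊x⌋₊ : ℝ) * L := by
          gcongr ?_ * L
          exact Real.rpow_le_rpow_of_exponent_ge hk hk1.le (Nat.floor_le hx0)
      _ = _ := by rw [Real.rpow_natCast]
  have h5 := pow_mul_le_of_scaling hk hk1 hγ (hsc E hE u hu) ⌊x⌋₊ L h3
  have h6 : (L / M) ^ ρ ≤ (1 + γ) * (1 + γ) ^ ⌊x⌋₊ := by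
    calc (L / M) ^ ρ = (1 + γ) ^ x := by
          rw [Real.rpow_def_of_pos (by positivity), Real.rpow_def_of_pos (by linarith)]
          congr 1
          rw [hx, hρ]
          ring
      _ ≤ (1 + γ) ^ ((⌊x⌋₊ + 1 : ℕ) : ℝ) := by
          apply Real.rpow_le_rpow_of_exponent_le (by linarith)
          push_cast
          exact (Nat.lt_floor_add_one x).le
      _ = _ := by rw [Real.rpow_natCast, pow_succ, mul_comm]
  apply Real.le_sqrt_of_sq_le
  rw [mul_pow, Real.sq_sqrt hD20.le, ← Real.rpow_natCast, ← Real.rpow_mul hL0.le]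
  have e : ρ / 2 * ((2 : ℕ) : ℝ) = ρ := by push_cast; ring
  rw [e]
  calc D2 * L ^ ρ = c / (1 + γ) * (L / M) ^ ρ := by
        rw [hD2, Real.div_rpow hL0.le hM0.le]; ring
    _ ≤ c / (1 + γ) * ((1 + γ) * (1 + γ) ^ ⌊x⌋₊) := by gcongr
    _ = (1 + γ) ^ ⌊x⌋₊ * c := by field_simp
    _ ≤ (1 + γ) ^ ⌊x⌋₊ * normSqUpTo u 2 := by gcongr
    _ ≤ _ := h5

/-- The constant only adds `log c / log T`, which tends to 0, to the exponent. -/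
theorem le_lowerExponent {p s c : ℝ} (hc : 0 < c)
    (h : ∀ᶠ T in atTop, ENNReal.ofReal (c * T ^ s) ≤ moment S V p T) :
    (s : EReal) ≤ lowerExponent S V p := by
  have h1 : Tendsto (fun T : ℝ => Real.log c / Real.log T + s) atTop (nhds s) := by
    have := (tendsto_const_nhds (x := Real.log c)).div_atTop Real.tendsto_log_atTop
    simpa using this.add_const s
  have h2 : Tendsto (fun T : ℝ => ((Real.log c / Real.log T + s : ℝ) : EReal)) atTop
      (nhds (s : EReal)) := (continuous_coe_real_ereal.tendsto s).comp h1
  rw [← h2.liminf_eq, lowerExponent]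
  refine liminf_le_liminf ?_
  filter_upwards [h, eventually_gt_atTop 1] with T hT hT1
  have hT0 : 0 < T := by linarith
  have hl : 0 < Real.log T := Real.log_pos hT1
  have e : ((Real.log c / Real.log T + s : ℝ) : EReal) =
      ENNReal.log (ENNReal.ofReal (c * T ^ s)) / (Real.log T : EReal) := by
    rw [ENNReal.log_ofReal_of_pos (by positivity), ← EReal.coe_div,
      Real.log_mul hc.ne' (by positivity), Real.log_rpow hT0]
    congr 1
    field_simp
  rw [e]
  exact EReal.div_le_div_right_of_nonneg (by exact_mod_cast hl.le) (ENNReal.log_monotone hT)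

/-- A substitute for Jensen's inequality, valid also for infinite moments: `|n| ^ p₀ ≤ R ^ p₀ + R ^
(p₀ - p) |n| ^ p`, and the total probability is 1, so half of the assumed bound is absorbed by the
first term. -/
theorem ofReal_rpow_le_moment {p₀ p T R : ℝ} (hp₀ : 0 < p₀) (hp : p₀ ≤ p) (h1 : (1 : ℤ) ∈ S)
    (hT : 0 < T) (hR : 0 < R) (h : ENNReal.ofReal (2 * R ^ p₀) ≤ moment S V p₀ T) :
    ENNReal.ofReal (R ^ p) ≤ moment S V p T := by
  have hle : moment S V p₀ T ≤
      ENNReal.ofReal (R ^ p₀) + ENNReal.ofReal (R ^ (p₀ - p)) * moment S V p T := by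
    calc moment S V p₀ T ≤ ∑' n : S, (ENNReal.ofReal (R ^ p₀) * ENNReal.ofReal (avgProb S V n T) +
          ENNReal.ofReal (R ^ (p₀ - p)) *
            ENNReal.ofReal (|((n : ℤ) : ℝ)| ^ p * avgProb S V n T)) := by
          refine ENNReal.tsum_le_tsum fun n => ?_
          have ha := avgProb_nonneg (S := S) (V := V) n hT
          set x := |((n : ℤ) : ℝ)| with hx
          have hx0 : 0 ≤ x := abs_nonneg _
          rw [← ENNReal.ofReal_mul (by positivity), ← ENNReal.ofReal_mul (by positivity),
            ← ENNReal.ofReal_add (by positivity) (by positivity)]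
          apply ENNReal.ofReal_le_ofReal
          rcases le_total x R with hxR | hxR
          · have : x ^ p₀ ≤ R ^ p₀ := by gcongr
            have h3 : 0 ≤ R ^ (p₀ - p) * (x ^ p * avgProb S V n T) := by positivity
            nlinarith
          · have hxpos : 0 < x := hR.trans_le hxR
            have h3 : x ^ p₀ ≤ R ^ (p₀ - p) * x ^ p := by
              calc x ^ p₀ = x ^ (p₀ - p) * x ^ p := by rw [← Real.rpow_add hxpos]; congr 1; ring
                _ ≤ _ := by
                  gcongr ?_ * x ^ p
                  exact Real.rpow_le_rpow_of_nonpos hR hxR (by linarith)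
            have h4 : 0 ≤ R ^ p₀ * avgProb S V n T := by positivity
            nlinarith
      _ = _ := by
          rw [ENNReal.tsum_add, ENNReal.tsum_mul_left, ENNReal.tsum_mul_left, tsum_avgProb h1 hT,
            mul_one, moment]
  have h2 : ENNReal.ofReal (R ^ p₀) ≤ ENNReal.ofReal (R ^ (p₀ - p)) * moment S V p T := by
    have h3 := h.trans hle
    rw [two_mul, ENNReal.ofReal_add (by positivity) (by positivity)] at h3
    exact (ENNReal.add_le_add_iff_left ENNReal.ofReal_ne_top).1 h3
  calc ENNReal.ofReal (R ^ p) = ENNReal.ofReal (R ^ (p - p₀)) * ENNReal.ofReal (R ^ p₀) := by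
        rw [← ENNReal.ofReal_mul (by positivity), ← Real.rpow_add hR]; congr 2; ring
    _ ≤ ENNReal.ofReal (R ^ (p - p₀)) * (ENNReal.ofReal (R ^ (p₀ - p)) * moment S V p T) := by
        gcongr
    _ = moment S V p T := by
        rw [← mul_assoc, ← ENNReal.ofReal_mul (by positivity), ← Real.rpow_add hR]
        simp

/-- The combination of the two mechanisms of spreading. -/
theorem exists_eventually_le_moment {p s c T₀ R : ℝ} (hS : Set.Ici 1 ⊆ S) (hp : 0 < p)
    (hs : 0 < s) (hc : 0 < c) (hμ : 0 < spectralMeasure S V (delta S 1) A)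
    (hR : ∀ E ∈ A, |E| ≤ R)
    (hres : ∀ T, T₀ < T → 1 ≤ T → ∀ E ∈ A, ∃ N : ℕ, ∀ (z : ℂ) (ψ : ℕ → ℂ), ‖z - E‖ ^ 2 ≤ 2 / T ^ 2 →
      (∀ n : ℕ, ψ (n + 3) + ψ (n + 1) + (V ((n : ℤ) + 2) : ℂ) * ψ (n + 2) = z * ψ (n + 2)) →
      c * T ^ s * ‖ψ 1‖ ^ 2 ≤ ∑ n ∈ Finset.Icc 1 N, (n : ℝ) ^ p * ‖ψ n‖ ^ 2) :
    ∃ c' : ℝ, 0 < c' ∧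
      ∀ᶠ T in atTop, ENNReal.ofReal (c' * T ^ (s * p / (p + 1))) ≤ moment S V p T := by
  classical
  have h1 : (1 : ℤ) ∈ S := hS (by simp)
  set μ := spectralMeasure S V (delta S 1) with hμdef
  have := (isSpectralMeasure_spectralMeasure S V (delta S 1)).finite
  rw [← hμdef] at this
  set m := μ.real A with hm
  have hm0 : 0 < m := ENNReal.toReal_pos hμ.ne' (measure_ne_top _ _)
  set Z := ∑' k : ℤ, 1 / (1 + (k : ℝ) ^ 2) with hZ
  have hZ0 : 0 < Z := by
    refine lt_of_lt_of_le ?_ (summable_inv_one_add_sq.le_tsum 0 fun k _ => by positivity)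
    norm_num
  -- Balances the outcomes `T ^ (s - q)` of the big cells and `T ^ (qp)` of the small ones.
  set q := s / (p + 1) with hq
  have hq0 : 0 < q := by positivity
  have hsq : s - q = s * p / (p + 1) := by rw [hq]; field_simp; ring
  have hqp : q * p = s * p / (p + 1) := by rw [hq]; field_simp
  -- Small cells are used with `N = ⌊d T ^ q⌋`. As `2N + 1 ≤ 3 d T ^ q`, the requirement becomes
  -- `192 Z d ≤ (m/2)²`, and 768 is four times 192.
  set d := m ^ 2 / (768 * Z) with hd
  have hd0 : 0 < d := by positivity
  set c₁ := c / (8 * Real.pi) * (m / 2) with hc₁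
  set c₂ := (d / 2) ^ p * (m / 8) with hc₂
  have hpi := Real.pi_pos
  have hc₁0 : 0 < c₁ := by positivity
  have hc₂0 : 0 < c₂ := by positivity
  refine ⟨min c₁ c₂, lt_min hc₁0 hc₂0, ?_⟩
  have hlarge : ∀ᶠ T : ℝ in atTop, 1 / d ≤ T ^ q :=
    (tendsto_rpow_atTop hq0).eventually (eventually_ge_atTop _)
  filter_upwards [eventually_gt_atTop T₀, eventually_ge_atTop 1, hlarge] with T hT₀ hT1 hTd
  have hT : 0 < T := by linarith
  set b := T ^ (-q) with hb
  have hb0 : 0 < b := by positivity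
  set J := (Finset.Icc ⌊-R * T⌋ ⌊R * T⌋).filter fun j => (cell T j ∩ A).Nonempty with hJ
  have hAJ : A ⊆ ⋃ j ∈ J, cell T j := by
    intro E hE
    have hcell := mem_cell_floor hT E
    simp only [Set.mem_iUnion]
    refine ⟨⌊E * T⌋, ?_, hcell⟩
    have := abs_le.1 (hR E hE)
    rw [hJ, Finset.mem_filter, Finset.mem_Icc]
    exact ⟨⟨by gcongr; exact this.1, by gcongr; exact this.2⟩, E, hcell, hE⟩
  set big := J.filter fun j => b < μ.real (cell T j) with hbig
  set small := J.filter fun j => ¬ b < μ.real (cell T j) with hsmall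
  -- Only monotonicity and subadditivity of `μ` enter here, so `A` need not be measurable.
  have hsplit : m ≤ μ.real (⋃ j ∈ big, cell T j) + μ.real (⋃ j ∈ small, cell T j) := by
    refine le_trans (measureReal_mono ?_) (measureReal_union_le _ _)
    refine hAJ.trans fun E hE => ?_
    simp only [Set.mem_iUnion, Set.mem_union] at hE ⊢
    obtain ⟨j, hj, hE⟩ := hE
    by_cases h : b < μ.real (cell T j)
    · exact Or.inl ⟨j, Finset.mem_filter.2 ⟨hj, h⟩, hE⟩
    · exact Or.inr ⟨j, Finset.mem_filter.2 ⟨hj, h⟩, hE⟩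
  rcases le_total (m / 2) (μ.real (⋃ j ∈ big, cell T j)) with hbm | hbm
  · have hex : ∀ j ∈ J, ∃ N : ℕ, ∀ E ∈ cell T j, ∀ ψ : ℕ → ℂ,
        (∀ n : ℕ, ψ (n + 3) + ψ (n + 1) + (V ((n : ℤ) + 2) : ℂ) * ψ (n + 2) =
          ((E : ℂ) + Complex.I * (1 / T : ℝ)) * ψ (n + 2)) →
        c * T ^ s * ‖ψ 1‖ ^ 2 ≤ ∑ n ∈ Finset.Icc 1 N, (n : ℝ) ^ p * ‖ψ n‖ ^ 2 := by
      intro j hj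
      obtain ⟨F, hFc, hFA⟩ := (Finset.mem_filter.1 hj).2
      obtain ⟨N, hN⟩ := hres T hT₀ hT1 F hFA
      refine ⟨N, fun E hE ψ hψ => hN _ ψ ?_ hψ⟩
      rw [cell, Set.mem_Ico, add_div] at hFc hE
      -- A big cell only meets `A`, so the energy `F` of `A` may differ from `E` by up to the length
      -- `1 / T`; with the imaginary part this gives `|z - F|² ≤ 2/T²`.
      have h2 : (E - F) ^ 2 ≤ (1 / T) ^ 2 := sq_le_sq' (by linarith [hFc.2, hE.1])
        (by linarith [hFc.1, hE.2])
      rw [← Complex.normSq_eq_norm_sq, Complex.normSq_apply]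
      simp only [Complex.sub_im, Complex.sub_re, Complex.add_im, Complex.add_re, Complex.ofReal_im,
        Complex.ofReal_re, Complex.mul_im, Complex.mul_re, Complex.I_re, Complex.I_im]
      calc _ = (E - F) ^ 2 + (1 / T) ^ 2 := by ring
        _ ≤ (1 / T) ^ 2 + (1 / T) ^ 2 := by gcongr
        _ = _ := by ring
    choose! N hN using hex
    refine le_trans (ENNReal.ofReal_le_ofReal ?_) (ofReal_le_moment_of_resolvent (p := p)
      (K := c * T ^ s) hS hT big (by positivity) (J.sup N) fun j hj E hE ψ hψ => ?_)
    · have hsum : b * (m / 2) ≤ ∑ j ∈ big, μ.real (cell T j) ^ 2 := by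
        calc b * (m / 2) ≤ b * ∑ j ∈ big, μ.real (cell T j) := by
              gcongr
              exact hbm.trans (measureReal_biUnion_finset_le _ _)
          _ ≤ _ := by
              rw [Finset.mul_sum]
              refine Finset.sum_le_sum fun j hj => ?_
              rw [sq]
              exact mul_le_mul_of_nonneg_right (Finset.mem_filter.1 hj).2.le measureReal_nonneg
      calc min c₁ c₂ * T ^ (s * p / (p + 1)) ≤ c₁ * T ^ (s * p / (p + 1)) := by
            gcongr; exact min_le_left _ _
        _ = c * T ^ s / (8 * Real.pi) * (b * (m / 2)) := by
            rw [← hsq, sub_eq_add_neg, Real.rpow_add hT, hc₁]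
            ring
        _ ≤ _ := by gcongr
    · have hjJ : j ∈ J := (Finset.mem_filter.1 hj).1
      refine (hN j hjJ E hE ψ hψ).trans ?_
      exact Finset.sum_le_sum_of_subset_of_nonneg
        (Finset.Icc_subset_Icc_right (Finset.le_sup (f := N) hjJ)) fun n _ _ => by positivity
  · set M := μ.real (⋃ j ∈ small, cell T j) with hM
    have hMm : m / 2 ≤ M := by linarith
    have hM0 : 0 < M := by linarith
    have hx1 : 1 ≤ d * T ^ q := by
      rw [div_le_iff₀ hd0] at hTd
      linarith
    have hN1 : 1 ≤ ⌊d * T ^ q⌋₊ := (Nat.one_le_floor_iff _).2 hx1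
    have hNle : (⌊d * T ^ q⌋₊ : ℝ) ≤ d * T ^ q := Nat.floor_le (by positivity)
    have hN1' : (1 : ℝ) ≤ ⌊d * T ^ q⌋₊ := by exact_mod_cast hN1
    have hNge : d / 2 * T ^ q ≤ ⌊d * T ^ q⌋₊ := by
      have := Nat.lt_floor_add_one (d * T ^ q)
      linarith
    refine le_trans (ENNReal.ofReal_le_ofReal ?_) (ofReal_le_moment_of_cell_le hp.le h1 hT small
      hb0.le (fun j hj => ?_) hM0 rfl ⌊d * T ^ q⌋₊ ?_)
    · calc min c₁ c₂ * T ^ (s * p / (p + 1)) ≤ c₂ * T ^ (s * p / (p + 1)) := by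
            gcongr; exact min_le_right _ _
        _ = (d / 2 * T ^ q) ^ p * (m / 2 / 4) := by
            rw [Real.mul_rpow (by positivity) (by positivity), ← Real.rpow_mul hT.le, hqp, hc₂]
            ring
        _ ≤ _ := by gcongr
    · rw [← ofReal_measureReal]
      exact ENNReal.ofReal_le_ofReal (not_lt.1 (Finset.mem_filter.1 hj).2)
    · have hbT : b * T ^ q = 1 := by
        rw [hb, ← Real.rpow_add hT]; simp
      calc 64 * Z * b * (2 * (⌊d * T ^ q⌋₊ : ℝ) + 1) ≤ 64 * Z * b * (3 * (d * T ^ q)) := by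
            gcongr
            linarith
        _ = 192 * Z * d * (b * T ^ q) := by ring
        _ = (m / 2) ^ 2 := by rw [hbT, hd]; field_simp; ring
        _ ≤ M ^ 2 := by gcongr

theorem PowerLawLowerBound.exists_eventually_le_moment {α κ p : ℝ} (hS : Set.Ici 1 ⊆ S) (hα : 0 < α)
    (ha : PowerLawUpperBound S V A α) (hb : ScalingLowerBound S V A)
    (hμ : 0 < spectralMeasure S V (delta S 1) A) (hκ : 0 < κ) (hlow : PowerLawLowerBound S V A κ)
    (hp : 0 < p) (hpα : p ≤ 2 * α + 1) :
    ∃ c : ℝ, 0 < c ∧ ∀ᶠ T in atTop,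
      ENNReal.ofReal (c * T ^ (p * (p + 2 * κ) / ((p + 1) * (α + κ + 1 / 2)))) ≤
        moment S V p T := by
  obtain ⟨W, hW, hWE⟩ := ha.exists_abs_sub_le (hS (by simp))
  obtain ⟨C, hC, hup⟩ := ha
  obtain ⟨k, γ, L₀, hk, hk1, hγ, hγ1, hL₀, hsc⟩ := hb
  obtain ⟨D, L₁, hD, hL₁, hlow⟩ := hlow
  have e : p * (p + 2 * κ) / ((p + 1) * (α + κ + 1 / 2)) =
      (p + 2 * κ) / (α + κ + 1 / 2) * p / (p + 1) := by
    field_simp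
  rw [e]
  refine _root_.exists_eventually_le_moment
    (c := k ^ p * (γ / 16) * min (D ^ 2) (γ ^ 2 / (4096 * C)))
    (T₀ := 64 * C * (max L₀ L₁) ^ (2 * α + 1) / γ) (R := W + |V 1|) hS hp (by positivity)
    (by positivity) hμ (fun E hE => ?_) fun T hT hT1 E hE =>
    exists_moment_le hS hα hκ hC hD hk hk1 hγ hγ1 hL₀ hL₁ hp hpα hT (hup E hE) (hsc E hE)
      (hlow E hE)
  have := abs_add_le (E - V 1) (V 1)
  rw [sub_add_cancel] at this
  linarith [hWE E hE]

/-- The comparison of moments is applied with `R ^ (2α + 1)` equal to half the lower bound at `2α +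
1`; raising to the power `p/(2α + 1)` turns the exponent `(2α + 1)/(α + 1)` into `p/(α + 1)`. -/
theorem le_lowerExponent_of_lt {α p : ℝ} (h1 : (1 : ℤ) ∈ S) (hα : 0 < α) (hp : 2 * α + 1 < p) {c : ℝ}
    (hc : 0 < c) (h : ∀ᶠ T in atTop, ENNReal.ofReal (c * T ^ ((2 * α + 1) / (α + 1))) ≤
      moment S V (2 * α + 1) T) :
    ((p / (α + 1) : ℝ) : EReal) ≤ lowerExponent S V p := by
  have hp₀ : 0 < 2 * α + 1 := by linarith
  refine le_lowerExponent (c := (c / 2) ^ (p / (2 * α + 1))) (by positivity) ?_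
  filter_upwards [h, eventually_gt_atTop 0] with T hT hT0
  set y := c / 2 * T ^ ((2 * α + 1) / (α + 1)) with hy
  have hy0 : 0 < y := by positivity
  have h2 := ofReal_rpow_le_moment (R := y ^ (1 / (2 * α + 1))) hp₀ hp.le h1 hT0 (by positivity) (by
    rw [← Real.rpow_mul hy0.le, one_div_mul_cancel hp₀.ne', Real.rpow_one]
    convert hT using 2
    rw [hy]
    ring)
  convert h2 using 2
  rw [← Real.rpow_mul hy0.le, hy, Real.mul_rpow (by positivity) (by positivity),
    ← Real.rpow_mul hT0.le]
  congr 2 <;> field_simp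

end growth

theorem theorem3 (S : Set ℤ) (hS : S = Set.univ ∨ S = Set.Ici 1) (V : ℤ → ℝ) (A : Set ℝ)
    (α : ℝ) (hα : 0 < α) (ha : PowerLawUpperBound S V A α) (hb : ScalingLowerBound S V A)
    (hμ : 0 < spectralMeasure S V (delta S 1) A) :
    (∃ κ : ℝ, 0 < κ ∧ PowerLawLowerBound S V A κ) ∧
    (∀ κ : ℝ, 0 < κ → PowerLawLowerBound S V A κ → ∀ p : ℝ, 0 < p → p ≤ 2 * α + 1 →
      ((p * (p + 2 * κ) / ((p + 1) * (α + κ + 1 / 2)) : ℝ) : EReal) ≤ lowerExponent S V p) ∧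
    (∀ p : ℝ, 2 * α + 1 < p → ((p / (α + 1) : ℝ) : EReal) ≤ lowerExponent S V p) := by
  have hS1 : Set.Ici 1 ⊆ S := by
    rcases hS with rfl | rfl
    · exact Set.subset_univ _
    · exact subset_rfl
  have h1 : (1 : ℤ) ∈ S := hS1 (by simp)
  have hex := hb.exists_powerLawLowerBound ha h1
  refine ⟨hex, fun κ hκ hlow p hp hpα => ?_, fun p hp => ?_⟩
  · obtain ⟨c, hc, h⟩ := hlow.exists_eventually_le_moment hS1 hα ha hb hμ hκ hp hpα
    exact le_lowerExponent hc h
  · obtain ⟨κ, hκ, hlow⟩ := hex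
    obtain ⟨c, hc, h⟩ := hlow.exists_eventually_le_moment hS1 hα ha hb hμ hκ
      (p := 2 * α + 1) (by linarith) le_rfl
    refine le_lowerExponent_of_lt h1 hα hp hc ?_
    -- At the endpoint `p + 2κ = 2(α + κ + 1/2)`, so `κ` cancels and any admissible `κ` will do.
    have e : (2 * α + 1) * (2 * α + 1 + 2 * κ) / ((2 * α + 1 + 1) * (α + κ + 1 / 2)) =
        (2 * α + 1) / (α + 1) := by
      have : α + κ + 1 / 2 ≠ 0 := by positivity
      rw [div_eq_div_iff (by positivity) (by positivity)]
      ring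
    rwa [e] at h
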